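/- Let $d\ge 1$, let $B_2^d=\{x\in\mathbb R^d:\|x\|_2\le 1\}$ be the closed unit Euclidean ball, and let $\mathcal P_n=\mathcal P_{n,d}$ be the space of real algebraic polynomials of total degree at most $n$ in $d$ variables. For $x\in\mathbb R^d$ put $$C(\mathcal P_n,B_2^d,x)=\sum_{k=1}^N\phi_k(x)^2,\qquad C(\mathcal P_n,B_2^d)=\sup_{x\in B_2^d}C(\mathcal P_n,B_2^d,x),$$ where $\{\phi_k\}_{k=1}^N$ is any basis of $\mathcal P_n$ that is orthonormal for the inner product $\int_{B_2^d}fg\,dx$ with Lebesgue measure (the sum does not depend on the choice of the basis). **Theorem.** 1. There is a constant $c>0$ depending only on $d$ such that $c^{-1}n^{d+1}\le C(\mathcal P_n,B_2^d)\le c\,n^{d+1}$ for all integers $n\ge 1$. 2. For every $n\ge1$, the value $C(\mathcal P_n,B_2^d,x)$ for $\frac12\le\|x\|_2^2\le1$ depends only on $\|x\|_2$; and if $d\ge2$, it is a strictly increasing function of $\|x\|_2$ in this range. 3. For every $a<1$ there is a constant $c>0$ depending only on $d$ and $a$ such that $c^{-1}n^{d}\le C(\mathcal P_n,B_2^d,x)\le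 c\,n^{d}$ for all integers $n\ge 1$ and all $x$ with $\|x\|_2<a$. -/

import Mathlib

open MeasureTheory

/-- `ℝ^d` with the Euclidean norm and Lebesgue measure `volume`. -/
abbrev RSpace (d : ℕ) : Type := EuclideanSpace ℝ (Fin d)

/-- The linear map sending a real polynomial in `d` variables to the function it defines on
`ℝ^d`. -/
noncomputable def polyFun (d : ℕ) : MvPolynomial (Fin d) ℝ →ₗ[ℝ] (RSpace d → ℝ) where
  toFun p := fun x => MvPolynomial.eval (fun i => x i) p
  map_add' p q := by funext x; simp
  map_smul' c p := by funext x; simp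

/-- The space `𝒫_{n,d}` of (functions given by) real algebraic polynomials of total degree `≤ n`
in `d` variables. -/
noncomputable def polySpace (n d : ℕ) : Submodule ℝ (RSpace d → ℝ) :=
  (MvPolynomial.restrictTotalDegree (Fin d) ℝ n).map (polyFun d)

/-- `φ` is a (finite) orthonormal basis of the space `S` of functions on `ℝ^d`, with respect to
the inner product `∫_D f g dμ`. (Orthonormality gives linear independence.) -/
structure IsOrthonormalBasisOn {d : ℕ} (S : Submodule ℝ (RSpace d → ℝ)) (D : Set (RSpace d))
    (μ : Measure (RSpace d)) {N : ℕ} (φ : Fin N → RSpace d → ℝ) : Prop where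
  span_eq : Submodule.span ℝ (Set.range φ) = S
  memLp : ∀ k, MemLp (φ k) 2 (μ.restrict D)
  orthonormal : ∀ j k, ∫ x in D, φ j x * φ k x ∂μ = if j = k then 1 else 0

open Classical in
/-- `C(S, D, μ, x) = ∑ₖ φₖ(x)²` for an orthonormal basis `φ` of `S` on `D` with respect to `μ`.
The value does not depend on the basis: see `christoffelC_eq`. (The value is `0` when
there is no orthonormal basis; `exists_isOrthonormalBasisOn_polySpace` shows that there is one for
polynomials on a ball.) -/
noncomputable def christoffelC {d : ℕ} (S : Submodule ℝ (RSpace d → ℝ)) (D : Set (RSpace d))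
    (μ : Measure (RSpace d)) (x : RSpace d) : ℝ :=
  if h : ∃ (N : ℕ) (φ : Fin N → RSpace d → ℝ), IsOrthonormalBasisOn S D μ φ then
    ∑ k, (h.choose_spec.choose k x) ^ 2
  else 0

/-- `C(S, D) = sup_{x ∈ D} C(S, D, x)`, for Lebesgue measure. -/
noncomputable def christoffelSup {d : ℕ} (S : Submodule ℝ (RSpace d → ℝ))
    (D : Set (RSpace d)) : ℝ :=
  ⨆ x : D, christoffelC S D volume (x : RSpace d)

/-- The closed Euclidean unit ball `B_2^d`. -/
abbrev unitBall (d : ℕ) : Set (RSpace d) := Metric.closedBall 0 1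

theorem IsOrthonormalBasisOn.integral_sq {d : ℕ} {S : Submodule ℝ (RSpace d → ℝ)}
    {D : Set (RSpace d)} {μ : Measure (RSpace d)} {N : ℕ} {φ : Fin N → RSpace d → ℝ}
    (h : IsOrthonormalBasisOn S D μ φ) (a : Fin N → ℝ) :
    ∫ x in D, (∑ k, a k * φ k x) ^ 2 ∂μ = ∑ k, a k ^ 2 := by
  have hint : ∀ j k, Integrable (fun x => (a j * φ j x) * (a k * φ k x)) (μ.restrict D) := by
    intro j k
    have := ((h.memLp j).integrable_mul (h.memLp k)).const_mul (a j * a k)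
    refine this.congr (Filter.Eventually.of_forall fun x => ?_)
    simp only [Pi.mul_apply]; ring
  have e1 : ∀ x, (∑ k, a k * φ k x) ^ 2 = ∑ j, ∑ k, (a j * φ j x) * (a k * φ k x) := by
    intro x; rw [sq, Finset.sum_mul_sum]
  simp_rw [e1]
  rw [integral_finsetSum _ fun j _ => integrable_finsetSum _ fun k _ => hint j k]
  refine Finset.sum_congr rfl fun j _ => ?_
  rw [integral_finsetSum _ fun k _ => hint j k]
  have e2 : ∀ k, ∫ x in D, (a j * φ j x) * (a k * φ k x) ∂μ
      = a j * a k * if j = k then 1 else 0 := by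
    intro k
    rw [← h.orthonormal j k, ← integral_const_mul]
    refine integral_congr_ae (Filter.Eventually.of_forall fun x => ?_)
    simp only []; ring
  simp [e2, sq]

theorem IsOrthonormalBasisOn.sum_sq_le {d : ℕ} {S : Submodule ℝ (RSpace d → ℝ)}
    {D : Set (RSpace d)} {μ : Measure (RSpace d)} {N M : ℕ} {φ : Fin N → RSpace d → ℝ}
    {ψ : Fin M → RSpace d → ℝ} (h : IsOrthonormalBasisOn S D μ φ)
    (h' : IsOrthonormalBasisOn S D μ ψ) (x : RSpace d) :
    ∑ k, ψ k x ^ 2 ≤ ∑ k, φ k x ^ 2 := by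
  have hf : (∑ k, ψ k x • ψ k) ∈ Submodule.span ℝ (Set.range φ) := by
    rw [h.span_eq, ← h'.span_eq]
    exact Submodule.sum_mem _ fun k _ =>
      Submodule.smul_mem _ _ (Submodule.subset_span ⟨k, rfl⟩)
  obtain ⟨a, ha⟩ := (Submodule.mem_span_range_iff_exists_fun ℝ).1 hf
  have hv : ∀ y, ∑ k, a k * φ k y = ∑ k, ψ k x * ψ k y := by
    intro y; simpa using congrFun ha y
  have hn : ∑ k, a k ^ 2 = ∑ k, ψ k x ^ 2 := by
    rw [← h.integral_sq a, ← h'.integral_sq fun k => ψ k x]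
    simp_rw [hv]
  have hx : ∑ k, a k * φ k x = ∑ k, ψ k x ^ 2 := by
    rw [hv x]; simp_rw [sq]
  have cs := Finset.sum_mul_sq_le_sq_mul_sq Finset.univ a fun k => φ k x
  rw [hx, hn] at cs
  have h0 : 0 ≤ ∑ k, ψ k x ^ 2 := Finset.sum_nonneg fun k _ => sq_nonneg _
  have h1 : 0 ≤ ∑ k, φ k x ^ 2 := Finset.sum_nonneg fun k _ => sq_nonneg _
  rcases h0.eq_or_lt with h0 | h0
  · rw [← h0]; exact h1
  · rw [sq] at cs
    exact le_of_mul_le_mul_left cs h0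

/-- `C(S, D, μ, x)` may be computed with any orthonormal basis. -/
theorem christoffelC_eq {d : ℕ} {S : Submodule ℝ (RSpace d → ℝ)} {D : Set (RSpace d)}
    {μ : Measure (RSpace d)} {N : ℕ} {φ : Fin N → RSpace d → ℝ}
    (h : IsOrthonormalBasisOn S D μ φ) (x : RSpace d) :
    christoffelC S D μ x = ∑ k, φ k x ^ 2 := by
  have hex : ∃ (N : ℕ) (φ : Fin N → RSpace d → ℝ), IsOrthonormalBasisOn S D μ φ := ⟨N, φ, h⟩
  rw [christoffelC, dif_pos hex]
  have h' := hex.choose_spec.choose_spec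
  exact le_antisymm (h.sum_sq_le h' x) (h'.sum_sq_le h x)

/-- An orthonormal basis exists when `∫_D f g dμ` is an inner product on the finite-dimensional
space `S`. -/
theorem exists_isOrthonormalBasisOn {d : ℕ} (S : Submodule ℝ (RSpace d → ℝ))
    [FiniteDimensional ℝ S] (D : Set (RSpace d)) (μ : Measure (RSpace d))
    (hS : ∀ f ∈ S, MemLp f 2 (μ.restrict D)) (h0 : ∀ f ∈ S, f =ᵐ[μ.restrict D] 0 → f = 0) :
    ∃ (N : ℕ) (φ : Fin N → RSpace d → ℝ), IsOrthonormalBasisOn S D μ φ := by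
  let T : S →ₗ[ℝ] Lp ℝ 2 (μ.restrict D) :=
    { toFun := fun f => (hS f f.2).toLp f
      map_add' := fun f g => MemLp.toLp_add (hS f f.2) (hS g g.2)
      map_smul' := fun c f => MemLp.toLp_const_smul c (hS f f.2) }
  have hT : Function.Injective T := by
    rw [← LinearMap.ker_eq_bot, LinearMap.ker_eq_bot']
    intro f hf
    have := (MemLp.toLp_eq_toLp_iff (hS f f.2) (MemLp.zero' (ε := ℝ))).1
      (hf.trans (MemLp.toLp_zero _).symm)
    exact Subtype.ext (h0 f f.2 this)
  let e : S ≃ₗ[ℝ] LinearMap.range T := LinearEquiv.ofInjective T hT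
  let b := stdOrthonormalBasis ℝ (LinearMap.range T)
  refine ⟨_, fun k => (e.symm (b k) : RSpace d → ℝ), ?_, fun k => hS _ (e.symm (b k)).2, ?_⟩
  · have h1 : Submodule.span ℝ (Set.range fun k => e.symm (b k)) = ⊤ := by
      have h := (b.toBasis.map e.symm).span_eq
      have hr : (fun k => e.symm (b k)) = ⇑(b.toBasis.map e.symm) := by
        funext k; simp
      rw [hr]; exact h
    have h2 := congrArg (Submodule.map S.subtype) h1
    rw [Submodule.map_span, ← Set.range_comp, Submodule.map_top, Submodule.range_subtype] at h2
    exact h2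
  · intro j k
    have ho := orthonormal_iff_ite.1 b.orthonormal j k
    have he : ∀ j, (((b j : LinearMap.range T)) : Lp ℝ 2 (μ.restrict D))
        = (hS _ (e.symm (b j)).2).toLp _ := by
      intro j
      have : e (e.symm (b j)) = b j := e.apply_symm_apply _
      exact (congrArg Subtype.val this).symm
    rw [← ho, Submodule.coe_inner, L2.inner_def, he j, he k]
    refine integral_congr_ae ?_
    filter_upwards [(hS _ (e.symm (b j)).2).coeFn_toLp, (hS _ (e.symm (b k)).2).coeFn_toLp]
      with x hx hy
    rw [hx, hy]
    exact mul_comm _ _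

theorem continuous_polyFun {d : ℕ} (p : MvPolynomial (Fin d) ℝ) : Continuous (polyFun d p) := by
  show Continuous fun x : RSpace d => MvPolynomial.eval (fun i => x i) p
  exact p.continuous_eval.comp (by fun_prop)

/-- Polynomials of degree `≤ n` have an orthonormal basis on the unit ball. -/
theorem exists_isOrthonormalBasisOn_polySpace (n d : ℕ) :
    ∃ (N : ℕ) (φ : Fin N → RSpace d → ℝ),
      IsOrthonormalBasisOn (polySpace n d) (unitBall d) volume φ := by
  have : FiniteDimensional ℝ (polySpace n d) := by unfold polySpace; infer_instance
  refine exists_isOrthonormalBasisOn _ _ _ ?_ ?_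
  · rintro f ⟨p, -, rfl⟩
    have hc := continuous_polyFun p
    obtain ⟨C, hC⟩ := (isCompact_closedBall (0 : RSpace d) 1).exists_bound_of_continuousOn
      hc.continuousOn
    have : IsFiniteMeasure (volume.restrict (unitBall d)) :=
      ⟨by simpa using measure_closedBall_lt_top⟩
    exact MemLp.of_bound hc.aestronglyMeasurable C
      ((ae_restrict_iff' measurableSet_closedBall).2 (Filter.Eventually.of_forall hC))
  · rintro f ⟨p, -, rfl⟩ hf
    have hc := continuous_polyFun p
    have hb : Set.EqOn (polyFun d p) 0 (Metric.ball 0 1) := by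
      refine Measure.eqOn_open_of_ae_eq (μ := volume) ?_ Metric.isOpen_ball hc.continuousOn
        continuousOn_const
      exact ae_restrict_of_ae_restrict_of_subset Metric.ball_subset_closedBall hf
    have hopen : IsOpen ((WithLp.ofLp : RSpace d → Fin d → ℝ) '' Metric.ball 0 1) :=
      (PiLp.homeomorph 2 fun _ : Fin d => ℝ).isOpenMap _ Metric.isOpen_ball
    have h0 : (0 : Fin d → ℝ) ∈ (WithLp.ofLp : RSpace d → Fin d → ℝ) '' Metric.ball 0 1 :=
      ⟨0, by simp, rfl⟩
    obtain ⟨ε, hε, hsub⟩ := Metric.isOpen_iff.1 hopen 0 h0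
    have hp : p = 0 := by
      refine MvPolynomial.funext_set (fun _ => Metric.ball (0 : ℝ) ε) (fun _ => ?_) ?_
      · rw [Real.ball_eq_Ioo]; exact Set.Ioo_infinite (by linarith)
      · intro x hx
        have : x ∈ Metric.ball (0 : Fin d → ℝ) ε := by
          rw [ball_pi _ hε]; exact hx
        obtain ⟨y, hy, rfl⟩ := hsub this
        simpa [polyFun] using hb hy
    simp [hp]

/-! Everything rests on a closed formula for the reproducing kernel. The weight `(1 - t² -
|y|²)^{-1/2}` on the unit ball of `ℝ × ℝ^d` is rotation invariant, and integrating out `t` gives `π`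
times Lebesgue measure on `B_2^d`. Rotating the direction `(√(1-|x|²), x)` to the first axis and
averaging over the other variables turns a polynomial of degree `≤ n` into a one-variable polynomial
of degree `≤ n`. Against the weight `sin^d φ dφ`, evaluation of such a polynomial at `1` is
represented by `Z_n = C_n^ν + C_{n-1}^ν`, `ν = d/2 + 1`, up to a constant. On the diagonal
(`zonalConst_mul_christoffelC`), up to the factor `zonalConst d`, the Christoffel function is `∫_0^π
Z_n(|x|² + (1-|x|²) cos φ) dφ`.

Growth. Expanding `C_n^ν` in the `C_j^1 = U_j` with nonnegative coefficients gives `|C_n^ν(u)| ≤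
C_n^ν(1)`, hence the upper bound of order `n^{d+1}`, attained in order at `|x| = 1`. The same
expansion gives order at least `n^d` at the centre. Comparing concentric and translated balls yields
`C(0) ≤ 2^d C(w)` and `C(x) ≤ (1-|x|)^{-d} C(0)`, while `∫ C` is the dimension of the space; this
settles the interior.

Monotonicity. With `t = 2(1 - |x|²)`, which runs over `[0, 1]` exactly when `1/2 ≤ |x|² ≤ 1`, the
integral is `π` times the mean `abelMean` of `w ↦ Z_n(1 - w)` at `t`, and it must be strictly
decreasing. For `d ≥ 2` one has `ν ≥ 2`, so `C_n^ν` is a nonnegative combination of the `C_m^2 =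
U'_{m+1}/2`, and the question becomes the sign of `abelE ℓ`, the negative derivative of the mean of
`U'_ℓ(1 - w)`. It is positive on `(0, 1)` for all `ℓ ≥ 2` except `ℓ = 5`, where a neighbouring term
makes up for the defect (`gegE_add_pos`).

For `ℓ ≤ 11` positivity is certified on explicit polynomials. For `ℓ ≥ 12` and `x = 1 - cos θ` with
`(ℓ-1)θ ≤ π`, the integrand itself is positive. For larger `θ`, `abelE` is a combination of three
means `P`, `Q`, `S` solving a first-order system: an increasing Sonin energy bounds the oscillating
pair, a slowly varying combination stays near `1`, and Cauchy–Schwarz (`osc_pos`) shows that the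
latter dominates. -/

/-! ### Gegenbauer polynomials: recurrence, parameter raising, differential equation, connection
coefficients. -/

open Polynomial in
/-- Gegenbauer polynomials `C_n^κ`. -/
noncomputable def gegenbauer (κ : ℝ) : ℕ → ℝ[X]
  | 0 => 1
  | 1 => C (2 * κ) * X
  | n + 2 => C (1 / ((n : ℝ) + 2)) * (C (2 * (n + 1 + κ)) * X * gegenbauer κ (n + 1)
      - C ((n : ℝ) + 2 * κ) * gegenbauer κ n)

/-- The values `C_m^κ(u)`, with the convention `C_m^κ = 0` for `m < 0`. -/
noncomputable def geg (κ : ℝ) (m : ℤ) (u : ℝ) : ℝ :=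
  if m < 0 then 0 else (gegenbauer κ m.toNat).eval u

theorem geg_natCast (κ : ℝ) (n : ℕ) (u : ℝ) : geg κ n u = (gegenbauer κ n).eval u := by
  simp [geg]

theorem geg_of_neg {κ : ℝ} {m : ℤ} (h : m < 0) (u : ℝ) : geg κ m u = 0 := by
  simp [geg, h]

@[simp] theorem geg_zero (κ u : ℝ) : geg κ 0 u = 1 := by simp [geg, gegenbauer]

@[simp] theorem geg_one (κ u : ℝ) : geg κ 1 u = 2 * κ * u := by simp [geg, gegenbauer]

/-- The zero convention at negative indices is consistent with the recurrence, also at `m = -1` and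
`m = -2`; this is why the index is an integer, and it spares later identities their boundary cases.
-/
theorem geg_rec (κ : ℝ) (m : ℤ) (u : ℝ) :
    (m + 2) * geg κ (m + 2) u = 2 * (m + 1 + κ) * u * geg κ (m + 1) u - (m + 2 * κ) * geg κ m u := by
  rcases lt_or_ge m 0 with h | h
  · rcases lt_trichotomy m (-2) with h2 | rfl | h2
    · rw [geg_of_neg (by lia), geg_of_neg (by lia), geg_of_neg (by lia)]; simp
    · rw [geg_of_neg (m := -2 + 1) (by lia), geg_of_neg (m := -2) (by lia)]; simp
    · obtain rfl : m = -1 := by lia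
      rw [geg_of_neg (m := -1) (by lia)]; norm_num
  · obtain ⟨n, rfl⟩ := Int.eq_ofNat_of_zero_le h
    have e2 : ((n : ℤ) + 2) = ((n + 2 : ℕ) : ℤ) := by push_cast; ring
    have e1 : ((n : ℤ) + 1) = ((n + 1 : ℕ) : ℤ) := by push_cast; ring
    rw [e2, e1, geg_natCast, geg_natCast, geg_natCast, gegenbauer]
    have : (n : ℝ) + 2 ≠ 0 := by positivity
    simp
    field_simp

/-- The two identities are proved in one induction because each step of the first uses both earlier
ones, and the second then follows from the first and the recurrence at `κ + 1`. -/
theorem geg_raise_aux (κ : ℝ) (n : ℕ) (u : ℝ) :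
    (n * geg κ n u = 2 * κ * (u * geg (κ + 1) (n - 1) u - geg (κ + 1) (n - 2) u)) ∧
    ((n + 2 * κ) * geg κ n u = 2 * κ * (geg (κ + 1) n u - u * geg (κ + 1) (n - 1) u)) := by
  induction n using Nat.strong_induction_on with
  | _ n ih =>
    rcases n with _ | _ | n
    · simp [geg_of_neg]
    · norm_num [geg_of_neg]; ring
    · obtain ⟨p0, q0⟩ := ih n (by lia)
      obtain ⟨p1, q1⟩ := ih (n + 1) (by lia)
      have r := geg_rec κ n u
      have rb := geg_rec (κ + 1) n u
      have rc := geg_rec (κ + 1) (n - 1) u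
      push_cast at *
      have e1 : ((n : ℤ) + 1 + 1) = n + 2 := by ring
      have e2 : ((n : ℤ) + 1 - 1) = n := by ring
      have e3 : ((n : ℤ) + 1 - 2) = n - 1 := by ring
      have e4 : ((n : ℤ) + 2 - 2) = n := by ring
      have e5 : ((n : ℤ) + 2 - 1) = n + 1 := by ring
      have e6 : ((n : ℤ) - 1 + 2) = n + 1 := by ring
      have e7 : ((n : ℤ) - 1 + 1) = n := by ring
      simp only [e1, e2, e3, e4, e5, e6, e7] at *
      have P : ((n : ℝ) + 2) * geg κ (n + 2) u
          = 2 * κ * (u * geg (κ + 1) (n + 1) u - geg (κ + 1) n u) := by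
        linear_combination r + u * p1 + u * q1 - q0
      have e8 : (n : ℝ) + 1 + 1 = n + 2 := by ring
      rw [e8]
      refine ⟨P, ?_⟩
      have h2 : (n : ℝ) + 2 ≠ 0 := by positivity
      apply mul_left_cancel₀ h2
      linear_combination (n + 2 + 2 * κ) * P - 2 * κ * rb

theorem geg_raise_left (κ : ℝ) (m : ℤ) (u : ℝ) :
    m * geg κ m u = 2 * κ * (u * geg (κ + 1) (m - 1) u - geg (κ + 1) (m - 2) u) := by
  rcases lt_or_ge m 0 with h | h
  · rw [geg_of_neg h, geg_of_neg (by lia), geg_of_neg (by lia)]; simp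
  · obtain ⟨n, rfl⟩ := Int.eq_ofNat_of_zero_le h
    exact_mod_cast (geg_raise_aux κ n u).1

theorem geg_raise_right (κ : ℝ) (m : ℤ) (u : ℝ) :
    (m + 2 * κ) * geg κ m u = 2 * κ * (geg (κ + 1) m u - u * geg (κ + 1) (m - 1) u) := by
  rcases lt_or_ge m 0 with h | h
  · rw [geg_of_neg h, geg_of_neg (by lia), geg_of_neg (by lia)]; simp
  · obtain ⟨n, rfl⟩ := Int.eq_ofNat_of_zero_le h
    exact_mod_cast (geg_raise_aux κ n u).2

theorem geg_raise (κ : ℝ) (m : ℤ) (u : ℝ) :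
    (m + κ) * geg κ m u = κ * (geg (κ + 1) m u - geg (κ + 1) (m - 2) u) := by
  linear_combination (geg_raise_left κ m u + geg_raise_right κ m u) / 2

theorem hasDerivAt_geg (κ : ℝ) (m : ℤ) (u : ℝ) :
    HasDerivAt (geg κ m) (2 * κ * geg (κ + 1) (m - 1) u) u := by
  rcases lt_or_ge m 0 with h | h
  · rw [geg_of_neg (by lia)]
    have : geg κ m = fun _ => 0 := funext fun u => geg_of_neg h u
    rw [this]; simpa using hasDerivAt_const u (0 : ℝ)
  · obtain ⟨n, rfl⟩ := Int.eq_ofNat_of_zero_le h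
    clear h
    induction n using Nat.strong_induction_on with
    | _ n ih =>
      rcases n with _ | _ | n
      · have : geg κ ((0 : ℕ) : ℤ) = fun _ => 1 := by funext u; simp
        rw [this, geg_of_neg (by simp)]; simpa using hasDerivAt_const u (1 : ℝ)
      · have : geg κ ((0 + 1 : ℕ) : ℤ) = fun u => 2 * κ * u := by funext u; simp
        rw [this]; simpa using (hasDerivAt_id u).const_mul (2 * κ)
      · have h0 := ih n (by lia)
        have h1 := ih (n + 1) (by lia)
        have h2 : (n : ℝ) + 2 ≠ 0 := by positivity
        have : geg κ ((n + 1 + 1 : ℕ) : ℤ) = fun u => (2 * (n + 1 + κ) * (u * geg κ ((n + 1 : ℕ) : ℤ) u)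
            - (n + 2 * κ) * geg κ n u) / (n + 2) := by
          funext u
          have := geg_rec κ n u
          push_cast at *
          have e1 : ((n : ℤ) + 1 + 1) = n + 2 := by ring
          rw [e1]; field_simp; linear_combination this
        rw [this]
        have hd := ((((hasDerivAt_id u).mul h1).const_mul (2 * (n + 1 + κ))).sub
          (h0.const_mul (n + 2 * κ))).div_const (n + 2)
        refine hd.congr_deriv ?_
        have r := geg_raise κ (n + 1) u
        have s := geg_rec (κ + 1) (n - 1) u
        have e2 : ((n : ℤ) + 1 - 2) = n - 1 := by ring
        have e6 : ((n : ℤ) - 1 + 2) = n + 1 := by ring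
        have e7 : ((n : ℤ) - 1 + 1) = n := by ring
        have e8 : ((n : ℤ) + 1 - 1) = n := by ring
        have e9 : ((n : ℤ) + 1 + 1 - 1) = n + 1 := by ring
        push_cast at *
        simp only [e2, e6, e7, e8, e9, id] at *
        field_simp
        linear_combination r - κ * s

/-- Gegenbauer's differential equation, with first and second derivatives replaced by values at the
parameters `κ + 1` and `κ + 2`. -/
theorem geg_ode (κ : ℝ) (m : ℤ) (u : ℝ) :
    (1 - u ^ 2) * (4 * κ * (κ + 1) * geg (κ + 2) (m - 2) u)
      - (2 * κ + 1) * u * (2 * κ * geg (κ + 1) (m - 1) u) + m * (m + 2 * κ) * geg κ m u = 0 := by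
  have h1 := geg_raise_left κ m u
  have h2 := geg_raise_left (κ + 1) (m - 1) u
  have h3 := geg_raise_right (κ + 1) (m - 2) u
  have e1 : m - 1 - 1 = m - 2 := by ring
  have e2 : m - 1 - 2 = m - 2 - 1 := by ring
  have e3 : κ + 1 + 1 = κ + 2 := by ring
  simp only [e1, e2, e3] at *
  push_cast at *
  linear_combination (m + 2 * κ) * h1 + 2 * κ * u * h2 - 2 * κ * h3

/-- Coefficients of the expansion of `C_n^ν` in the `C_{n-2k}^κ`, up to the factor `κ + n - 2k`. -/
noncomputable def gegCoeff (κ ν : ℝ) (n k : ℕ) : ℝ :=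
  (∏ i ∈ Finset.range k, (ν - κ + i)) * (∏ i ∈ Finset.range (n - k), (ν + i)) /
    (k.factorial * ∏ i ∈ Finset.range (n - k + 1), (κ + i))

/-- Induction along the recurrence in `n`. Any length `N > n` is allowed since surplus terms have
negative index and vanish; this freedom aligns the shifted sums coming from degrees `n` and `n + 1`.
-/
theorem geg_connection_aux {κ : ℝ} (hκ : 0 < κ) (ν : ℝ) (u : ℝ) (n : ℕ) : ∀ N, n < N →
    geg ν n u = ∑ k ∈ Finset.range N, (κ + n - 2 * k) * gegCoeff κ ν n k * geg κ (n - 2 * k) u := by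
  have hsing : ∀ (n N : ℕ), 0 < N → n < 2 → ∑ k ∈ Finset.range N,
      (κ + n - 2 * k) * gegCoeff κ ν n k * geg κ (n - 2 * k) u
      = (κ + n) * gegCoeff κ ν n 0 * geg κ n u := by
    intro n N hN hn
    rw [Finset.sum_eq_single_of_mem 0 (by simpa using hN)]
    · simp
    · intro b _ hb
      rw [geg_of_neg (by lia)]; simp
  induction n using Nat.strong_induction_on with
  | _ n ih =>
    rcases n with _ | _ | n
    · intro N hN
      rw [hsing _ _ (by lia) (by lia)]; simp [gegCoeff]; field_simp
    · intro N hN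
      rw [hsing _ _ (by lia) (by lia)]; simp [gegCoeff, Finset.prod_range_succ]; field_simp
    · intro M hM
      obtain ⟨N, rfl⟩ : ∃ N, M = N + 1 := ⟨M - 1, by lia⟩
      have h1 := ih (n + 1) (by lia) (N + 1) (by lia)
      have h1' := ih (n + 1) (by lia) N (by lia)
      have h0 := ih n (by lia) N (by lia)
      have r := geg_rec ν n u
      have h2 : (n : ℝ) + 2 ≠ 0 := by positivity
      apply mul_left_cancel₀ h2
      have e1 : ((n + 1 + 1 : ℕ) : ℤ) = n + 2 := by push_cast; ring
      have e2 : ((n + 1 : ℕ) : ℤ) = n + 1 := by push_cast; ring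
      have e0 : ((n : ℤ) : ℝ) = n := by simp
      rw [e0] at r
      rw [e1, r]
      rw [e2] at h1 h1'
      -- Multiplication by `u` in the target basis; the factor `κ + j` is why the coefficients carry
      -- `κ + n - 2k` separately.
      have lad : ∀ j : ℤ, 2 * (κ + j) * (u * geg κ j u)
          = (j + 1) * geg κ (j + 1) u + (j + 2 * κ - 1) * geg κ (j - 1) u := by
        intro j
        have := geg_rec κ (j - 1) u
        rw [show j - 1 + 2 = j + 1 by ring, show j - 1 + 1 = j by ring] at this
        push_cast at this
        linear_combination -this
      have split : 2 * (u * geg ν (n + 1) u) =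
          ∑ k ∈ Finset.range (N + 1), gegCoeff κ ν (n + 1) k * ((n + 2 - 2 * k) * geg κ (n + 2 - 2 * k) u)
          + ∑ k ∈ Finset.range N, gegCoeff κ ν (n + 1) k * ((n - 2 * k + 2 * κ) * geg κ (n - 2 * k) u) := by
        have ext : ∑ k ∈ Finset.range N, gegCoeff κ ν (n + 1) k * ((n - 2 * k + 2 * κ) * geg κ (n - 2 * k) u)
            = ∑ k ∈ Finset.range (N + 1), gegCoeff κ ν (n + 1) k * ((n - 2 * k + 2 * κ) * geg κ (n - 2 * k) u) := by
          rw [Finset.sum_range_succ, geg_of_neg (m := (n : ℤ) - 2 * (N : ℤ)) (by lia)]; simp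
        rw [ext, ← Finset.sum_add_distrib, h1, Finset.mul_sum, Finset.mul_sum]
        refine Finset.sum_congr rfl fun k _ => ?_
        have := lad (n + 1 - 2 * k)
        rw [show (n : ℤ) + 1 - 2 * k + 1 = n + 2 - 2 * k by ring,
          show (n : ℤ) + 1 - 2 * k - 1 = n - 2 * k by ring] at this
        push_cast at *
        linear_combination gegCoeff κ ν (n + 1) k * this
      rw [h0, show 2 * ((n : ℝ) + 1 + ν) * u * geg ν (n + 1) u
        = (n + 1 + ν) * (2 * (u * geg ν (n + 1) u)) by ring, split]
      rw [Finset.sum_range_succ', Finset.sum_range_succ']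
      simp only [mul_add, Finset.mul_sum]
      -- Comparison of the coefficients of `C_{n-2k}^κ`, an identity between ratios of Pochhammer
      -- products; for `n < 2k` both sides vanish.
      have step : ∀ k ∈ Finset.range N,
          (n + 1 + ν) * (gegCoeff κ ν (n + 1) (k + 1) * ((n + 2 - 2 * ((k + 1 : ℕ) : ℝ)) *
            geg κ (n + 2 - 2 * ((k + 1 : ℕ) : ℤ)) u))
          + (n + 1 + ν) * (gegCoeff κ ν (n + 1) k * ((n - 2 * k + 2 * κ) * geg κ (n - 2 * k) u))
          - (n + 2 * ν) * ((κ + n - 2 * k) * gegCoeff κ ν n k * geg κ (n - 2 * k) u)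
          = ((n : ℝ) + 2) * ((κ + ((n + 1 + 1 : ℕ) : ℝ) - 2 * ((k + 1 : ℕ) : ℝ)) *
            gegCoeff κ ν (n + 1 + 1) (k + 1) * geg κ (n + 2 - 2 * ((k + 1 : ℕ) : ℤ)) u) := by
        intro k _
        have e3 : (n : ℤ) + 2 - 2 * ((k + 1 : ℕ) : ℤ) = n - 2 * k := by push_cast; ring
        rw [e3]
        rcases lt_or_ge ((n : ℤ) - 2 * k) 0 with hneg | hpos
        · simp [geg_of_neg hneg]
        · obtain ⟨i, rfl⟩ : ∃ i, n = k + i := ⟨n - k, by lia⟩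
          have hpr : ∀ m : ℕ, 0 < ∏ i ∈ Finset.range m, (κ + i) :=
            fun m => Finset.prod_pos fun i _ => by positivity
          have hp := hpr i
          have hi : 0 < κ + i := by positivity
          have hi1 : 0 < κ + (i + 1) := by positivity
          have hf : (0 : ℝ) < k.factorial := by positivity
          have hk : (0 : ℝ) < (k : ℝ) + 1 := by positivity
          have s1 : k + i + 1 - (k + 1) = i := by lia
          have s2 : k + i + 1 - k = i + 1 := by lia
          have s3 : k + i + 1 + 1 - (k + 1) = i + 1 := by lia
          have s4 : k + i - k = i := by lia
          simp only [gegCoeff, s1, s2, s3, s4, Finset.prod_range_succ, Nat.factorial_succ]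
          generalize (∏ x ∈ Finset.range i, (κ + (x : ℝ))) = A at *
          generalize (∏ x ∈ Finset.range i, (ν + (x : ℝ))) = B
          generalize (∏ x ∈ Finset.range k, (ν - κ + (x : ℝ))) = D
          push_cast
          field_simp
          ring
      have key := Finset.sum_congr rfl step
      rw [Finset.sum_sub_distrib, Finset.sum_add_distrib] at key
      have z : ((n : ℝ) + 1 + ν) * (gegCoeff κ ν (n + 1) 0 * ((n + 2 - 2 * ((0 : ℕ) : ℝ)) *
            geg κ (n + 2 - 2 * ((0 : ℕ) : ℤ)) u))
          = ((n : ℝ) + 2) * ((κ + ((n + 1 + 1 : ℕ) : ℝ) - 2 * ((0 : ℕ) : ℝ)) *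
            gegCoeff κ ν (n + 1 + 1) 0 * geg κ (n + 2 - 2 * ((0 : ℕ) : ℤ)) u) := by
        have hp : 0 < ∏ i ∈ Finset.range n, (κ + (i : ℝ)) :=
          Finset.prod_pos fun i _ => by positivity
        have hi : 0 < κ + n := by positivity
        have hi1 : 0 < κ + (n + 1) := by positivity
        have hi2 : 0 < κ + (n + 1 + 1) := by positivity
        simp only [gegCoeff, Nat.sub_zero, Finset.prod_range_succ]
        simp
        field_simp
        ring
      linear_combination key + z

theorem gegCoeff_nonneg {κ ν : ℝ} (hκ : 0 < κ) (h : κ ≤ ν) (n k : ℕ) : 0 ≤ gegCoeff κ ν n k := by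
  refine div_nonneg (mul_nonneg (Finset.prod_nonneg fun i _ => ?_)
    (Finset.prod_nonneg fun i _ => ?_)) (mul_nonneg (by positivity) (Finset.prod_nonneg fun i _ => ?_))
  · have : (0 : ℝ) ≤ i := by positivity
    linarith
  · have : (0 : ℝ) ≤ i := by positivity
    linarith
  · positivity

theorem geg_connection {κ : ℝ} (hκ : 0 < κ) (ν : ℝ) (u : ℝ) (n : ℕ) :
    geg ν n u = ∑ k ∈ Finset.range (n / 2 + 1),
      (κ + n - 2 * k) * gegCoeff κ ν n k * geg κ ((n - 2 * k : ℕ) : ℤ) u := by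
  rw [geg_connection_aux hκ ν u n (n + 1) (by lia)]
  symm
  refine (Finset.sum_congr rfl fun k hk => ?_).trans
    (Finset.sum_subset (Finset.range_mono (by lia)) fun k _ hk => ?_)
  · rw [Finset.mem_range] at hk
    rw [Nat.cast_sub (by lia)]; simp
  · rw [Finset.mem_range] at hk
    rw [geg_of_neg (by lia)]; simp

/-! ### The mean `abelMean` and the differential system for the means of Chebyshev polynomials. -/

section AbelMean

open Polynomial

/-- The Wallis ratios `∏_{i<j} (2i+1)/(2i+2)`. -/
noncomputable def wallisRatio (j : ℕ) : ℝ := ∏ i ∈ Finset.range j, (2 * (i : ℝ) + 1) / (2 * i + 2)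

@[simp] theorem wallisRatio_zero : wallisRatio 0 = 1 := by simp [wallisRatio]

theorem wallisRatio_succ (j : ℕ) :
    wallisRatio (j + 1) * (2 * j + 2) = wallisRatio j * (2 * j + 1) := by
  rw [wallisRatio, Finset.prod_range_succ, ← wallisRatio]
  have : (2 * (j : ℝ) + 2) ≠ 0 := by positivity
  field_simp

theorem wallisRatio_pos (j : ℕ) : 0 < wallisRatio j :=
  Finset.prod_pos fun i _ => by positivity

/-- The mean `f ↦ (x ↦ π⁻¹ ∫_0^π f (x (1 - cos φ) / 2) dφ)` on polynomials. -/
noncomputable def abelMean : ℝ[X] →ₗ[ℝ] ℝ[X] :=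
  Polynomial.lsum fun j => wallisRatio j • Polynomial.monomial j

theorem coeff_abelMean (f : ℝ[X]) (j : ℕ) : (abelMean f).coeff j = wallisRatio j * f.coeff j := by
  induction f using Polynomial.induction_on' with
  | add p q hp hq => rw [map_add, coeff_add, hp, hq, coeff_add]; ring
  | monomial n a =>
    rw [abelMean, lsum_apply, sum_monomial_index _ _ (by simp)]
    by_cases h : n = j
    · subst h; simp
    · simp [coeff_monomial, h]

theorem X_mul_derivative_abelMean (f : ℝ[X]) :
    X * derivative (abelMean f) = abelMean (X * derivative f) := by
  ext j
  rcases j with _ | j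
  · simp [coeff_abelMean]
  · simp only [coeff_X_mul, coeff_derivative, coeff_abelMean]; ring

/-- The ratio `(2j+1)/(2j+2)` of consecutive Wallis numbers turns a factor `X` under the mean into
the first-order operator `2X d/dX + 1`. This and the commutation with `X d/dX` are all that the mean
contributes to the differential equations below. -/
theorem two_mul_derivative_abelMean_X_mul (f : ℝ[X]) :
    2 * derivative (abelMean (X * f)) = abelMean (2 * X * derivative f + f) := by
  have h2 : (2 : ℝ[X]) = C 2 := rfl
  ext j
  rw [h2, coeff_C_mul, coeff_derivative, coeff_abelMean, coeff_X_mul, coeff_abelMean, coeff_add,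
    ← h2, mul_assoc (2 : ℝ[X]), h2, coeff_C_mul]
  have := wallisRatio_succ j
  have e : (X * derivative f).coeff j = j * f.coeff j := by
    rcases j with _ | j
    · simp
    · simp only [coeff_X_mul, coeff_derivative]; push_cast; ring
  rw [e]
  linear_combination f.coeff j * this

theorem X_mul_abelMean (f : ℝ[X]) :
    X * abelMean (2 * X * derivative f + f) = abelMean (2 * (X ^ 2 * derivative f + X * f)) := by
  have h2 : (2 : ℝ[X]) = C 2 := rfl
  ext j
  rcases j with _ | j
  · simp [coeff_abelMean, pow_two]
  · have e : (X * derivative f).coeff j = j * f.coeff j := by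
      rcases j with _ | j
      · simp
      · simp only [coeff_X_mul, coeff_derivative]; push_cast; ring
    have := wallisRatio_succ j
    rw [coeff_X_mul, coeff_abelMean, coeff_abelMean, h2, coeff_C_mul, coeff_add, coeff_add, mul_assoc,
      coeff_C_mul, e, pow_two, mul_assoc, coeff_X_mul, e, coeff_X_mul]
    linear_combination -f.coeff j * this

theorem integral_sin_half_pow (j : ℕ) :
    ∫ φ in (0 : ℝ)..Real.pi, ((1 - Real.cos φ) / 2) ^ j = Real.pi * wallisRatio j := by
  have h1 : ∀ φ : ℝ, ((1 - Real.cos φ) / 2) ^ j = Real.sin (φ / 2) ^ (2 * j) := by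
    intro φ
    rw [pow_mul, Real.sin_sq, Real.cos_sq]
    congr 1
    rw [show 2 * (φ / 2) = φ by ring]; ring
  simp_rw [h1]
  rw [intervalIntegral.integral_comp_div (fun x => Real.sin x ^ (2 * j)) (by norm_num : (2 : ℝ) ≠ 0)]
  have hi : ∀ a b : ℝ, IntervalIntegrable (fun x => Real.sin x ^ (2 * j)) volume a b :=
    fun a b => (by fun_prop : Continuous fun x => Real.sin x ^ (2 * j)).intervalIntegrable _ _
  have h2 := integral_sin_pow_even j
  rw [← intervalIntegral.integral_add_adjacent_intervals (hi 0 (Real.pi / 2)) (hi _ _)] at h2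
  have h3 := intervalIntegral.integral_comp_sub_left (a := 0) (b := Real.pi / 2)
    (fun x => Real.sin x ^ (2 * j)) Real.pi
  simp only [Real.sin_pi_sub, sub_zero] at h3
  rw [show Real.pi - Real.pi / 2 = Real.pi / 2 by ring] at h3
  rw [← h3] at h2
  rw [zero_div, wallisRatio, ← h2, smul_eq_mul]; ring

theorem integral_eval_eq_abelMean (f : ℝ[X]) (x : ℝ) :
    ∫ φ in (0 : ℝ)..Real.pi, f.eval (x * ((1 - Real.cos φ) / 2))
      = Real.pi * (abelMean f).eval x := by
  induction f using Polynomial.induction_on' with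
  | add p q hp hq =>
    simp only [eval_add, map_add]
    rw [intervalIntegral.integral_add, hp, hq, mul_add]
    · exact (by fun_prop : Continuous fun φ => eval (x * ((1 - Real.cos φ) / 2)) p).intervalIntegrable _ _
    · exact (by fun_prop : Continuous fun φ => eval (x * ((1 - Real.cos φ) / 2)) q).intervalIntegrable _ _
  | monomial n a =>
    have : abelMean (monomial n a) = monomial n (wallisRatio n * a) := by
      ext j; rw [coeff_abelMean, coeff_monomial, coeff_monomial]; split_ifs with h <;> simp [h]
    rw [this]
    simp only [eval_monomial, mul_pow]
    simp_rw [← mul_assoc]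
    rw [intervalIntegral.integral_const_mul, integral_sin_half_pow]; ring

/-- `T_ℓ(1 - w)` as a polynomial in `w`. -/
noncomputable def chebT (ℓ : ℕ) : ℝ[X] := (Chebyshev.T ℝ ℓ).comp (1 - X)

/-- `U_{ℓ-1}(1 - w)` as a polynomial in `w`. -/
noncomputable def chebU (ℓ : ℕ) : ℝ[X] := (Chebyshev.U ℝ (ℓ - 1)).comp (1 - X)

theorem derivative_chebT (ℓ : ℕ) : derivative (chebT ℓ) = -(ℓ : ℝ[X]) * chebU ℓ := by
  rw [chebT, derivative_comp, Chebyshev.T_derivative_eq_U, chebU]; simp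

theorem derivative_chebU (ℓ : ℕ) :
    X * (2 - X) * derivative (chebU ℓ) = (ℓ : ℝ[X]) * chebT ℓ - (1 - X) * chebU ℓ := by
  have h := congrArg (fun p => p.comp (1 - X)) (Chebyshev.add_one_mul_T_eq_poly_in_U (R := ℝ) (ℓ - 1))
  have e : (ℓ : ℤ) - 1 + 1 = ℓ := by ring
  simp [e] at h
  rw [chebU, derivative_comp, chebT]
  simp
  linear_combination -h

theorem derivative2_chebU (ℓ : ℕ) :
    X * (2 - X) * derivative (derivative (chebU ℓ)) + 3 * (1 - X) * derivative (chebU ℓ)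
      + ((ℓ : ℝ[X]) ^ 2 - 1) * chebU ℓ = 0 := by
  have h := congrArg derivative (derivative_chebU ℓ)
  simp [derivative_mul, derivative_chebT] at h
  linear_combination h

theorem derivative_U_comp (ℓ : ℕ) : (derivative (Chebyshev.U ℝ ℓ)).comp (1 - X)
      = (ℓ + 1 : ℝ[X]) * chebU ℓ - (1 - X) * derivative (chebU ℓ) := by
  have h := congrArg (fun p => (derivative p).comp (1 - X)) (Chebyshev.T_eq_U_sub_X_mul_U (R := ℝ) ℓ)
  simp [Chebyshev.T_derivative_eq_U, derivative_mul] at h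
  rw [chebU, derivative_comp]
  simp
  linear_combination -h

/-- `abelP`, `abelQ`, `abelS` form a closed first-order linear system, through which `abelD` and its
derivative are expressed. -/
noncomputable def abelP (ℓ : ℕ) : ℝ[X] := 2 * abelMean (chebT ℓ)
noncomputable def abelQ (ℓ : ℕ) : ℝ[X] := 2 * abelMean (X * chebU ℓ)
noncomputable def abelS (ℓ : ℕ) : ℝ[X] := abelMean (chebU ℓ)
noncomputable def abelD (ℓ : ℕ) : ℝ[X] := abelMean ((derivative (Chebyshev.U ℝ ℓ)).comp (1 - X))

theorem natCast_mul_abelMean (n : ℕ) (f : ℝ[X]) : abelMean ((n : ℝ[X]) * f) = (n : ℝ[X]) * abelMean f := by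
  rw [← nsmul_eq_mul, ← nsmul_eq_mul, map_nsmul]

theorem two_mul_abelMean (f : ℝ[X]) : abelMean (2 * f) = 2 * abelMean f := by
  simpa using natCast_mul_abelMean 2 f

theorem X_mul_derivative_abelP (ℓ : ℕ) : X * derivative (abelP ℓ) = -(ℓ : ℝ[X]) * abelQ ℓ := by
  have h := X_mul_derivative_abelMean (chebT ℓ)
  rw [derivative_chebT, show X * (-(ℓ : ℝ[X]) * chebU ℓ) = -((ℓ : ℝ[X]) * (X * chebU ℓ)) by ring,
    map_neg, natCast_mul_abelMean] at h
  simp only [abelP, abelQ, derivative_mul, derivative_ofNat]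
  linear_combination 2 * h

theorem sub_X_mul_derivative_abelQ (ℓ : ℕ) :
    (2 - X) * derivative (abelQ ℓ) = (ℓ : ℝ[X]) * abelP ℓ := by
  have h1 := two_mul_derivative_abelMean_X_mul (chebU ℓ)
  have h2 := X_mul_abelMean (chebU ℓ)
  have h3 := natCast_mul_abelMean ℓ (chebT ℓ)
  rw [show (ℓ : ℝ[X]) * chebT ℓ = X * (2 - X) * derivative (chebU ℓ) + (1 - X) * chebU ℓ by
    linear_combination -derivative_chebU ℓ] at h3
  have h4 := two_mul_abelMean (X * (2 - X) * derivative (chebU ℓ) + (1 - X) * chebU ℓ)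
  rw [show 2 * (X * (2 - X) * derivative (chebU ℓ) + (1 - X) * chebU ℓ)
    = 2 * (2 * X * derivative (chebU ℓ) + chebU ℓ) - 2 * (X ^ 2 * derivative (chebU ℓ) + X * chebU ℓ)
    by ring, map_sub, two_mul_abelMean, ← h2] at h4
  simp only [abelP, abelQ, derivative_mul, derivative_ofNat]
  linear_combination (2 - X) * h1 + h4 + 2 * h3

theorem two_X_mul_derivative_abelS (ℓ : ℕ) :
    2 * X * derivative (abelS ℓ) = derivative (abelQ ℓ) - abelS ℓ := by
  have h1 := two_mul_derivative_abelMean_X_mul (chebU ℓ)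
  have h2 := X_mul_derivative_abelMean (chebU ℓ)
  rw [map_add, mul_assoc, two_mul_abelMean] at h1
  simp only [abelS, abelQ, derivative_mul, derivative_ofNat]
  linear_combination 2 * h2 - h1

theorem two_mul_abelD (ℓ : ℕ) : 2 * abelD ℓ
    = (2 - X) * derivative (X * derivative (abelS ℓ)) + ((ℓ : ℝ[X]) + 1) ^ 2 * abelS ℓ := by
  set s := chebU ℓ with hs
  have h1 := two_mul_derivative_abelMean_X_mul (derivative s)
  have h2 := X_mul_derivative_abelMean s
  have h3 := X_mul_abelMean (derivative s)
  have h4 := natCast_mul_abelMean (2 * ℓ + 2) s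
  have h5 := natCast_mul_abelMean ((ℓ + 1) ^ 2) s
  have h6 := two_mul_abelMean ((ℓ + 1 : ℝ[X]) * chebU ℓ - (1 - X) * derivative (chebU ℓ))
  have h7 := derivative2_chebU ℓ
  have h8 := two_mul_abelMean (2 * X * derivative (derivative s) + derivative s)
  have e : (2 : ℝ[X]) * (2 * ((ℓ + 1 : ℝ[X]) * s - (1 - X) * derivative s))
      = 2 * (2 * X * derivative (derivative s) + derivative s) - 2 * (X ^ 2 * derivative (derivative s)
        + X * derivative s) + 2 * ((((ℓ + 1) ^ 2 : ℕ) : ℝ[X]) * s) := by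
    push_cast
    rw [← hs] at h7
    linear_combination -2 * h7
  have h9 := congrArg abelMean e
  rw [two_mul_abelMean, two_mul_abelMean, map_add, map_sub (abelMean) (2 * (2 * X * _ + _)), h8, ← h3, two_mul_abelMean, h5] at h9
  rw [abelD, derivative_U_comp, ← hs, abelS, ← hs, h2]
  push_cast at h9
  apply mul_left_cancel₀ (two_ne_zero : (2 : ℝ[X]) ≠ 0)
  linear_combination h9 - (2 - X) * h1

/-- Differentiating the first-order system eliminates the second derivative of `abelS` from
`two_mul_abelD`. -/
theorem eight_X_mul_abelD (ℓ : ℕ) : 8 * X * abelD ℓ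
    = (2 + (4 * ((ℓ : ℝ[X]) + 1) ^ 2 - 1) * X) * abelS ℓ + (3 * X - 2) * derivative (abelQ ℓ)
      - 2 * (ℓ : ℝ[X]) ^ 2 * abelQ ℓ := by
  have h1 := X_mul_derivative_abelP ℓ
  have h2 := sub_X_mul_derivative_abelQ ℓ
  have h3 := two_X_mul_derivative_abelS ℓ
  have h4 := two_mul_abelD ℓ
  have d2 := congrArg derivative h2
  have d3 := congrArg derivative h3
  simp [derivative_mul] at d2 d3 h4
  linear_combination 4 * X * h4 + 2 * (2 - X) * X * d3 + 2 * X * d2 - (2 - X) * h3 + 2 * (ℓ : ℝ[X]) * h1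

/-- For `0 < x < 2` the sign of `abelE ℓ x` is thus that of a combination of the values of the three
means, free of derivatives. -/
theorem derivative_abelD (ℓ : ℕ) : -(16 * X ^ 2 * (2 - X) ^ 2 * derivative (abelD ℓ))
    = (2 - X) ^ 2 * (6 + (4 * ((ℓ : ℝ[X]) + 1) ^ 2 - 1) * X) * abelS ℓ
      - (2 - X) * (6 * (2 - X) - 4 * X) * (ℓ : ℝ[X]) ^ 2 * abelQ ℓ
      - (ℓ : ℝ[X]) * abelP ℓ * ((6 + (8 * (ℓ : ℝ[X]) - 3) * X) * (2 - X) + 8 * X) := by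
  have h1 := X_mul_derivative_abelP ℓ
  have h2 := sub_X_mul_derivative_abelQ ℓ
  have h3 := two_X_mul_derivative_abelS ℓ
  have h5 := eight_X_mul_abelD ℓ
  have d2 := congrArg derivative h2
  have d5 := congrArg derivative h5
  simp [derivative_mul] at d2 d5
  have e1 : derivative ((ℓ : ℝ[X]) ^ 2) = 0 := by rw [← Nat.cast_pow, derivative_natCast]
  have e2 : derivative (((ℓ : ℝ[X]) + 1) ^ 2) = 0 := by
    rw [← Nat.cast_succ, ← Nat.cast_pow, derivative_natCast]
  rw [e1, e2] at d5
  linear_combination -(2 * X * (2 - X) ^ 2) * d5 + 2 * (2 - X) ^ 2 * h5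
    - (2 - X) ^ 2 * (2 + (4 * ((ℓ : ℝ[X]) + 1) ^ 2 - 1) * X) * h3
    - 2 * X * (3 * X - 2) * (2 - X) * d2 - 2 * (3 * X - 2) * (2 - X) * (ℓ : ℝ[X]) * h1
    + (-(2 - X) * (6 + (8 * (ℓ : ℝ[X]) + 3) * X) - 2 * X * (3 * X - 2)) * h2

end AbelMean

/-! ### The numerical inequality behind the Cauchy–Schwarz step. -/

/-- Here `k = sin(θ/2)`, `c = cos(θ/2)`, `r = 1/(ℓk)`, so `rk = 1/ℓ`. On the box `[r0, r1] × [k0,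
k1]` the inequality is reduced to one between constants: `d`, `C`, `R`, `B` are upper bounds for
`rk`, `1/c`, `√(4r/3)`, `|cb|`. -/
theorem box_bound {r k c : ℝ} (hr : 0 < r) (hk : 0 < k) (hc : 0 < c) (h1 : k ^ 2 + c ^ 2 = 1)
    (hrk : r * k ≤ 1 / 12) (r0 r1 k0 k1 d C R : ℝ) (hr0 : r0 ≤ r) (hr1 : r ≤ r1) (hk0 : k0 ≤ k)
    (hk1 : k ≤ k1) (hd : r1 * k1 ≤ d ∨ 1 / 12 ≤ d)
    (hpos : 0 ≤ r0 ∧ 0 ≤ k0 ∧ 0 < C ∧ 0 ≤ R)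
    (hC : 1 ≤ C ^ 2 * (1 - k1 ^ 2)) (hR : 4 * r1 / 3 ≤ R ^ 2)
    (B : ℝ) (hB : 1 - (k0 ^ 2 + r0 * k0 + 3 / 8 * (r0 * k0) ^ 2 + 3 / 8 * r0 ^ 2) ≤ B ∧
      -1 + (k1 * C) ^ 2 + d + 3 / 8 * d ^ 2 + 3 / 8 * r1 ^ 2 ≤ B ∧ B ≤ 3)
    (hV : 0 < 197 / 200 - r1 * R / 6)
    (hfin : 4 / 3 * (r1 * C) * (B ^ 2 * (1 + r1 ^ 2 / 16) +
      (k1 * C * (2 + d * (C ^ 2 - 3 / 4)) + r1 * C * (5 / 4 - k0 ^ 2 / 2 + d / 4 +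
        3 / 32 * (d ^ 2 + r1 ^ 2))) ^ 2)
      < ((1 + 2 * (r0 * k0) + 3 / 4 * (r0 * k0) ^ 2 + 3 / 4 * r0 ^ 2) * (197 / 200 - r1 * R / 6)) ^ 2)
    {cs cb ca : ℝ} (hcs : cs = 1 + 2 * (r * k) + 3 / 4 * (r * k) ^ 2 + 3 / 4 * r ^ 2)
    (hcb : cb = -1 + (k / c) ^ 2 + r * k + 3 / 8 * (r * k) ^ 2 + 3 / 8 * r ^ 2)
    (hca : ca = -(k / c) * (2 - 3 / 4 * (r * k) + r * k / c ^ 2) - 3 / 4 * r / c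
      - cs * r * c / 4 + cb * r / (4 * c)) :
    4 / 3 * (r / c) * (cb ^ 2 * (1 + r ^ 2 / 16) + ca ^ 2)
      < (cs * (197 / 200 - r * √(4 * r / 3) / 6)) ^ 2 ∧ 0 < 197 / 200 - r * √(4 * r / 3) / 6 := by
  revert hfin
  obtain ⟨p1, p2, p3, p4⟩ := hpos
  obtain ⟨hB1, hB2, hB3⟩ := hB
  have hr1p : 0 < r1 := hr.trans_le hr1
  have hk1p : 0 < k1 := hk.trans_le hk1
  have hdd : r * k ≤ d := by
    rcases hd with h | h
    · exact (mul_le_mul hr1 hk1 hk.le hr1p.le).trans h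
    · exact hrk.trans h
  have hdl : r0 * k0 ≤ r * k := mul_le_mul hr0 hk0 p2 hr.le
  set δ := r * k with hδ
  have hδ0 : 0 < δ := mul_pos hr hk
  have hd0 : 0 < d := hδ0.trans_le hdd
  have hd00 : 0 ≤ r0 * k0 := mul_nonneg p1 p2
  set e := r0 * k0 with he
  obtain ⟨i, hi⟩ : ∃ i, i = c⁻¹ := ⟨_, rfl⟩
  have hic : i * c = 1 := by rw [hi]; field_simp
  have hi0 : 0 < i := by rw [hi]; positivity
  have hic2 : i ^ 2 * c ^ 2 = 1 := by rw [← mul_pow, hic]; norm_num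
  have hi1 : 1 ≤ i ^ 2 := by
    rw [← hic2]
    exact mul_le_of_le_one_right (sq_nonneg i) (by linarith [sq_nonneg k])
  have hiC : i ≤ C := by
    have : i ^ 2 ≤ C ^ 2 := by
      have h2 : 1 ≤ C ^ 2 * c ^ 2 := by
        have : k ^ 2 ≤ k1 ^ 2 := by gcongr
        have := mul_le_mul_of_nonneg_left this (sq_nonneg C)
        have e : c ^ 2 = 1 - k ^ 2 := by linarith
        rw [e]; linarith
      exact le_of_mul_le_mul_right (hic2.le.trans h2) (by positivity : 0 < c ^ 2)
    exact (sq_le_sq₀ hi0.le p3.le).1 this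
  have hiC2 : i ^ 2 ≤ C ^ 2 := by gcongr
  have ht0 : 0 < k * i := mul_pos hk hi0
  have htT : k * i ≤ k1 * C := by gcongr
  have htz : (k * i) ^ 2 = i ^ 2 - 1 := by rw [mul_pow]; linear_combination i ^ 2 * h1 - hic2
  have htk : k ^ 2 ≤ (k * i) ^ 2 := by
    rw [mul_pow]; exact le_mul_of_one_le_right (sq_nonneg k) hi1
  have hk02 : k0 ^ 2 ≤ k ^ 2 := by gcongr
  have hr02 : r0 ^ 2 ≤ r ^ 2 := by gcongr
  have hr12 : r ^ 2 ≤ r1 ^ 2 := by gcongr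
  have he2 : e ^ 2 ≤ δ ^ 2 := by gcongr
  have hd2 : δ ^ 2 ≤ d ^ 2 := by gcongr
  have htT2 : (k * i) ^ 2 ≤ (k1 * C) ^ 2 := by gcongr
  have ek : k / c = k * i := by rw [hi]; rfl
  rw [ek] at hcb hca
  have hcb1 : -B ≤ cb := by rw [hcb]; linarith
  have hcb2 : cb ≤ B := by rw [hcb]; linarith
  have hcbsq : cb ^ 2 ≤ B ^ 2 := sq_le_sq' hcb1 hcb2
  have hcsA : 1 + 2 * e + 3 / 4 * e ^ 2 + 3 / 4 * r0 ^ 2 ≤ cs := by rw [hcs]; linarith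
  have hcspos : 0 < cs := by rw [hcs]; positivity
  -- With `i = 1/c` this is a sum of nonnegative terms, each bounded by its value with corner
  -- constants.
  have hca' : -ca = k * i * (2 + δ * (i ^ 2 - 3 / 4)) + r * i * (3 / 4 + (c ^ 2 * cs - cb) / 4) := by
    rw [hca]
    have e1 : c = i * c ^ 2 := by linear_combination (-c) * hic
    have e2 : δ / c ^ 2 = δ * i ^ 2 := by rw [hi]; field_simp
    have e3 : 3 / 4 * r / c = 3 / 4 * r * i := by rw [hi]; rfl
    have e4 : cb * r / (4 * c) = cb * r * i / 4 := by rw [hi]; field_simp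
    rw [e2, e3, e4]
    linear_combination cs * r / 4 * e1
  have hc2 : c ^ 2 = 1 - k ^ 2 := by linarith
  have hz : c ^ 2 * cs - cb ≤ 2 - 2 * k ^ 2 + δ + 3 / 8 * δ ^ 2 + 3 / 8 * r ^ 2 := by
    rw [hc2, hcb, hcs]
    have := mul_nonneg (sq_nonneg k)
      (by positivity : 0 ≤ 2 * δ + 3 / 4 * δ ^ 2 + 3 / 4 * r ^ 2)
    linarith
  have hk12 : k1 ^ 2 < 1 := by
    by_contra h
    have := mul_nonneg (sq_nonneg C) (sub_nonneg.2 (not_lt.1 h))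
    linarith
  have hk01 : k0 ^ 2 < 1 := lt_of_le_of_lt (hk02.trans (by gcongr)) hk12
  have hcaU : -ca ≤ k1 * C * (2 + d * (C ^ 2 - 3 / 4)) + r1 * C * (5 / 4 - k0 ^ 2 / 2 + d / 4 +
        3 / 32 * (d ^ 2 + r1 ^ 2)) := by
    rw [hca']
    have a1 : δ * (i ^ 2 - 3 / 4) ≤ d * (C ^ 2 - 3 / 4) :=
      mul_le_mul hdd (by linarith) (by linarith) hd0.le
    have a0 : 0 ≤ δ * (i ^ 2 - 3 / 4) := mul_nonneg hδ0.le (by linarith)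
    have a2 : k * i * (2 + δ * (i ^ 2 - 3 / 4)) ≤ k1 * C * (2 + d * (C ^ 2 - 3 / 4)) :=
      mul_le_mul htT (by linarith) (by linarith) (by positivity)
    have a3 : r * i ≤ r1 * C := mul_le_mul hr1 hiC hi0.le hr1p.le
    have a4 : 3 / 4 + (c ^ 2 * cs - cb) / 4 ≤ 5 / 4 - k0 ^ 2 / 2 + d / 4 +
        3 / 32 * (d ^ 2 + r1 ^ 2) := by linarith
    have a5 : r * i * (3 / 4 + (c ^ 2 * cs - cb) / 4) ≤ r1 * C * (5 / 4 - k0 ^ 2 / 2 + d / 4 +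
        3 / 32 * (d ^ 2 + r1 ^ 2)) := by
      refine (mul_le_mul_of_nonneg_left a4 (by positivity)).trans
        (mul_le_mul_of_nonneg_right a3 ?_)
      have := sq_nonneg d
      have := sq_nonneg r1
      linarith
    linarith
  have hcaL : 0 ≤ -ca := by
    rw [hca']
    have a0 : 0 ≤ δ * (i ^ 2 - 3 / 4) := mul_nonneg hδ0.le (by linarith)
    have a1 : 0 ≤ c ^ 2 * cs := by positivity
    exact add_nonneg (mul_nonneg ht0.le (by linarith)) (mul_nonneg (by positivity) (by linarith))
  have hcasq : ca ^ 2 ≤ (k1 * C * (2 + d * (C ^ 2 - 3 / 4)) + r1 * C * (5 / 4 - k0 ^ 2 / 2 + d / 4 +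
        3 / 32 * (d ^ 2 + r1 ^ 2))) ^ 2 := by
    rw [← neg_sq ca]
    exact pow_le_pow_left₀ hcaL hcaU 2
  have hsq : √(4 * r / 3) ≤ R := by
    rw [Real.sqrt_le_left p4]; linarith
  have hv : 197 / 200 - r1 * R / 6 ≤ 197 / 200 - r * √(4 * r / 3) / 6 := by
    have : r * √(4 * r / 3) ≤ r1 * R := mul_le_mul hr1 hsq (Real.sqrt_nonneg _) hr1p.le
    linarith
  intro hfin
  refine ⟨?_, hV.trans_le hv⟩
  refine lt_of_le_of_lt ?_ (hfin.trans_le ?_)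
  · have : r / c ≤ r1 * C := by
      rw [div_eq_mul_inv, ← hi]; exact mul_le_mul hr1 hiC hi0.le hr1p.le
    have hrc : 0 < r / c := by positivity
    gcongr
  · refine pow_le_pow_left₀ (mul_nonneg (by positivity) hV.le) ?_ 2
    exact mul_le_mul hcsA hv hV.le hcspos.le

/-- A finite cover of the region by boxes: bands in `r`, cut in `k`. The bound `0.70711` is `1/√2`,
since `θ ≤ π/2`; `0.6367` is just above `2/π`, since `(ℓ-1)θ > π`. -/
theorem cauchy_bound {r k c : ℝ} (hr : 0 < r) (hk : 0 < k) (hc : 0 < c) (h1 : k ^ 2 + c ^ 2 = 1)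
    (hrk : r * k ≤ 1 / 12) (hr1 : r ≤ 0.6367) (hk1 : k ≤ 0.70711)
    {cs cb ca : ℝ} (hcs : cs = 1 + 2 * (r * k) + 3 / 4 * (r * k) ^ 2 + 3 / 4 * r ^ 2)
    (hcb : cb = -1 + (k / c) ^ 2 + r * k + 3 / 8 * (r * k) ^ 2 + 3 / 8 * r ^ 2)
    (hca : ca = -(k / c) * (2 - 3 / 4 * (r * k) + r * k / c ^ 2) - 3 / 4 * r / c
      - cs * r * c / 4 + cb * r / (4 * c)) :
    4 / 3 * (r / c) * (cb ^ 2 * (1 + r ^ 2 / 16) + ca ^ 2)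
      < (cs * (197 / 200 - r * √(4 * r / 3) / 6)) ^ 2 ∧ 0 < 197 / 200 - r * √(4 * r / 3) / 6 := by
  have bb := fun r0 r1 k0 k1 d C R B a1 a2 a3 a4 a5 a6 a7 a8 a9 a10 a11 =>
    box_bound hr hk hc h1 hrk r0 r1 k0 k1 d C R a1 a2 a3 a4 a5 a6 a7 a8 B a9 a10 a11 hcs hcb hca
  rcases le_total 0.611 r with h0 | u0
  · rcases le_total k 0.024 with g' | g0
    · exact bb 0.611 0.6367 0 0.024 0.015281 1.0003 0.9214 0.8601 h0 hr1 hk.le g' (by norm_num) (by norm_num) (by norm_num)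
       (by norm_num) (by norm_num) (by norm_num) (by norm_num)
    rcases le_total k 0.049 with g' | g1
    · exact bb 0.611 0.6367 0.024 0.049 0.031199 1.0013 0.9214 0.8447 h0 hr1 g0 g' (by norm_num) (by norm_num) (by norm_num)
       (by norm_num) (by norm_num) (by norm_num) (by norm_num)
    rcases le_total k 0.074 with g' | g2
    · exact bb 0.611 0.6367 0.049 0.074 0.047116 1.0028 0.9214 0.8274 h0 hr1 g1 g' (by norm_num) (by norm_num) (by norm_num)
       (by norm_num) (by norm_num) (by norm_num) (by norm_num)
    rcases le_total k 0.098 with g' | g3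
    · exact bb 0.611 0.6367 0.074 0.098 0.062397 1.0049 0.9214 0.8086 h0 hr1 g2 g' (by norm_num) (by norm_num) (by norm_num)
       (by norm_num) (by norm_num) (by norm_num) (by norm_num)
    rcases le_total k 0.121 with g' | g4
    · exact bb 0.611 0.6367 0.098 0.121 0.077041 1.0075 0.9214 0.7892 h0 hr1 g3 g' (by norm_num) (by norm_num) (by norm_num)
       (by norm_num) (by norm_num) (by norm_num) (by norm_num)
    -- The upper end of `k` comes from `r * k ≤ 1/12` and the lower end of the band: `1/(12 · 0.611)
    -- < 0.1364`. The uppermost boxes of the next bands are closed in the same way.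
    exact bb 0.611 0.6367 0.121 0.1364 (1 / 12) 1.0095 0.9214 0.7694 h0 hr1 g4 (by nlinarith) (by norm_num) (by norm_num) (by norm_num)
       (by norm_num) (by norm_num) (by norm_num) (by norm_num)
  rcases le_total 0.58 r with h0 | u1
  · rcases le_total k 0.038 with g' | g0
    · exact bb 0.58 0.611 0 0.038 0.023218 1.0008 0.9026 0.8739 h0 u0 hk.le g' (by norm_num) (by norm_num) (by norm_num)
       (by norm_num) (by norm_num) (by norm_num) (by norm_num)
    rcases le_total k 0.075 with g' | g1
    · exact bb 0.58 0.611 0.038 0.075 0.045825 1.0029 0.9026 0.8502 h0 u0 g0 g' (by norm_num) (by norm_num) (by norm_num)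
       (by norm_num) (by norm_num) (by norm_num) (by norm_num)
    rcases le_total k 0.111 with g' | g2
    · exact bb 0.58 0.611 0.075 0.111 0.067821 1.0063 0.9026 0.8241 h0 u0 g1 g' (by norm_num) (by norm_num) (by norm_num)
       (by norm_num) (by norm_num) (by norm_num) (by norm_num)
    exact bb 0.58 0.611 0.111 0.1437 (1 / 12) 1.0105 0.9026 0.7956 h0 u0 g2 (by nlinarith) (by norm_num) (by norm_num) (by norm_num)
       (by norm_num) (by norm_num) (by norm_num) (by norm_num)
  rcases le_total 0.527 r with h0 | u2
  · rcases le_total k 0.046 with g' | g0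
    · exact bb 0.527 0.58 0 0.046 0.02668 1.0011 0.8794 0.8959 h0 u1 hk.le g' (by norm_num) (by norm_num) (by norm_num)
       (by norm_num) (by norm_num) (by norm_num) (by norm_num)
    rcases le_total k 0.09 with g' | g1
    · exact bb 0.527 0.58 0.046 0.09 0.0522 1.0041 0.8794 0.8693 h0 u1 g0 g' (by norm_num) (by norm_num) (by norm_num)
       (by norm_num) (by norm_num) (by norm_num) (by norm_num)
    rcases le_total k 0.13 with g' | g2
    · exact bb 0.527 0.58 0.09 0.13 0.0754 1.0086 0.8794 0.8395 h0 u1 g1 g' (by norm_num) (by norm_num) (by norm_num)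
       (by norm_num) (by norm_num) (by norm_num) (by norm_num)
    exact bb 0.527 0.58 0.13 0.1582 (1 / 12) 1.0128 0.8794 0.8087 h0 u1 g2 (by nlinarith) (by norm_num) (by norm_num) (by norm_num)
       (by norm_num) (by norm_num) (by norm_num) (by norm_num)
  rcases le_total 0.447 r with h0 | u3
  · rcases le_total k 0.073 with g' | g0
    · exact bb 0.447 0.527 0 0.073 0.038471 1.0027 0.8383 0.9251 h0 u2 hk.le g' (by norm_num) (by norm_num) (by norm_num)
       (by norm_num) (by norm_num) (by norm_num) (by norm_num)
    rcases le_total k 0.136 with g' | g1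
    · exact bb 0.447 0.527 0.073 0.136 0.071672 1.0094 0.8383 0.8868 h0 u2 g0 g' (by norm_num) (by norm_num) (by norm_num)
       (by norm_num) (by norm_num) (by norm_num) (by norm_num)
    exact bb 0.447 0.527 0.136 0.1865 (1 / 12) 1.0179 0.8383 0.8444 h0 u2 g1 (by nlinarith) (by norm_num) (by norm_num) (by norm_num)
       (by norm_num) (by norm_num) (by norm_num) (by norm_num)
  rcases le_total 0.348 r with h0 | u4
  · rcases le_total k 0.146 with g' | g0
    · exact bb 0.348 0.447 0 0.146 0.065262 1.0109 0.7721 0.9546 h0 u3 hk.le g' (by norm_num) (by norm_num) (by norm_num)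
       (by norm_num) (by norm_num) (by norm_num) (by norm_num)
    exact bb 0.348 0.447 0.146 0.2395 (1 / 12) 1.03 0.7721 0.8815 h0 u3 g0 (by nlinarith) (by norm_num) (by norm_num) (by norm_num)
       (by norm_num) (by norm_num) (by norm_num) (by norm_num)
  rcases le_total 0.226 r with h0 | u5
  · rcases le_total k 0.258 with g' | g0
    · exact bb 0.226 0.348 0 0.258 (1 / 12) 1.0351 0.6812 0.9809 h0 u4 hk.le g' (by norm_num) (by norm_num) (by norm_num)
       (by norm_num) (by norm_num) (by norm_num) (by norm_num)
    exact bb 0.226 0.348 0.258 0.3688 (1 / 12) 1.0759 0.6812 0.8547 h0 u4 g0 (by nlinarith) (by norm_num) (by norm_num) (by norm_num)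
       (by norm_num) (by norm_num) (by norm_num) (by norm_num)
  rcases le_total 0.183 r with h0 | u6
  · exact bb 0.183 0.226 0 0.4554 (1 / 12) 1.1233 0.549 0.9875 h0 u5 hk.le (by nlinarith) (by norm_num) (by norm_num) (by norm_num)
       (by norm_num) (by norm_num) (by norm_num) (by norm_num)
  rcases le_total 0.135 r with h0 | u7
  · rcases le_total k 0.512 with g' | g0
    · exact bb 0.135 0.183 0 0.512 (1 / 12) 1.1642 0.494 0.9932 h0 u6 hk.le g' (by norm_num) (by norm_num) (by norm_num)
       (by norm_num) (by norm_num) (by norm_num) (by norm_num)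
    exact bb 0.135 0.183 0.512 0.6173 (1 / 12) 1.2711 0.494 0.6602 h0 u6 g0 (by nlinarith) (by norm_num) (by norm_num) (by norm_num)
       (by norm_num) (by norm_num) (by norm_num) (by norm_num)
  rcases le_total 0.121 r with h0 | u8
  · rcases le_total k 0.608 with g' | g0
    · exact bb 0.121 0.135 0 0.608 0.08208 1.2596 0.4243 0.9946 h0 u7 hk.le g' (by norm_num) (by norm_num) (by norm_num)
       (by norm_num) (by norm_num) (by norm_num) (by norm_num)
    exact bb 0.121 0.135 0.608 0.6888 (1 / 12) 1.3795 0.4243 0.5493 h0 u7 g0 (by nlinarith) (by norm_num) (by norm_num) (by norm_num)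
       (by norm_num) (by norm_num) (by norm_num) (by norm_num)
  rcases le_total 0.091 r with h0 | u9
  · rcases le_total k 0.624 with g' | g0
    · exact bb 0.091 0.121 0 0.624 0.075504 1.2798 0.4017 0.9969 h0 u8 hk.le g' (by norm_num) (by norm_num) (by norm_num)
       (by norm_num) (by norm_num) (by norm_num) (by norm_num)
    rcases le_total k 0.698 with g' | g1
    · exact bb 0.091 0.121 0.624 0.698 (1 / 12) 1.3965 0.4017 0.5496 h0 u8 g0 g' (by norm_num) (by norm_num) (by norm_num)
       (by norm_num) (by norm_num) (by norm_num) (by norm_num)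
    exact bb 0.091 0.121 0.698 0.70711 (1 / 12) 1.4143 0.4017 0.4447 h0 u8 g1 hk1 (by norm_num) (by norm_num) (by norm_num)
       (by norm_num) (by norm_num) (by norm_num) (by norm_num)
  rcases le_total k 0.685 with g' | g0
  · exact bb 0 0.091 0 0.685 0.062335 1.3727 0.3484 1 hr.le u9 hk.le g' (by norm_num) (by norm_num) (by norm_num)
       (by norm_num) (by norm_num) (by norm_num) (by norm_num)
  exact bb 0 0.091 0.685 0.70711 0.064348 1.4143 0.3484 0.5308 hr.le u9 g0 hk1 (by norm_num) (by norm_num) (by norm_num)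
       (by norm_num) (by norm_num) (by norm_num) (by norm_num)

/-! ### Sonin energy and the slowly varying part, for an abstract solution `p`, `q`, `S` of the
system. -/

section Oscillation

open Real

variable {ℓ : ℝ} {p q S p' q' S' : ℝ → ℝ}

theorem hasDerivAt_sin_half (θ : ℝ) : HasDerivAt (fun θ => sin (θ / 2)) (cos (θ / 2) / 2) θ := by
  simpa [div_eq_mul_inv] using ((hasDerivAt_id θ).div_const 2).sin

theorem hasDerivAt_cos_half (θ : ℝ) : HasDerivAt (fun θ => cos (θ / 2)) (-(sin (θ / 2) / 2)) θ := by
  simpa [div_eq_mul_inv] using ((hasDerivAt_id θ).div_const 2).cos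

theorem hasDerivAt_comp_sin_half {f f' : ℝ → ℝ} (hf : ∀ x, HasDerivAt f (f' x) x) (θ : ℝ) :
    HasDerivAt (fun θ => f (2 * sin (θ / 2) ^ 2))
      (f' (2 * sin (θ / 2) ^ 2) * (2 * sin (θ / 2) * cos (θ / 2))) θ := by
  have h := ((hasDerivAt_sin_half θ).pow 2).const_mul 2
  refine ((hf _).comp θ h).congr_deriv ?_
  simp only [Pi.pow_apply]
  push_cast; ring

noncomputable def oscA (p : ℝ → ℝ) (θ : ℝ) : ℝ := p (2 * sin (θ / 2) ^ 2) / cos (θ / 2)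
noncomputable def oscB (q : ℝ → ℝ) (θ : ℝ) : ℝ := q (2 * sin (θ / 2) ^ 2) / sin (θ / 2)
noncomputable def oscS (S : ℝ → ℝ) (θ : ℝ) : ℝ := 2 * sin (θ / 2) * S (2 * sin (θ / 2) ^ 2)

/-- Put `f = √(sin θ) · oscA`. Then `f' = -√(sin θ) · oscG` and `f'' = -oscQ · f`: this is the
Liouville normal form of the system. -/
noncomputable def oscG (ℓ : ℝ) (p q : ℝ → ℝ) (θ : ℝ) : ℝ :=
  ℓ * oscB q θ - oscA p θ / (4 * sin (θ / 2) * cos (θ / 2))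

noncomputable def oscQ (ℓ : ℝ) (θ : ℝ) : ℝ :=
  ℓ ^ 2 + 1 / (16 * sin (θ / 2) ^ 2) - 3 / (16 * cos (θ / 2) ^ 2)

/-- The Sonin function `f² + f'²/oscQ`; its derivative is `-f'² oscQ'/oscQ²`, which is nonnegative
because `oscQ` decreases. -/
noncomputable def oscE (ℓ : ℝ) (p q : ℝ → ℝ) (θ : ℝ) : ℝ :=
  2 * sin (θ / 2) * cos (θ / 2) * (oscA p θ ^ 2 + oscG ℓ p q θ ^ 2 / oscQ ℓ θ)

/-- The second term cancels the derivative `ℓ oscA / 2` of `oscS`, and the third cancels the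
multiple of `oscB` that this introduces. What remains of the derivative has a factor `1/ℓ`. -/
noncomputable def oscV (ℓ : ℝ) (p q S : ℝ → ℝ) (θ : ℝ) : ℝ :=
  oscS S θ - oscB q θ / 2 + cos (θ / 2) * oscA p θ / (4 * ℓ * sin (θ / 2))

theorem hasDerivAt_oscA (hp : ∀ x, HasDerivAt p (p' x) x) (h1 : ∀ x, x * p' x = -ℓ * q x) {θ : ℝ}
    (hk : 0 < sin (θ / 2)) (hc : 0 < cos (θ / 2)) :
    HasDerivAt (oscA p) (-ℓ * oscB q θ + sin (θ / 2) / (2 * cos (θ / 2)) * oscA p θ) θ := by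
  refine ((hasDerivAt_comp_sin_half hp θ).div (hasDerivAt_cos_half θ) hc.ne').congr_deriv ?_
  have := h1 (2 * sin (θ / 2) ^ 2)
  unfold oscA oscB
  field_simp
  linear_combination 2 * cos (θ / 2) ^ 2 * this

theorem hasDerivAt_oscB (hq : ∀ x, HasDerivAt q (q' x) x) (h2 : ∀ x, (2 - x) * q' x = ℓ * p x)
    {θ : ℝ} (hk : 0 < sin (θ / 2)) (hc : 0 < cos (θ / 2)) :
    HasDerivAt (oscB q) (ℓ * oscA p θ - cos (θ / 2) / (2 * sin (θ / 2)) * oscB q θ) θ := by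
  refine ((hasDerivAt_comp_sin_half hq θ).div (hasDerivAt_sin_half θ) hk.ne').congr_deriv ?_
  have := h2 (2 * sin (θ / 2) ^ 2)
  rw [show 2 - 2 * sin (θ / 2) ^ 2 = 2 * cos (θ / 2) ^ 2 by
    linear_combination (-2) * sin_sq_add_cos_sq (θ / 2)] at this
  unfold oscA oscB
  field_simp
  linear_combination 2 * sin (θ / 2) ^ 2 * this

theorem hasDerivAt_oscS (hS : ∀ x, HasDerivAt S (S' x) x) (h2 : ∀ x, (2 - x) * q' x = ℓ * p x)
    (h3 : ∀ x, 2 * x * S' x = q' x - S x) {θ : ℝ} (hc : 0 < cos (θ / 2)) :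
    HasDerivAt (oscS S) (ℓ * oscA p θ / 2) θ := by
  refine (((hasDerivAt_sin_half θ).const_mul 2).mul (hasDerivAt_comp_sin_half hS θ)).congr_deriv ?_
  have := h2 (2 * sin (θ / 2) ^ 2)
  have h3 := h3 (2 * sin (θ / 2) ^ 2)
  rw [show 2 - 2 * sin (θ / 2) ^ 2 = 2 * cos (θ / 2) ^ 2 by
    linear_combination (-2) * sin_sq_add_cos_sq (θ / 2)] at this
  unfold oscA
  field_simp
  linear_combination this + 2 * cos (θ / 2) ^ 2 * h3

theorem hasDerivAt_oscG (hp : ∀ x, HasDerivAt p (p' x) x) (hq : ∀ x, HasDerivAt q (q' x) x)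
    (h1 : ∀ x, x * p' x = -ℓ * q x) (h2 : ∀ x, (2 - x) * q' x = ℓ * p x) {θ : ℝ}
    (hk : 0 < sin (θ / 2)) (hc : 0 < cos (θ / 2)) :
    HasDerivAt (oscG ℓ p q) (oscQ ℓ θ * oscA p θ - (cos (θ / 2) ^ 2 - sin (θ / 2) ^ 2) /
      (4 * sin (θ / 2) * cos (θ / 2)) * oscG ℓ p q θ) θ := by
  have hk' := hk.ne'
  have hc' := hc.ne'
  refine (((hasDerivAt_oscB hq h2 hk hc).const_mul ℓ).sub ((hasDerivAt_oscA hp h1 hk hc).div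
    (((hasDerivAt_sin_half θ).const_mul 4).mul (hasDerivAt_cos_half θ)) (by simp [hk', hc']))).congr_deriv ?_
  have h := sin_sq_add_cos_sq (θ / 2)
  simp only [Pi.mul_apply]
  unfold oscG oscQ
  generalize sin (θ / 2) = k at *
  generalize cos (θ / 2) = c at *
  generalize oscA p θ = a
  generalize oscB q θ = b
  have e : c ^ 2 - k ^ 2 = 2 * c ^ 2 - 1 := by linear_combination -h
  field_simp
  linear_combination (-128 * k * c * ℓ * b) * h

theorem hasDerivAt_oscQ (ℓ : ℝ) {θ : ℝ} (hk : 0 < sin (θ / 2)) (hc : 0 < cos (θ / 2)) :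
    HasDerivAt (oscQ ℓ) (-(cos (θ / 2) / (16 * sin (θ / 2) ^ 3)
      + 3 * sin (θ / 2) / (16 * cos (θ / 2) ^ 3))) θ := by
  have hk' := hk.ne'
  have hc' := hc.ne'
  refine (((hasDerivAt_const θ (ℓ ^ 2)).add ((hasDerivAt_const θ (1 : ℝ)).div
    (((hasDerivAt_sin_half θ).pow 2).const_mul 16) (by simp; exact hk'))).sub
      ((hasDerivAt_const θ (3 : ℝ)).div
    (((hasDerivAt_cos_half θ).pow 2).const_mul 16) (by simp; exact hc'))).congr_deriv ?_
  simp only [Pi.pow_apply]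
  field_simp
  ring

theorem hasDerivAt_oscE (hp : ∀ x, HasDerivAt p (p' x) x) (hq : ∀ x, HasDerivAt q (q' x) x)
    (h1 : ∀ x, x * p' x = -ℓ * q x) (h2 : ∀ x, (2 - x) * q' x = ℓ * p x) {θ : ℝ}
    (hk : 0 < sin (θ / 2)) (hc : 0 < cos (θ / 2)) (hQ : 0 < oscQ ℓ θ) :
    HasDerivAt (oscE ℓ p q) (2 * sin (θ / 2) * cos (θ / 2) * oscG ℓ p q θ ^ 2 *
      (cos (θ / 2) / (16 * sin (θ / 2) ^ 3) + 3 * sin (θ / 2) / (16 * cos (θ / 2) ^ 3))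
      / oscQ ℓ θ ^ 2) θ := by
  have hk' := hk.ne'
  have hc' := hc.ne'
  have hQ' := hQ.ne'
  refine ((((hasDerivAt_sin_half θ).const_mul 2).mul (hasDerivAt_cos_half θ)).mul
    (((hasDerivAt_oscA hp h1 hk hc).pow 2).add (((hasDerivAt_oscG hp hq h1 h2 hk hc).pow 2).div
    (hasDerivAt_oscQ ℓ hk hc) hQ'))).congr_deriv ?_
  have h := sin_sq_add_cos_sq (θ / 2)
  have hb : ℓ * oscB q θ = oscG ℓ p q θ + oscA p θ / (4 * sin (θ / 2) * cos (θ / 2)) := by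
    unfold oscG; ring
  simp only [Pi.mul_apply, Pi.pow_apply, Pi.add_apply, Pi.div_apply]
  rw [show -ℓ * oscB q θ = -(ℓ * oscB q θ) by ring, hb]
  generalize oscQ ℓ θ = Q at *
  generalize oscG ℓ p q θ = g at *
  generalize oscA p θ = a at *
  generalize sin (θ / 2) = k at *
  generalize cos (θ / 2) = c at *
  field_simp
  linear_combination (64 * c ^ 2 * k ^ 2 * Q ^ 2 * a ^ 2) * h

theorem hasDerivAt_oscV (hp : ∀ x, HasDerivAt p (p' x) x) (hq : ∀ x, HasDerivAt q (q' x) x)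
    (hS : ∀ x, HasDerivAt S (S' x) x)
    (h1 : ∀ x, x * p' x = -ℓ * q x) (h2 : ∀ x, (2 - x) * q' x = ℓ * p x)
    (h3 : ∀ x, 2 * x * S' x = q' x - S x) (hℓ : 0 < ℓ) {θ : ℝ}
    (hk : 0 < sin (θ / 2)) (hc : 0 < cos (θ / 2)) :
    HasDerivAt (oscV ℓ p q S) (-(oscA p θ * cos (θ / 2) ^ 2 / (8 * ℓ * sin (θ / 2) ^ 2))) θ := by
  have hk' := hk.ne'
  have hc' := hc.ne'
  refine (((hasDerivAt_oscS hS h2 h3 hc).sub ((hasDerivAt_oscB hq h2 hk hc).div_const 2)).add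
    (((hasDerivAt_cos_half θ).mul (hasDerivAt_oscA hp h1 hk hc)).div
      ((hasDerivAt_sin_half θ).const_mul (4 * ℓ)) (by positivity))).congr_deriv ?_
  have h := sin_sq_add_cos_sq (θ / 2)
  simp only [Pi.mul_apply]
  generalize oscB q θ = b at *
  generalize oscA p θ = a at *
  generalize sin (θ / 2) = k at *
  generalize cos (θ / 2) = c at *
  field_simp
  ring

theorem osc_half_angle {φ : ℝ} (h0 : 0 < φ) (h1 : φ ≤ π / 2) :
    0 < sin (φ / 2) ∧ 0 < cos (φ / 2) ∧ 1 / 2 ≤ cos (φ / 2) ^ 2 ∧ sin (φ / 2) ^ 2 ≤ 1 / 2 := by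
  have hp := pi_pos
  refine ⟨sin_pos_of_pos_of_lt_pi (by linarith) (by linarith),
    cos_pos_of_mem_Ioo ⟨by linarith, by linarith⟩, ?_, ?_⟩
  · have := cos_nonneg_of_mem_Icc (x := φ) ⟨by linarith, h1⟩
    rw [cos_sq, show 2 * (φ / 2) = φ by ring]; linarith
  · have := cos_nonneg_of_mem_Icc (x := φ) ⟨by linarith, h1⟩
    rw [sin_sq, cos_sq, show 2 * (φ / 2) = φ by ring]; linarith

theorem oscQ_pos (hℓ : 12 ≤ ℓ) {φ : ℝ} (h0 : 0 < φ) (h1 : φ ≤ π / 2) : 0 < oscQ ℓ φ := by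
  obtain ⟨a, b, c, d⟩ := osc_half_angle h0 h1
  have e1 : 0 < 1 / (16 * sin (φ / 2) ^ 2) := by positivity
  have e2 : 3 / (16 * cos (φ / 2) ^ 2) ≤ 1 := by
    rw [div_le_one (by positivity)]; linarith
  unfold oscQ
  nlinarith

/-- The energy increases up to `θ = π/2`, that is `x = 1`, where `hE` is exactly the bound on its
value. -/
theorem oscE_le (hℓ : 12 ≤ ℓ) (hp : ∀ x, HasDerivAt p (p' x) x) (hq : ∀ x, HasDerivAt q (q' x) x)
    (h1 : ∀ x, x * p' x = -ℓ * q x) (h2 : ∀ x, (2 - x) * q' x = ℓ * p x)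
    (hE : 2 * p 1 ^ 2 + 2 * (ℓ * q 1 - p 1 / 2) ^ 2 / (ℓ ^ 2 - 1 / 4) ≤ 8 / (3 * ℓ))
    {θ : ℝ} (h0 : 0 < θ) (hθ : θ ≤ π / 2) : oscE ℓ p q θ ≤ 8 / (3 * ℓ) := by
  have hmono : MonotoneOn (oscE ℓ p q) (Set.Icc θ (π / 2)) := by
    have hd : ∀ φ ∈ Set.Icc θ (π / 2), HasDerivAt (oscE ℓ p q) _ φ := fun φ hφ =>
      hasDerivAt_oscE hp hq h1 h2 (osc_half_angle (h0.trans_le hφ.1) hφ.2).1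
        (osc_half_angle (h0.trans_le hφ.1) hφ.2).2.1 (oscQ_pos hℓ (h0.trans_le hφ.1) hφ.2)
    refine monotoneOn_of_hasDerivWithinAt_nonneg (convex_Icc _ _)
      (fun φ hφ => (hd φ hφ).continuousAt.continuousWithinAt)
      (fun φ hφ => (hd φ (interior_subset hφ)).hasDerivWithinAt) (fun φ hφ => ?_)
    replace hφ := interior_subset hφ
    obtain ⟨a, b, -, -⟩ := osc_half_angle (h0.trans_le hφ.1) hφ.2
    positivity
  refine (hmono (Set.left_mem_Icc.2 hθ) (Set.right_mem_Icc.2 hθ) hθ).trans ?_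
  have e : π / 2 / 2 = π / 4 := by ring
  have e2 : √2 ^ 2 = 2 := sq_sqrt (by norm_num)
  have e3 : (√2 / 2) ^ 2 = 1 / 2 := by rw [div_pow, e2]; norm_num
  have e4 : (√2 / 2) * (√2 / 2) = 1 / 2 := by rw [← pow_two, e3]
  refine le_of_eq_of_le ?_ hE
  have hx : 2 * (√2 / 2) ^ 2 = 1 := by rw [e3]; norm_num
  have e5 : p 1 / (√2 / 2) = √2 * p 1 := by
    have : √2 ≠ 0 := by positivity
    field_simp; rw [e2]
  have e6 : q 1 / (√2 / 2) = √2 * q 1 := by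
    have : √2 ≠ 0 := by positivity
    field_simp; rw [e2]
  simp only [oscE, oscG, oscQ, oscA, oscB, e, sin_pi_div_four, cos_pi_div_four, hx, e5, e6]
  rw [mul_assoc 4, mul_assoc 2, e4, e3]
  rw [show ℓ ^ 2 + 1 / (16 * (1 / 2)) - 3 / (16 * (1 / 2)) = ℓ ^ 2 - 1 / 4 by ring]
  linear_combination (p 1 ^ 2 + (ℓ * q 1 - p 1 / 2) ^ 2 / (ℓ ^ 2 - 1 / 4)) * e2

theorem oscA_sq_le (hℓ : 12 ≤ ℓ) {M φ : ℝ} (hE : oscE ℓ p q φ ≤ M) (h0 : 0 < φ) (h1 : φ ≤ π / 2) :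
    2 * sin (φ / 2) * cos (φ / 2) * oscA p φ ^ 2 ≤ M := by
  obtain ⟨a, b, -, -⟩ := osc_half_angle h0 h1
  have hQ := oscQ_pos hℓ h0 h1
  refine le_trans ?_ hE
  unfold oscE
  have : 0 ≤ oscG ℓ p q φ ^ 2 / oscQ ℓ φ := by positivity
  gcongr
  linarith

/-- The energy bounds `oscA`, hence the derivative of `oscV`. Integrating from `π/2` is replaced by
adding a multiple of `sin(φ/2)^{-3/2}` that makes the sum antitone. At `π/2` the value is at least
`1.41421 · 0.6966 > 197/200`. -/
theorem le_oscV (hℓ : 12 ≤ ℓ) (hp : ∀ x, HasDerivAt p (p' x) x) (hq : ∀ x, HasDerivAt q (q' x) x)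
    (hS : ∀ x, HasDerivAt S (S' x) x)
    (h1 : ∀ x, x * p' x = -ℓ * q x) (h2 : ∀ x, (2 - x) * q' x = ℓ * p x)
    (h3 : ∀ x, 2 * x * S' x = q' x - S x)
    (hE : 2 * p 1 ^ 2 + 2 * (ℓ * q 1 - p 1 / 2) ^ 2 / (ℓ ^ 2 - 1 / 4) ≤ 8 / (3 * ℓ))
    (hv : 0.6966 ≤ S 1 - q 1 / 2 + p 1 / (4 * ℓ))
    {θ : ℝ} (h0 : 0 < θ) (hθ : θ ≤ π / 2) :
    197 / 200 - (1 / (ℓ * sin (θ / 2))) * √(4 * (1 / (ℓ * sin (θ / 2))) / 3) / 6 ≤ oscV ℓ p q S θ := by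
  have hℓ0 : 0 < ℓ := by linarith
  -- Chosen so that `3η/4 = √(4/(3ℓ))/(8ℓ)`, which matches the derivative of `η k^{-3/2}` with the
  -- bound for that of `oscV`.
  set η := √(4 / (3 * ℓ)) / (6 * ℓ) with hη
  have hη0 : 0 < η := by positivity
  set W : ℝ → ℝ := fun φ => oscV ℓ p q S φ + η * (sin (φ / 2) * √(sin (φ / 2)))⁻¹ with hW
  have hanti : AntitoneOn W (Set.Icc θ (π / 2)) := by
    have hd : ∀ φ ∈ Set.Icc θ (π / 2), HasDerivAt W
        (-(oscA p φ * cos (φ / 2) ^ 2 / (8 * ℓ * sin (φ / 2) ^ 2))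
          - η * (3 / 4 * cos (φ / 2) * √(sin (φ / 2))) / (sin (φ / 2) * √(sin (φ / 2))) ^ 2) φ := by
      intro φ hφ
      obtain ⟨a, b, -, -⟩ := osc_half_angle (h0.trans_le hφ.1) hφ.2
      have hs := (hasDerivAt_sin_half φ)
      refine ((hasDerivAt_oscV hp hq hS h1 h2 h3 hℓ0 a b).add
        (((hs.mul (hs.sqrt a.ne')).inv (by simp; exact ⟨a.ne', by positivity⟩)).const_mul η)).congr_deriv ?_
      have e := sq_sqrt a.le
      have : 0 < √(sin (φ / 2)) := by positivity
      simp only [Pi.mul_apply]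
      generalize √(sin (φ / 2)) = m at *
      field_simp
      rw [← e]
      ring
    refine antitoneOn_of_hasDerivWithinAt_nonpos (convex_Icc _ _)
      (fun φ hφ => (hd φ hφ).continuousAt.continuousWithinAt)
      (fun φ hφ => (hd φ (interior_subset hφ)).hasDerivWithinAt) (fun φ hφ => ?_)
    replace hφ := interior_subset hφ
    obtain ⟨a, b, -, -⟩ := osc_half_angle (h0.trans_le hφ.1) hφ.2
    have hA := oscA_sq_le hℓ (oscE_le hℓ hp hq h1 h2 hE (h0.trans_le hφ.1) hφ.2)
      (h0.trans_le hφ.1) hφ.2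
    have hc1 := cos_le_one (φ / 2)
    have e := sq_sqrt a.le
    have hsq : 0 < √(sin (φ / 2)) := by positivity
    generalize sin (φ / 2) = k at *
    generalize cos (φ / 2) = c at *
    generalize oscA p φ = α at *
    have key : -α * c * √k ≤ √(4 / (3 * ℓ)) := by
      apply le_sqrt_of_sq_le
      rw [mul_pow, mul_pow, e, neg_sq]
      have : 8 / (3 * ℓ) = 2 * (4 / (3 * ℓ)) := by ring
      have h5 : α ^ 2 * c ^ 2 * k ≤ α ^ 2 * c * k := by
        have : c ^ 2 ≤ c := by nlinarith
        gcongr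
      linarith
    have h6 : -(α * c ^ 2 / (8 * ℓ * k ^ 2)) - η * (3 / 4 * c * √k) / (k * √k) ^ 2
        = (-α * c * √k - √(4 / (3 * ℓ))) * (c / (8 * ℓ * k ^ 2 * √k)) := by
      rw [hη]; field_simp; ring
    rw [h6]
    exact mul_nonpos_of_nonpos_of_nonneg (by linarith) (by positivity)
  have h4 := hanti (Set.left_mem_Icc.2 hθ) (Set.right_mem_Icc.2 hθ) hθ
  obtain ⟨a, b, -, -⟩ := osc_half_angle h0 hθ
  have e7 : 1 / (ℓ * sin (θ / 2)) * √(4 * (1 / (ℓ * sin (θ / 2))) / 3) / 6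
      = η * (sin (θ / 2) * √(sin (θ / 2)))⁻¹ := by
    rw [hη, show 4 * (1 / (ℓ * sin (θ / 2))) / 3 = 4 / (3 * ℓ) / sin (θ / 2) by field_simp,
      sqrt_div (by positivity)]
    field_simp
  rw [e7]
  have e : π / 2 / 2 = π / 4 := by ring
  have e2 : √2 ^ 2 = 2 := sq_sqrt (by norm_num)
  have hx : 2 * (√2 / 2) ^ 2 = 1 := by rw [div_pow, e2]; norm_num
  have h8 : 197 / 200 ≤ oscV ℓ p q S (π / 2) := by
    have : oscV ℓ p q S (π / 2) = √2 * (S 1 - q 1 / 2 + p 1 / (4 * ℓ)) := by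
      simp only [oscV, oscS, oscA, oscB, e, sin_pi_div_four, cos_pi_div_four, hx]
      have : √2 ≠ 0 := by positivity
      field_simp
      linear_combination (4 * q 1 * ℓ - 2 * p 1) * e2
    rw [this]
    have h9 : 1.41421 ≤ √2 := le_sqrt_of_sq_le (by norm_num)
    have := mul_le_mul h9 hv (by norm_num) (by positivity)
    norm_num at this ⊢
    linarith
  have h10 : 0 ≤ η * (sin (π / 2 / 2) * √(sin (π / 2 / 2)))⁻¹ := by
    rw [e, sin_pi_div_four]; positivity
  simp only [hW] at h4
  linarith

/-- The target is the right-hand side of `derivative_abelD`. In the coordinates `v = oscV`, `g =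
oscG`, `a = oscA` it is a positive multiple of `cs * v + cb * g / ℓ + ca * a`; the lower bound on
`v` beats the other two terms, which the energy controls. -/
theorem osc_pos (hℓ : 12 ≤ ℓ) (hp : ∀ x, HasDerivAt p (p' x) x) (hq : ∀ x, HasDerivAt q (q' x) x)
    (hS : ∀ x, HasDerivAt S (S' x) x)
    (h1 : ∀ x, x * p' x = -ℓ * q x) (h2 : ∀ x, (2 - x) * q' x = ℓ * p x)
    (h3 : ∀ x, 2 * x * S' x = q' x - S x)
    (hE : 2 * p 1 ^ 2 + 2 * (ℓ * q 1 - p 1 / 2) ^ 2 / (ℓ ^ 2 - 1 / 4) ≤ 8 / (3 * ℓ))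
    (hv : 0.6966 ≤ S 1 - q 1 / 2 + p 1 / (4 * ℓ))
    {θ : ℝ} (h0 : 0 < θ) (hθ : θ ≤ π / 2) (hr : 1 ≤ 0.6367 * (ℓ * sin (θ / 2)))
    {x : ℝ} (hx : x = 2 * sin (θ / 2) ^ 2) :
    0 < (2 - x) ^ 2 * (6 + (4 * (ℓ + 1) ^ 2 - 1) * x) * S x
      - (2 - x) * (6 * (2 - x) - 4 * x) * ℓ ^ 2 * q x
      - ℓ * p x * ((6 + (8 * ℓ - 3) * x) * (2 - x) + 8 * x) := by
  have hℓ0 : 0 < ℓ := by linarith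
  obtain ⟨hk, hc, hc2, hk2⟩ := osc_half_angle h0 hθ
  have hEn := oscE_le hℓ hp hq h1 h2 hE h0 hθ
  have hV := le_oscV hℓ hp hq hS h1 h2 h3 hE hv h0 hθ
  have hQ := oscQ_pos hℓ h0 hθ
  have hpx : p x = oscA p θ * cos (θ / 2) := by rw [oscA, hx]; field_simp
  have hqx : q x = oscB q θ * sin (θ / 2) := by rw [oscB, hx]; field_simp
  have hSx : S x = oscS S θ / (2 * sin (θ / 2)) := by rw [oscS, hx]; field_simp
  have hkc := sin_sq_add_cos_sq (θ / 2)
  have hy : 2 - x = 2 * cos (θ / 2) ^ 2 := by rw [hx]; linear_combination (-2) * hkc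
  rw [hy, hpx, hqx, hSx, hx]
  unfold oscV at hV
  unfold oscE at hEn
  have hg : oscB q θ = (oscG ℓ p q θ + oscA p θ / (4 * sin (θ / 2) * cos (θ / 2))) / ℓ := by
    unfold oscG; field_simp; ring
  have hQle : oscQ ℓ θ ≤ ℓ ^ 2 * (1 + (1 / (ℓ * sin (θ / 2))) ^ 2 / 16) := by
    unfold oscQ
    have : 0 < 3 / (16 * cos (θ / 2) ^ 2) := by positivity
    have e : ℓ ^ 2 * (1 + (1 / (ℓ * sin (θ / 2))) ^ 2 / 16) = ℓ ^ 2 + 1 / (16 * sin (θ / 2) ^ 2) := by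
      field_simp
    rw [e]; linarith
  have hk1 : sin (θ / 2) ≤ 0.70711 := by
    refine le_of_sq_le_sq ?_ (by norm_num)
    exact hk2.trans (by norm_num)
  generalize sin (θ / 2) = k at *
  generalize cos (θ / 2) = c at *
  generalize oscQ ℓ θ = Q at *
  generalize oscG ℓ p q θ = g at *
  generalize oscA p θ = a at *
  generalize oscB q θ = b at *
  generalize oscS S θ = s at *
  obtain ⟨r, hrr⟩ : ∃ r, r = 1 / (ℓ * k) := ⟨_, rfl⟩
  have hr0 : 0 < r := by rw [hrr]; positivity
  have hrk : r * k = 1 / ℓ := by rw [hrr]; field_simp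
  have hrk12 : r * k ≤ 1 / 12 := by rw [hrk]; exact one_div_le_one_div_of_le (by norm_num) hℓ
  have hr1 : r ≤ 0.6367 := by
    rw [hrr, div_le_iff₀ (by positivity)]; exact hr
  rw [← hrr] at hV hQle
  obtain ⟨cs, hcs⟩ : ∃ cs, cs = 1 + 2 * (r * k) + 3 / 4 * (r * k) ^ 2 + 3 / 4 * r ^ 2 := ⟨_, rfl⟩
  obtain ⟨cb, hcb⟩ : ∃ cb, cb = -1 + (k / c) ^ 2 + r * k + 3 / 8 * (r * k) ^ 2 + 3 / 8 * r ^ 2 :=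
    ⟨_, rfl⟩
  obtain ⟨ca, hca⟩ : ∃ ca, ca = -(k / c) * (2 - 3 / 4 * (r * k) + r * k / c ^ 2) - 3 / 4 * r / c
      - cs * r * c / 4 + cb * r / (4 * c) := ⟨_, rfl⟩
  obtain ⟨hmain, hVpos⟩ := cauchy_bound hr0 hk hc hkc hrk12 hr1 hk1 hcs hcb hca
  have hcs0 : 0 < cs := by rw [hcs]; positivity
  obtain ⟨v, hvv⟩ : ∃ v, v = s - b / 2 + c * a / (4 * ℓ * k) := ⟨_, rfl⟩
  rw [← hvv] at hV
  have hD : 0 < cs * v + cb * g / ℓ + ca * a := by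
    have hcsv : cs * (197 / 200 - r * √(4 * r / 3) / 6) ≤ cs * v := by gcongr
    have hcsV : 0 < cs * (197 / 200 - r * √(4 * r / 3) / 6) := mul_pos hcs0 hVpos
    have hE2 : a ^ 2 + g ^ 2 / Q ≤ 4 / 3 * (r / c) := by
      have : 4 / 3 * (r / c) = 8 / (3 * ℓ) / (2 * k * c) := by rw [hrr]; field_simp; norm_num
      rw [this, le_div_iff₀ (by positivity)]
      linarith
    -- Cauchy–Schwarz for the quadratic form `a² + g²/Q` of the energy, followed by `Q/ℓ² ≤ 1 +
    -- r²/16`.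
    have hcauchy : (cb * g / ℓ + ca * a) ^ 2
        ≤ (cb ^ 2 * (1 + r ^ 2 / 16) + ca ^ 2) * (a ^ 2 + g ^ 2 / Q) := by
      have h5 : cb ^ 2 * Q / ℓ ^ 2 ≤ cb ^ 2 * (1 + r ^ 2 / 16) := by
        rw [div_le_iff₀ (by positivity)]
        have := mul_le_mul_of_nonneg_left hQle (sq_nonneg cb)
        linarith
      have h6 : (cb * g / ℓ + ca * a) ^ 2 ≤ (cb ^ 2 * Q / ℓ ^ 2 + ca ^ 2) * (a ^ 2 + g ^ 2 / Q) := by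
        have : (cb ^ 2 * Q / ℓ ^ 2 + ca ^ 2) * (a ^ 2 + g ^ 2 / Q) - (cb * g / ℓ + ca * a) ^ 2
            = (cb * a * Q - ca * ℓ * g) ^ 2 / (ℓ ^ 2 * Q) := by
          field_simp; ring
        have h7 : 0 ≤ (cb * a * Q - ca * ℓ * g) ^ 2 / (ℓ ^ 2 * Q) := by positivity
        linarith
      refine h6.trans ?_
      have : 0 ≤ a ^ 2 + g ^ 2 / Q := by positivity
      gcongr
    have h8 : (cb * g / ℓ + ca * a) ^ 2 < (cs * (197 / 200 - r * √(4 * r / 3) / 6)) ^ 2 := by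
      refine lt_of_le_of_lt (hcauchy.trans ?_) hmain
      rw [mul_comm (4 / 3 * (r / c))]
      gcongr
    have h9 := abs_lt_of_sq_lt_sq h8 hcsV.le
    rw [abs_lt] at h9
    linarith [h9.1]
  have hfin : (2 * c ^ 2) ^ 2 * (6 + (4 * (ℓ + 1) ^ 2 - 1) * (2 * k ^ 2)) * (s / (2 * k))
      - 2 * c ^ 2 * (6 * (2 * c ^ 2) - 4 * (2 * k ^ 2)) * ℓ ^ 2 * (b * k)
      - ℓ * (a * c) * ((6 + (8 * ℓ - 3) * (2 * k ^ 2)) * (2 * c ^ 2) + 8 * (2 * k ^ 2))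
      = 16 * k * c ^ 4 * ℓ ^ 2 * (cs * v + cb * g / ℓ + ca * a) := by
    have hs : s = v + b / 2 - c * a / (4 * ℓ * k) := by rw [hvv]; ring
    rw [hs, hca, hcb, hcs, hg, hrr]
    field_simp
    ring
  rw [hfin]
  positivity

end Oscillation

/-! ### Link with Chebyshev polynomials and positivity for small angles. -/

open Polynomial in
theorem geg_one_left_eq_U (n : ℤ) (hn : -1 ≤ n) (u : ℝ) : geg 1 n u = (Chebyshev.U ℝ n).eval u := by
  obtain ⟨m, rfl⟩ : ∃ m : ℕ, n = m - 1 := ⟨(n + 1).toNat, by lia⟩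
  clear hn
  induction m using Nat.strong_induction_on with
  | _ m ih =>
    rcases m with _ | _ | m
    · simp [geg_of_neg]
    · simp
    · have h0 := ih m (by lia)
      have h1 := ih (m + 1) (by lia)
      have r := geg_rec 1 (m - 1) u
      have e2 : ((m + 1 + 1 : ℕ) : ℤ) - 1 = (m : ℤ) - 1 + 2 := by push_cast; ring
      have e1 : ((m + 1 : ℕ) : ℤ) - 1 = (m : ℤ) - 1 + 1 := by push_cast; ring
      rw [e1] at h1
      rw [e2, Chebyshev.U_add_two, eval_sub, eval_mul, eval_mul, eval_X, ← h0, ← h1]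
      push_cast at r
      have hp : (m : ℝ) + 1 ≠ 0 := by positivity
      apply mul_left_cancel₀ hp
      simp only [eval_ofNat]
      linear_combination r

open Polynomial in
theorem eval_derivative_U (n : ℤ) (hn : -1 ≤ n) (u : ℝ) :
    (derivative (Chebyshev.U ℝ n)).eval u = 2 * geg 2 (n - 1) u := by
  have h1 := hasDerivAt_geg 1 n u
  rw [show geg 1 n = fun u => (Chebyshev.U ℝ n).eval u from funext fun u => geg_one_left_eq_U n hn u]
    at h1
  have := ((Chebyshev.U ℝ n).hasDerivAt u).unique h1
  norm_num at this
  exact this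

open Polynomial in
theorem eval_derivative_derivative_U (n : ℤ) (hn : -1 ≤ n) (u : ℝ) :
    (derivative (derivative (Chebyshev.U ℝ n))).eval u = 8 * geg 3 (n - 2) u := by
  have h1 := (hasDerivAt_geg 2 (n - 1) u).const_mul 2
  rw [show (fun y => 2 * geg 2 (n - 1) y) = fun u => (derivative (Chebyshev.U ℝ n)).eval u from
    funext fun u => (eval_derivative_U n hn u).symm] at h1
  have := ((derivative (Chebyshev.U ℝ n)).hasDerivAt u).unique h1
  norm_num at this
  rw [this, show n - 1 - 1 = n - 2 by ring]; ring

theorem gegCoeff_pos {κ ν : ℝ} (hκ : 0 < κ) (h : κ < ν) (n k : ℕ) : 0 < gegCoeff κ ν n k := by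
  refine div_pos (mul_pos (Finset.prod_pos fun i _ => ?_)
    (Finset.prod_pos fun i _ => ?_)) (mul_pos (by positivity) (Finset.prod_pos fun i _ => ?_))
  · have : (0 : ℝ) ≤ i := by positivity
    linarith
  · have : (0 : ℝ) ≤ i := by positivity
    linarith
  · positivity

/-- Positive expansion in `U_j`, `j ≤ n`, and `U_j(cos φ) = sin((j+1)φ)/sin φ` is positive in this
range. -/
theorem geg_cos_pos {ν φ : ℝ} (hν : 1 < ν) (n : ℕ) (h0 : 0 < φ) (h1 : (n + 1) * φ < Real.pi) :
    0 < geg ν n (Real.cos φ) := by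
  rw [geg_connection one_pos]
  refine Finset.sum_pos (fun k hk => ?_) ⟨0, by simp⟩
  rw [Finset.mem_range] at hk
  have h2k : 2 * k ≤ n := by lia
  have h2k' : (2 : ℝ) * k ≤ n := by exact_mod_cast h2k
  have hn1 : (1 : ℝ) ≤ n + 1 := by linarith [(Nat.cast_nonneg n : (0 : ℝ) ≤ n)]
  have hs : 0 < Real.sin φ := Real.sin_pos_of_pos_of_lt_pi h0 (by nlinarith)
  refine mul_pos (mul_pos (by linarith) (gegCoeff_pos one_pos hν n k)) ?_
  rw [geg_one_left_eq_U _ (by lia)]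
  have h := Polynomial.Chebyshev.U_real_cos φ ((n - 2 * k : ℕ) : ℤ)
  have h3 : 0 < Real.sin (((((n - 2 * k : ℕ) : ℤ) : ℝ) + 1) * φ) := by
    have e : ((((n - 2 * k : ℕ) : ℤ) : ℝ) + 1) = n - 2 * k + 1 := by
      rw [Int.cast_natCast, Nat.cast_sub h2k]; push_cast; ring
    rw [e]
    apply Real.sin_pos_of_pos_of_lt_pi
    · exact mul_pos (by linarith) h0
    · have : (0 : ℝ) ≤ k := by positivity
      nlinarith
  rw [← h] at h3
  exact pos_of_mul_pos_left h3 hs.le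

/-- The negative of the derivative of the mean of `U'_ℓ(1 - w)`. -/
noncomputable def abelE (ℓ : ℕ) (x : ℝ) : ℝ := -(Polynomial.derivative (abelD ℓ)).eval x

open Polynomial in
-- `x · abelE ℓ x` is the mean of `8w C_{ℓ-2}^3(1 - w)`, because `U_ℓ'' = 8 C_{ℓ-2}^3`. On the range
-- of integration `1 - w > cos θ`, so `geg_cos_pos` makes the integrand positive.
theorem abelE_pos_of_small {ℓ : ℕ} (hℓ : 2 ≤ ℓ) {θ : ℝ} (h0 : 0 < θ) (h1 : θ < Real.pi)
    (hθ : (ℓ - 1) * θ ≤ Real.pi) : 0 < abelE ℓ (1 - Real.cos θ) := by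
  have hcos : Real.cos θ < 1 := by
    have := Real.strictAntiOn_cos (Set.left_mem_Icc.2 Real.pi_pos.le) ⟨h0.le, h1.le⟩ h0
    simpa using this
  set x := 1 - Real.cos θ with hx
  have hx0 : 0 < x := by linarith
  have h2 := X_mul_derivative_abelMean ((derivative (Chebyshev.U ℝ ℓ)).comp (1 - X))
  have h3 := congrArg (eval x) h2
  rw [eval_mul, eval_X] at h3
  have h4 := integral_eval_eq_abelMean
    (X * derivative ((derivative (Chebyshev.U ℝ ℓ)).comp (1 - X))) x
  rw [← h3] at h4
  have h5 : ∀ w, (X * derivative ((derivative (Chebyshev.U ℝ ℓ)).comp (1 - X))).eval w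
      = -(8 * w * geg 3 ((ℓ - 2 : ℕ) : ℤ) (1 - w)) := by
    intro w
    rw [derivative_comp]
    simp only [eval_mul, eval_comp, eval_X, eval_sub, eval_one, derivative_sub, derivative_one,
      derivative_X, eval_zero]
    rw [eval_derivative_derivative_U _ (by lia), show ((ℓ : ℤ) - 2) = ((ℓ - 2 : ℕ) : ℤ) by lia]
    ring
  simp_rw [h5] at h4
  rw [intervalIntegral.integral_neg] at h4
  have h6 : 0 < ∫ φ in (0 : ℝ)..Real.pi, 8 * (x * ((1 - Real.cos φ) / 2)) *
      geg 3 ((ℓ - 2 : ℕ) : ℤ) (1 - x * ((1 - Real.cos φ) / 2)) := by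
    refine intervalIntegral.intervalIntegral_pos_of_pos_on ?_ (fun φ hφ => ?_) Real.pi_pos
    · refine Continuous.intervalIntegrable ?_ _ _
      simp_rw [geg_natCast]
      fun_prop
    · have hc1 : Real.cos φ < 1 := by
        have := Real.strictAntiOn_cos (Set.left_mem_Icc.2 Real.pi_pos.le) ⟨hφ.1.le, hφ.2.le⟩ hφ.1
        simpa using this
      have hc2 : -1 < Real.cos φ := by
        have := Real.strictAntiOn_cos ⟨hφ.1.le, hφ.2.le⟩ (Set.right_mem_Icc.2 Real.pi_pos.le) hφ.2
        simpa using this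
      have hw0 : 0 < x * ((1 - Real.cos φ) / 2) := mul_pos hx0 (by linarith)
      have hwx : x * ((1 - Real.cos φ) / 2) < x := by nlinarith
      refine mul_pos (by linarith) ?_
      set w := x * ((1 - Real.cos φ) / 2)
      have hu1 : Real.cos θ < 1 - w := by linarith
      have hm1 := Real.neg_one_le_cos θ
      have e : 1 - w = Real.cos (Real.arccos (1 - w)) :=
        (Real.cos_arccos (by linarith) (by linarith)).symm
      have hlt : Real.arccos (1 - w) < θ := by
        rw [← Real.arccos_cos h0.le h1.le]
        exact Real.arccos_lt_arccos hm1 hu1 (by linarith)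
      rw [e]
      have ha : 0 < Real.arccos (1 - w) := Real.arccos_pos.2 (by linarith)
      refine geg_cos_pos (by norm_num) _ ha ?_
      rw [Nat.cast_sub hℓ]
      have : (2 : ℝ) ≤ ℓ := by exact_mod_cast hℓ
      push_cast
      nlinarith
  have hp := Real.pi_pos
  rw [abelE, abelD]
  have h7 : 0 < Real.pi * x * -(eval x (derivative (abelMean ((derivative (Chebyshev.U ℝ ℓ)).comp (1 - X))))) := by
    linarith
  exact pos_of_mul_pos_right h7 (by positivity)

/-! ### Values of the means at `x = 1`, and positivity for `ℓ ≥ 12`. -/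

section BoundaryValues

open Polynomial

theorem chebU_zero : chebU 0 = 0 := by simp [chebU]
theorem chebU_one : chebU 1 = 1 := by simp [chebU]
theorem chebU_two : chebU 2 = 2 * (1 - X) := by
  rw [chebU, show ((2 : ℕ) : ℤ) - 1 = 1 by norm_num]; simp

theorem abelP_sub_abelQ (ℓ : ℕ) : abelP ℓ - abelQ ℓ = 2 * (abelS (ℓ + 1) - abelS ℓ) := by
  have h := congrArg (fun p => p.comp (1 - X)) (Chebyshev.T_eq_U_sub_X_mul_U (R := ℝ) ℓ)
  simp only [sub_comp, mul_comp, X_comp] at h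
  rw [abelP, abelQ, abelS, abelS, ← mul_sub, ← map_sub, ← map_sub]
  congr 2
  have e : chebU (ℓ + 1) = (Chebyshev.U ℝ ℓ).comp (1 - X) := by
    rw [chebU]; congr 2; push_cast; ring
  rw [e, chebT, h, chebU]; ring

theorem abelP_add_abelQ (ℓ : ℕ) : abelP (ℓ + 1) + abelQ (ℓ + 1) = 2 * (abelS (ℓ + 1) - abelS ℓ) := by
  have h := congrArg (fun p => p.comp (1 - X)) (Chebyshev.T_eq_X_mul_U_sub_U (R := ℝ) (ℓ - 1))
  simp only [sub_comp, mul_comp, X_comp] at h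
  rw [abelP, abelQ, abelS, abelS, ← mul_add, ← map_sub, ← map_add]
  congr 2
  have e : chebU (ℓ + 1) = (Chebyshev.U ℝ ℓ).comp (1 - X) := by
    rw [chebU]; congr 2; push_cast; ring
  have e2 : chebT (ℓ + 1) = (Chebyshev.T ℝ (ℓ - 1 + 2)).comp (1 - X) := by
    rw [chebT]; congr 2; push_cast; ring
  rw [e, e2, h, chebU, show (ℓ : ℤ) - 1 + 1 = ℓ by ring]; ring

/-- The value at `1` of the mean of `U_m(1 - w) - U_{m-1}(1 - w)`. -/
noncomputable def legAtOne (m : ℕ) : ℝ := (abelS (m + 1)).eval 1 - (abelS m).eval 1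

theorem legAtOne_zero : legAtOne 0 = 1 := by
  have h : abelMean (1 : ℝ[X]) = 1 := by
    ext j
    rw [coeff_abelMean, coeff_one]
    split_ifs with h
    · subst h; simp
    · simp
  simp [legAtOne, abelS, chebU_zero, chebU_one, h]

theorem legAtOne_one : legAtOne 1 = 0 := by
  have h : abelMean (chebU 2) = 2 - X := by
    ext j
    have e : chebU 2 = C 2 - C 2 * X := by
      have h2 : (2 : ℝ[X]) = C 2 := rfl
      rw [chebU_two, h2]; ring
    have e2 : (2 - X : ℝ[X]) = C 2 - C 1 * X := by rw [map_one, one_mul]; rfl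
    rw [coeff_abelMean, e, e2, coeff_sub, coeff_sub, coeff_C_mul, coeff_C_mul, coeff_C, coeff_X]
    rcases j with _ | _ | j <;> simp [wallisRatio]
  have h0 := legAtOne_zero
  simp [legAtOne, abelS, chebU_zero] at h0
  simp [legAtOne, abelS, h, h0]; norm_num

/-- The recurrence of the Legendre values `P_m(0)`. It follows by evaluating at `1` the system and
the two contiguity relations for `abelP ∓ abelQ`, together with their derivatives. -/
theorem legAtOne_rec (m : ℕ) : (m + 2) * legAtOne (m + 2) = -(m + 1) * legAtOne m := by
  have h1 := congrArg (fun p => (derivative p).eval 1) (abelP_sub_abelQ (m + 1))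
  have h2 := congrArg (fun p => (derivative p).eval 1) (abelP_add_abelQ (m + 1))
  have h3 := congrArg (eval 1) (abelP_sub_abelQ (m + 2))
  have h4 := congrArg (eval 1) (abelP_add_abelQ m)
  have a1 := congrArg (eval 1) (X_mul_derivative_abelP (m + 1))
  have a2 := congrArg (eval 1) (X_mul_derivative_abelP (m + 1 + 1))
  have b1 := congrArg (eval 1) (sub_X_mul_derivative_abelQ (m + 1))
  have b2 := congrArg (eval 1) (sub_X_mul_derivative_abelQ (m + 1 + 1))
  simp [derivative_mul] at h1 h2 h3 h4 a1 a2 b1 b2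
  norm_num at b1 b2
  unfold legAtOne
  linear_combination (-1 / 2 : ℝ) * (h1 - h2 - a1 + b1 + a2 + b2) - (m + 2) / 2 * h3 - (m + 1) / 2 * h4

theorem legAtOne_odd (j : ℕ) : legAtOne (2 * j + 1) = 0 := by
  induction j with
  | zero => exact legAtOne_one
  | succ j ih =>
    have := legAtOne_rec (2 * j + 1)
    rw [ih, mul_zero] at this
    have hp : (((2 * j + 1 : ℕ) : ℝ) + 2) ≠ 0 := by positivity
    have h := (mul_eq_zero.1 this).resolve_left hp
    rwa [show 2 * (j + 1) + 1 = 2 * j + 1 + 2 by ring]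

theorem legAtOne_even (j : ℕ) : legAtOne (2 * j) = (-1) ^ j * wallisRatio j := by
  induction j with
  | zero => simpa using legAtOne_zero
  | succ j ih =>
    have h := legAtOne_rec (2 * j)
    have h2 := wallisRatio_succ j
    rw [ih] at h
    have hp : (2 * (j : ℝ) + 2) ≠ 0 := by positivity
    apply mul_left_cancel₀ hp
    rw [show 2 * (j + 1) = 2 * j + 2 by ring]
    push_cast at h
    rw [h, pow_succ]
    linear_combination ((-1) ^ j : ℝ) * h2

theorem eval_one_abelS (ℓ : ℕ) : (abelS ℓ).eval 1 = ∑ m ∈ Finset.range ℓ, legAtOne m := by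
  unfold legAtOne
  rw [Finset.sum_range_sub (fun m => (abelS m).eval 1)]
  simp [abelS, chebU_zero]

theorem eval_one_abelP (ℓ : ℕ) : (abelP (ℓ + 1)).eval 1 = legAtOne ℓ + legAtOne (ℓ + 1) := by
  have h3 := congrArg (eval 1) (abelP_sub_abelQ (ℓ + 1))
  have h4 := congrArg (eval 1) (abelP_add_abelQ ℓ)
  simp at h3 h4
  unfold legAtOne
  linear_combination (h3 + h4) / 2

theorem eval_one_abelQ (ℓ : ℕ) : (abelQ (ℓ + 1)).eval 1 = legAtOne ℓ - legAtOne (ℓ + 1) := by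
  have h3 := congrArg (eval 1) (abelP_sub_abelQ (ℓ + 1))
  have h4 := congrArg (eval 1) (abelP_add_abelQ ℓ)
  simp at h3 h4
  unfold legAtOne
  linear_combination (h4 - h3) / 2

/-- An elementary substitute for the asymptotics `1/√(πj)`; the `3` here is the one in the energy
bound `8/(3ℓ)`. -/
theorem wallisRatio_sq_le (j : ℕ) : wallisRatio j ^ 2 * (3 * j + 1) ≤ 1 := by
  induction j with
  | zero => simp
  | succ j ih =>
    have h := wallisRatio_succ j
    have hw : wallisRatio (j + 1) = wallisRatio j * (2 * j + 1) / (2 * j + 2) := by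
      field_simp; linarith
    rw [hw]
    have hj : (0 : ℝ) ≤ j := by positivity
    refine le_trans ?_ ih
    rw [div_pow, mul_pow, div_mul_eq_mul_div, div_le_iff₀ (by positivity)]
    have : (2 * (j : ℝ) + 1) ^ 2 * (3 * (j + 1) + 1) ≤ (3 * j + 1) * (2 * j + 2) ^ 2 := by nlinarith
    push_cast
    have := mul_le_mul_of_nonneg_left this (sq_nonneg (wallisRatio j))
    linarith

/-- The trapezoidal partial sums of `∑ (-1)^i wallisRatio i`. -/
noncomputable def altSum (j : ℕ) : ℝ :=
  ∑ i ∈ Finset.range j, (-1) ^ i * wallisRatio i + (-1) ^ j * wallisRatio j / 2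

theorem altSum_succ (j : ℕ) :
    altSum (j + 1) = altSum j + (-1) ^ j * (wallisRatio j - wallisRatio (j + 1)) / 2 := by
  rw [altSum, altSum, Finset.sum_range_succ, pow_succ]; ring

theorem wallisRatio_succ_le (j : ℕ) : wallisRatio (j + 1) ≤ wallisRatio j := by
  have h := wallisRatio_succ j
  have := wallisRatio_pos j
  have hj : (0 : ℝ) < 2 * j + 2 := by positivity
  refine le_of_mul_le_mul_right ?_ hj
  rw [h]; nlinarith

/-- The increment is half a second difference of the Wallis ratios, which are convex. The even sums
increase towards `1/√2`, so the value at `6` gives a uniform lower bound. -/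
theorem altSum_even_le (j : ℕ) : altSum (2 * j) ≤ altSum (2 * j + 2) := by
  rw [show 2 * j + 2 = 2 * j + 1 + 1 by ring, altSum_succ (2 * j + 1), altSum_succ (2 * j), pow_succ,
    pow_mul]
  have h1 := wallisRatio_succ (2 * j)
  have h2 := wallisRatio_succ (2 * j + 1)
  have hp := wallisRatio_pos (2 * j)
  have hw : wallisRatio (2 * j + 1) = wallisRatio (2 * j) * (4 * j + 1) / (4 * j + 2) := by
    push_cast at h1; field_simp; linarith
  have hw2 : wallisRatio (2 * j + 1 + 1) = wallisRatio (2 * j) * ((4 * j + 1) / (4 * j + 2) *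
      ((4 * j + 3) / (4 * j + 4))) := by
    push_cast at h2; rw [hw] at h2; field_simp at h2 ⊢; linarith
  have h3 : 0 ≤ wallisRatio (2 * j) - 2 * wallisRatio (2 * j + 1) + wallisRatio (2 * j + 1 + 1) := by
    have : wallisRatio (2 * j) - 2 * wallisRatio (2 * j + 1) + wallisRatio (2 * j + 1 + 1)
        = wallisRatio (2 * j) * (3 / ((4 * j + 2) * (4 * j + 4))) := by
      rw [hw2, hw]; field_simp; ring
    rw [this]; positivity
  norm_num
  linarith

theorem le_altSum_even (j : ℕ) (hj : 3 ≤ j) : 0.7026 ≤ altSum (2 * j) := by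
  induction j, hj using Nat.le_induction with
  | base => norm_num [altSum, wallisRatio, Finset.sum_range_succ, Finset.prod_range_succ]
  | succ j hj ih => exact ih.trans (altSum_even_le j)

theorem le_altSum_add (j : ℕ) (hj : 6 ≤ j) {ℓ : ℝ} (hℓ : 2 * j ≤ ℓ) :
    0.6966 ≤ altSum j + (-1) ^ j * wallisRatio j / (4 * ℓ) := by
  have hjr : (6 : ℝ) ≤ j := by exact_mod_cast hj
  have hp := wallisRatio_pos j
  rcases Nat.even_or_odd' j with ⟨i, rfl | rfl⟩
  · have := le_altSum_even i (by lia)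
    have h2 : 0 ≤ (-1) ^ (2 * i) * wallisRatio (2 * i) / (4 * ℓ) := by
      rw [pow_mul]; norm_num
      have : (0 : ℝ) < ℓ := by linarith
      positivity
    exact (by norm_num : (0.6966 : ℝ) ≤ 0.7026).trans (this.trans (le_add_of_nonneg_right h2))
  -- For odd index the sum exceeds the next even one, and the negative correction is at most
  -- `0.006`, whence `0.6966 = 0.7026 - 0.006`.
  · have h1 := le_altSum_even (i + 1) (by lia)
    have h2 := altSum_succ (2 * i + 1)
    have h3 := wallisRatio_succ_le (2 * i + 1)
    rw [show 2 * i + 1 + 1 = 2 * (i + 1) by ring] at h2 h3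
    have hs : (-1 : ℝ) ^ (2 * i + 1) = -1 := by rw [pow_succ, pow_mul]; norm_num
    have h4 := wallisRatio_sq_le (2 * i + 1)
    have h5 : wallisRatio (2 * i + 1) ≤ 0.25 := by
      by_contra! h
      have : (0.25 : ℝ) ^ 2 < wallisRatio (2 * i + 1) ^ 2 := by gcongr
      nlinarith
    have h6 : wallisRatio (2 * i + 1) / (4 * ℓ) ≤ 0.006 := by
      rw [div_le_iff₀ (by linarith)]; linarith
    rw [hs] at h2 ⊢
    rw [show -1 * wallisRatio (2 * i + 1) / (4 * ℓ) = -(wallisRatio (2 * i + 1) / (4 * ℓ)) by ring]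
    norm_num at *
    linarith

theorem sum_legAtOne_even (j : ℕ) :
    ∑ m ∈ Finset.range (2 * j), legAtOne m = ∑ i ∈ Finset.range j, (-1) ^ i * wallisRatio i := by
  induction j with
  | zero => simp
  | succ j ih =>
    rw [show 2 * (j + 1) = 2 * j + 1 + 1 by ring, Finset.sum_range_succ, Finset.sum_range_succ, ih,
      legAtOne_odd, legAtOne_even, Finset.sum_range_succ]; ring

/-- With `j = ⌊ℓ/2⌋`, for both parities `P(1) = (-1)^j wallisRatio j`, `Q(1) = ±P(1)` and `S(1) -
Q(1)/2 = altSum j`. -/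
theorem boundary_values (ℓ : ℕ) (hℓ : 12 ≤ ℓ) :
    2 * (abelP ℓ).eval 1 ^ 2 + 2 * (ℓ * (abelQ ℓ).eval 1 - (abelP ℓ).eval 1 / 2) ^ 2 /
      ((ℓ : ℝ) ^ 2 - 1 / 4) ≤ 8 / (3 * ℓ) ∧
    0.6966 ≤ (abelS ℓ).eval 1 - (abelQ ℓ).eval 1 / 2 + (abelP ℓ).eval 1 / (4 * ℓ) := by
  have hℓr : (12 : ℝ) ≤ ℓ := by exact_mod_cast hℓ
  rcases Nat.even_or_odd' ℓ with ⟨j, hj | hj⟩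
  · obtain ⟨i, rfl⟩ : ∃ i, j = i + 1 := ⟨j - 1, by lia⟩
    have hl : ℓ = (2 * i + 1) + 1 := by lia
    have hP : (abelP ℓ).eval 1 = (-1) ^ (i + 1) * wallisRatio (i + 1) := by
      rw [hl, eval_one_abelP, legAtOne_odd, show 2 * i + 1 + 1 = 2 * (i + 1) by ring, legAtOne_even]
      ring
    have hQ : (abelQ ℓ).eval 1 = -((-1) ^ (i + 1) * wallisRatio (i + 1)) := by
      rw [hl, eval_one_abelQ, legAtOne_odd, show 2 * i + 1 + 1 = 2 * (i + 1) by ring, legAtOne_even]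
      ring
    have hS : (abelS ℓ).eval 1 = ∑ i ∈ Finset.range (i + 1), (-1) ^ i * wallisRatio i := by
      rw [eval_one_abelS, hj, sum_legAtOne_even]
    have hlr : (ℓ : ℝ) = 2 * (i + 1) := by rw [hj]; push_cast; ring
    have h1 := le_altSum_add (i + 1) (by lia) (ℓ := ℓ) (by rw [hlr]; push_cast; exact le_rfl)
    have h2 := wallisRatio_sq_le (i + 1)
    rw [altSum] at h1
    rw [hP, hQ, hS]
    refine ⟨?_, by linarith⟩
    have h3 : ((-1) ^ (i + 1) * wallisRatio (i + 1)) ^ 2 = wallisRatio (i + 1) ^ 2 := by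
      rw [mul_pow, ← pow_mul, mul_comm (i + 1) 2, pow_mul]; norm_num
    set a := (-1) ^ (i + 1) * wallisRatio (i + 1)
    rw [← h3] at h2
    have h4 : a ^ 2 * (3 * ℓ + 2) ≤ 2 := by rw [hlr]; push_cast at h2; linarith
    have h5 : 2 * a ^ 2 + 2 * (ℓ * -a - a / 2) ^ 2 / ((ℓ : ℝ) ^ 2 - 1 / 4) = a ^ 2 * (4 * ℓ / (ℓ - 1 / 2)) := by
      obtain ⟨m, hm⟩ : ∃ m : ℝ, (ℓ : ℝ) = m + 1 / 2 := ⟨ℓ - 1 / 2, by ring⟩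
      have hm0 : m ≠ 0 := by linarith
      have hm1 : m + 1 ≠ 0 := by linarith
      rw [hm, show (m + 1 / 2) ^ 2 - 1 / 4 = m * (m + 1) by ring,
        show m + 1 / 2 - 1 / 2 = m by ring]
      field_simp; ring
    rw [h5]
    have h6 : a ^ 2 ≤ 2 / (3 * ℓ + 2) := by rw [le_div_iff₀ (by linarith)]; exact h4
    have h7 : 0 < (ℓ : ℝ) - 1 / 2 := by linarith
    refine (mul_le_mul_of_nonneg_right h6 (by positivity)).trans ?_
    rw [div_mul_div_comm, div_le_div_iff₀ (by positivity) (by positivity)]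
    nlinarith
  · have hP : (abelP ℓ).eval 1 = (-1) ^ j * wallisRatio j := by
      rw [hj, eval_one_abelP, legAtOne_odd, legAtOne_even]; ring
    have hQ : (abelQ ℓ).eval 1 = (-1) ^ j * wallisRatio j := by
      rw [hj, eval_one_abelQ, legAtOne_odd, legAtOne_even]; ring
    have hS : (abelS ℓ).eval 1 = ∑ i ∈ Finset.range j, (-1) ^ i * wallisRatio i
        + (-1) ^ j * wallisRatio j := by
      rw [eval_one_abelS, hj, Finset.sum_range_succ, sum_legAtOne_even, legAtOne_even]
    have hlr : (ℓ : ℝ) = 2 * j + 1 := by rw [hj]; push_cast; ring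
    have h1 := le_altSum_add j (by lia) (ℓ := ℓ) (by rw [hlr]; linarith)
    have h2 := wallisRatio_sq_le j
    rw [altSum] at h1
    rw [hP, hQ, hS]
    refine ⟨?_, by linarith⟩
    have h3 : ((-1) ^ j * wallisRatio j) ^ 2 = wallisRatio j ^ 2 := by
      rw [mul_pow, ← pow_mul, mul_comm j 2, pow_mul]; norm_num
    set a := (-1) ^ j * wallisRatio j
    rw [← h3] at h2
    have h4 : a ^ 2 * (3 * ℓ - 1) ≤ 2 := by rw [hlr]; linarith
    have h5 : 2 * a ^ 2 + 2 * (ℓ * a - a / 2) ^ 2 / ((ℓ : ℝ) ^ 2 - 1 / 4) = a ^ 2 * (4 * ℓ / (ℓ + 1 / 2)) := by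
      have : (ℓ : ℝ) - 1 / 2 ≠ 0 := by linarith
      have h' : (ℓ : ℝ) + 1 / 2 ≠ 0 := by linarith
      rw [show (ℓ : ℝ) ^ 2 - 1 / 4 = (ℓ - 1 / 2) * (ℓ + 1 / 2) by ring]
      field_simp; ring
    rw [h5]
    have h7 : 0 < 3 * (ℓ : ℝ) - 1 := by linarith
    have h6 : a ^ 2 ≤ 2 / (3 * ℓ - 1) := by rw [le_div_iff₀ h7]; exact h4
    refine (mul_le_mul_of_nonneg_right h6 (by positivity)).trans ?_
    rw [div_mul_div_comm, div_le_div_iff₀ (by positivity) (by positivity)]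
    nlinarith

theorem abelE_pos_of_large {ℓ : ℕ} (hℓ : 12 ≤ ℓ) {x : ℝ} (h0 : 0 < x) (h1 : x < 1) :
    0 < abelE ℓ x := by
  have hℓr : (12 : ℝ) ≤ ℓ := by exact_mod_cast hℓ
  set θ := Real.arccos (1 - x) with hθ
  have hcos : Real.cos θ = 1 - x := Real.cos_arccos (by linarith) (by linarith)
  have hθ0 : 0 < θ := Real.arccos_pos.2 (by linarith)
  have hθ1 : θ ≤ Real.pi / 2 := Real.arccos_le_pi_div_two.2 (by linarith)
  have hpi := Real.pi_gt_d4
  have hpi2 := Real.pi_lt_d4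
  rcases le_or_gt ((ℓ - 1) * θ) Real.pi with hs | hs
  · have := abelE_pos_of_small (by lia) hθ0 (by linarith) hs
    rwa [hcos, sub_sub_cancel] at this
  have hxs : x = 2 * Real.sin (θ / 2) ^ 2 := by
    rw [Real.sin_sq, Real.cos_sq, show 2 * (θ / 2) = θ by ring, hcos]; ring
  obtain ⟨b1, b2⟩ := boundary_values ℓ hℓ
  have ev := fun (f g : ℝ[X]) (h : f = g) (x : ℝ) => congrArg (eval x) h
  have a1 := ev _ _ (X_mul_derivative_abelP ℓ)
  have a2 := ev _ _ (sub_X_mul_derivative_abelQ ℓ)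
  have a3 := ev _ _ (two_X_mul_derivative_abelS ℓ)
  have a4 := ev _ _ (derivative_abelD ℓ) x
  simp only [eval_mul, eval_sub, eval_X, eval_neg, eval_natCast, eval_ofNat, eval_add, eval_pow,
    eval_one] at a1 a2 a3 a4
  have hr : 1 ≤ 0.6367 * ((ℓ : ℝ) * Real.sin (θ / 2)) := by
    -- The least possible `θ/2` here. Since `ℓy = π/2 + y`, the cubic bound for the sine gives `ℓ
    -- sin y ≥ (π/2 + y)(1 - y²/6) ≥ 1.5707`, and `0.6367 · 1.5707 > 1`.
    set y := Real.pi / (2 * (ℓ - 1)) with hy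
    have hl1 : (0 : ℝ) < ℓ - 1 := by linarith
    have hy0 : 0 < y := by positivity
    have hyl : y * (ℓ - 1) = Real.pi / 2 := by rw [hy]; field_simp
    have hy1 : y ≤ 0.15 := by nlinarith
    have hyθ : y ≤ θ / 2 := by
      rw [hy, div_le_iff₀ (by linarith)]; nlinarith
    have hsin : Real.sin y ≤ Real.sin (θ / 2) :=
      Real.sin_le_sin_of_le_of_le_pi_div_two (by linarith) (by linarith) hyθ
    have hc := Real.sin_gt_sub_cube hy0
    have h5 : (ℓ : ℝ) * (y - y ^ 3 / 6) ≤ ℓ * Real.sin (θ / 2) := by gcongr; linarith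
    have h6 : (ℓ : ℝ) * (y - y ^ 3 / 6) = (Real.pi / 2 + y) * (1 - y ^ 2 / 6) := by
      rw [← hyl]; ring
    have h7 : 1.5707 ≤ (Real.pi / 2 + y) * (1 - y ^ 2 / 6) := by nlinarith
    norm_num at *
    linarith
  have hmain := osc_pos hℓr (fun x => (abelP ℓ).hasDerivAt x) (fun x => (abelQ ℓ).hasDerivAt x)
    (fun x => (abelS ℓ).hasDerivAt x) a1 a2 a3 b1 b2 hθ0 hθ1 hr hxs
  rw [abelE]
  have h8 : 0 < 16 * x ^ 2 * (2 - x) ^ 2 * -(derivative (abelD ℓ)).eval x := by linarith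
  exact pos_of_mul_pos_right h8 (by positivity)

end BoundaryValues

/-! ### Small degrees: explicit polynomials and certificates of positivity. -/

open Polynomial in
theorem abelE_of_geg {n N : ℕ} (a : Fin N → ℝ)
    (h : ∀ w, geg 2 n (1 - w) = ∑ j, a j * w ^ (j : ℕ)) (x : ℝ) :
    abelE (n + 1) x = -2 * ∑ j, a j * wallisRatio j * (j * x ^ ((j : ℕ) - 1)) := by
  have h1 : (derivative (Chebyshev.U ℝ (n + 1 : ℕ))).comp (1 - X)
      = ∑ j, C (2 * a j) * X ^ (j : ℕ) := by
    refine Polynomial.funext fun w => ?_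
    rw [eval_comp, eval_derivative_U _ (by lia), eval_finsetSum]
    have e : ((n + 1 : ℕ) : ℤ) - 1 = n := by push_cast; ring
    simp only [eval_sub, eval_one, eval_X, e, h, eval_mul, eval_C, eval_pow, Finset.mul_sum]
    exact Finset.sum_congr rfl fun j _ => by ring
  have h2 : abelD (n + 1) = ∑ j, C (2 * a j * wallisRatio j) * X ^ (j : ℕ) := by
    rw [abelD, h1, map_sum]
    refine Finset.sum_congr rfl fun j _ => ?_
    ext i
    rw [coeff_abelMean, coeff_C_mul_X_pow, coeff_C_mul_X_pow]
    split_ifs with hij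
    · rw [hij]; ring
    · simp
  rw [abelE, h2, derivative_sum, eval_finsetSum, Finset.mul_sum, ← Finset.sum_neg_distrib]
  refine Finset.sum_congr rfl fun j _ => ?_
  simp only [derivative_mul, derivative_C, derivative_X_pow, eval_add, eval_mul, eval_C, eval_pow,
    eval_X, zero_mul, eval_zero]
  ring

theorem geg_two_explicit (w : ℝ) :
    geg 2 0 (1 - w) = 1 ∧
    geg 2 1 (1 - w) = 4 - 4 * w ∧
    geg 2 2 (1 - w) = 10 - 24 * w + 12 * w ^ 2 ∧
    geg 2 3 (1 - w) = 20 - 84 * w + 96 * w ^ 2 - 32 * w ^ 3 ∧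
    geg 2 4 (1 - w) = 35 - 224 * w + 432 * w ^ 2 - 320 * w ^ 3 + 80 * w ^ 4 ∧
    geg 2 5 (1 - w) = 56 - 504 * w + 1440 * w ^ 2 - 1760 * w ^ 3 + 960 * w ^ 4 - 192 * w ^ 5 ∧
    geg 2 6 (1 - w) = 84 - 1008 * w + 3960 * w ^ 2 - 7040 * w ^ 3 + 6240 * w ^ 4 - 2688 * w ^ 5 + 448 * w ^ 6 ∧
    geg 2 7 (1 - w) = 120 - 1848 * w + 9504 * w ^ 2 - 22880 * w ^ 3 + 29120 * w ^ 4 - 20160 * w ^ 5 + 7168 * w ^ 6 - 1024 * w ^ 7 ∧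
    geg 2 8 (1 - w) = 165 - 3168 * w + 20592 * w ^ 2 - 64064 * w ^ 3 + 109200 * w ^ 4 - 107520 * w ^ 5 + 60928 * w ^ 6 - 18432 * w ^ 7 + 2304 * w ^ 8 ∧
    geg 2 9 (1 - w) = 220 - 5148 * w + 41184 * w ^ 2 - 160160 * w ^ 3 + 349440 * w ^ 4 - 456960 * w ^ 5 + 365568 * w ^ 6 - 175104 * w ^ 7 + 46080 * w ^ 8 - 5120 * w ^ 9 ∧
    geg 2 10 (1 - w) = 286 - 8008 * w + 77220 * w ^ 2 - 366080 * w ^ 3 + 990080 * w ^ 4 - 1645056 * w ^ 5 + 1736448 * w ^ 6 - 1167360 * w ^ 7 + 483840 * w ^ 8 - 112640 * w ^ 9 + 11264 * w ^ 10 := by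
  have h0 : geg 2 0 (1 - w) = 1 := geg_zero _ _
  have h1 : geg 2 1 (1 - w) = 4 - 4 * w := by rw [geg_one]; ring
  have h2 : geg 2 2 (1 - w) = 10 - 24 * w + 12 * w ^ 2 := by
    have r := geg_rec 2 0 (1 - w)
    norm_num [h1, h0] at r
    linear_combination r / 2
  have h3 : geg 2 3 (1 - w) = 20 - 84 * w + 96 * w ^ 2 - 32 * w ^ 3 := by
    have r := geg_rec 2 1 (1 - w)
    norm_num [h2, h1] at r
    linear_combination r / 3
  have h4 : geg 2 4 (1 - w) = 35 - 224 * w + 432 * w ^ 2 - 320 * w ^ 3 + 80 * w ^ 4 := by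
    have r := geg_rec 2 2 (1 - w)
    norm_num [h3, h2] at r
    linear_combination r / 4
  have h5 : geg 2 5 (1 - w) = 56 - 504 * w + 1440 * w ^ 2 - 1760 * w ^ 3 + 960 * w ^ 4 - 192 * w ^ 5 := by
    have r := geg_rec 2 3 (1 - w)
    norm_num [h4, h3] at r
    linear_combination r / 5
  have h6 : geg 2 6 (1 - w) = 84 - 1008 * w + 3960 * w ^ 2 - 7040 * w ^ 3 + 6240 * w ^ 4 - 2688 * w ^ 5 + 448 * w ^ 6 := by
    have r := geg_rec 2 4 (1 - w)
    norm_num [h5, h4] at r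
    linear_combination r / 6
  have h7 : geg 2 7 (1 - w) = 120 - 1848 * w + 9504 * w ^ 2 - 22880 * w ^ 3 + 29120 * w ^ 4 - 20160 * w ^ 5 + 7168 * w ^ 6 - 1024 * w ^ 7 := by
    have r := geg_rec 2 5 (1 - w)
    norm_num [h6, h5] at r
    linear_combination r / 7
  have h8 : geg 2 8 (1 - w) = 165 - 3168 * w + 20592 * w ^ 2 - 64064 * w ^ 3 + 109200 * w ^ 4 - 107520 * w ^ 5 + 60928 * w ^ 6 - 18432 * w ^ 7 + 2304 * w ^ 8 := by
    have r := geg_rec 2 6 (1 - w)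
    norm_num [h7, h6] at r
    linear_combination r / 8
  have h9 : geg 2 9 (1 - w) = 220 - 5148 * w + 41184 * w ^ 2 - 160160 * w ^ 3 + 349440 * w ^ 4 - 456960 * w ^ 5 + 365568 * w ^ 6 - 175104 * w ^ 7 + 46080 * w ^ 8 - 5120 * w ^ 9 := by
    have r := geg_rec 2 7 (1 - w)
    norm_num [h8, h7] at r
    linear_combination r / 9
  have h10 : geg 2 10 (1 - w) = 286 - 8008 * w + 77220 * w ^ 2 - 366080 * w ^ 3 + 990080 * w ^ 4 - 1645056 * w ^ 5 + 1736448 * w ^ 6 - 1167360 * w ^ 7 + 483840 * w ^ 8 - 112640 * w ^ 9 + 11264 * w ^ 10 := by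
    have r := geg_rec 2 8 (1 - w)
    norm_num [h9, h8] at r
    linear_combination r / 10
  exact ⟨h0, h1, h2, h3, h4, h5, h6, h7, h8, h9, h10⟩

theorem abelE_explicit (x : ℝ) :
    abelE 1 x = 0 ∧
    abelE 2 x = 4 ∧
    abelE 3 x = 24 - 18 * x ∧
    abelE 4 x = 84 - 144 * x + 60 * x ^ 2 ∧
    abelE 5 x = 224 - 648 * x + 600 * x ^ 2 - 175 * x ^ 3 ∧
    abelE 6 x = 504 - 2160 * x + 3300 * x ^ 2 - 2100 * x ^ 3 + 945 / 2 * x ^ 4 ∧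
    abelE 7 x = 1008 - 5940 * x + 13200 * x ^ 2 - 13650 * x ^ 3 + 6615 * x ^ 4 - 4851 / 4 * x ^ 5 ∧
    abelE 8 x = 1848 - 14256 * x + 42900 * x ^ 2 - 63700 * x ^ 3 + 99225 / 2 * x ^ 4 - 19404 * x ^ 5 + 3003 * x ^ 6 ∧
    abelE 9 x = 3168 - 30888 * x + 120120 * x ^ 2 - 238875 * x ^ 3 + 264600 * x ^ 4 - 164934 * x ^ 5 + 54054 * x ^ 6 - 57915 / 8 * x ^ 7 ∧
    abelE 10 x = 5148 - 61776 * x + 300300 * x ^ 2 - 764400 * x ^ 3 + 1124550 * x ^ 4 - 989604 * x ^ 5 + 513513 * x ^ 6 - 289575 / 2 * x ^ 7 + 546975 / 32 * x ^ 8 ∧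
    abelE 11 x = 8008 - 115830 * x + 686400 * x ^ 2 - 2165800 * x ^ 3 + 4048380 * x ^ 4 - 4700619 * x ^ 5 + 3423420 * x ^ 6 - 6081075 / 4 * x ^ 7 + 6016725 / 16 * x ^ 8 - 2540395 / 64 * x ^ 9 := by
  have g := geg_two_explicit
  refine ⟨?_, ?_, ?_, ?_, ?_, ?_, ?_, ?_, ?_, ?_, ?_⟩
  · rw [abelE_of_geg (n := 0) ![1] fun w => by
      refine ((g w).1).trans ?_; simp]
    norm_num [Fin.sum_univ_succ, wallisRatio, Finset.prod_range_succ]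
  · rw [abelE_of_geg (n := 1) ![4, -4] fun w => by
      refine ((g w).2.1).trans ?_; simp [Fin.sum_univ_succ]; ring]
    norm_num [Fin.sum_univ_succ, wallisRatio, Finset.prod_range_succ]; try ring
  · rw [abelE_of_geg (n := 2) ![10, -24, 12] fun w => by
      refine ((g w).2.2.1).trans ?_; simp [Fin.sum_univ_succ]; ring]
    norm_num [Fin.sum_univ_succ, wallisRatio, Finset.prod_range_succ]; try ring
  · rw [abelE_of_geg (n := 3) ![20, -84, 96, -32] fun w => by
      refine ((g w).2.2.2.1).trans ?_; simp [Fin.sum_univ_succ]; ring]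
    norm_num [Fin.sum_univ_succ, wallisRatio, Finset.prod_range_succ]; try ring
  · rw [abelE_of_geg (n := 4) ![35, -224, 432, -320, 80] fun w => by
      refine ((g w).2.2.2.2.1).trans ?_; simp [Fin.sum_univ_succ]; ring]
    norm_num [Fin.sum_univ_succ, wallisRatio, Finset.prod_range_succ]; try ring
  · rw [abelE_of_geg (n := 5) ![56, -504, 1440, -1760, 960, -192] fun w => by
      refine ((g w).2.2.2.2.2.1).trans ?_; simp [Fin.sum_univ_succ]; ring]
    norm_num [Fin.sum_univ_succ, wallisRatio, Finset.prod_range_succ]; try ring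
  · rw [abelE_of_geg (n := 6) ![84, -1008, 3960, -7040, 6240, -2688, 448] fun w => by
      refine ((g w).2.2.2.2.2.2.1).trans ?_; simp [Fin.sum_univ_succ]; ring]
    norm_num [Fin.sum_univ_succ, wallisRatio, Finset.prod_range_succ]; try ring
  · rw [abelE_of_geg (n := 7) ![120, -1848, 9504, -22880, 29120, -20160, 7168, -1024] fun w => by
      refine ((g w).2.2.2.2.2.2.2.1).trans ?_; simp [Fin.sum_univ_succ]; ring]
    norm_num [Fin.sum_univ_succ, wallisRatio, Finset.prod_range_succ]; try ring
  · rw [abelE_of_geg (n := 8) ![165, -3168, 20592, -64064, 109200, -107520, 60928, -18432, 2304] fun w => by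
      refine ((g w).2.2.2.2.2.2.2.2.1).trans ?_; simp [Fin.sum_univ_succ]; ring]
    norm_num [Fin.sum_univ_succ, wallisRatio, Finset.prod_range_succ]; try ring
  · rw [abelE_of_geg (n := 9) ![220, -5148, 41184, -160160, 349440, -456960, 365568, -175104, 46080, -5120] fun w => by
      refine ((g w).2.2.2.2.2.2.2.2.2.1).trans ?_; simp [Fin.sum_univ_succ]; ring]
    norm_num [Fin.sum_univ_succ, wallisRatio, Finset.prod_range_succ]; try ring
  · rw [abelE_of_geg (n := 10) ![286, -8008, 77220, -366080, 990080, -1645056, 1736448, -1167360, 483840, -112640, 11264] fun w => by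
      refine ((g w).2.2.2.2.2.2.2.2.2.2).trans ?_; simp [Fin.sum_univ_succ]; ring]
    norm_num [Fin.sum_univ_succ, wallisRatio, Finset.prod_range_succ]; try ring

theorem abelE_pos_2 (x : ℝ) : 0 < abelE 2 x := by
  rw [(abelE_explicit x).2.1]; norm_num

/-- Bernstein certificate, here and below: on an interval `[a, b]` the polynomial is rewritten as a
form in `x - a` and `b - x` with positive coefficients, after cutting `(0, 1)` where one interval
does not suffice. -/
theorem abelE_pos_3 {x : ℝ} (h0 : 0 < x) (h1 : x < 1) : 0 < abelE 3 x := by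
  rw [(abelE_explicit x).2.2.1]
  obtain ⟨s, hs⟩ : ∃ s, s = 1 - x := ⟨_, rfl⟩
  have hs0 : 0 < s := by linarith
  refine lt_of_lt_of_eq (b := 24 * s + 6 * x) (by positivity) ?_
  subst hs; ring

theorem abelE_pos_4 {x : ℝ} (h0 : 0 < x) (h1 : x < 1) : 0 < abelE 4 x := by
  rw [(abelE_explicit x).2.2.2.1]
  obtain ⟨s, hs⟩ : ∃ s, s = 1 - x := ⟨_, rfl⟩
  have hs0 : 0 < s := by linarith
  refine lt_of_lt_of_eq (b := 84 * s ^ 2 + 24 * x * s) (by positivity) ?_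
  subst hs; ring

theorem abelE_pos_6 {x : ℝ} (h0 : 0 < x) (h1 : x < 1) : 0 < abelE 6 x := by
  rw [(abelE_explicit x).2.2.2.2.2.1]
  rcases lt_or_ge x (13 / 20) with hb | ha0
  · obtain ⟨s, hs⟩ : ∃ s, s = 13 / 20 - x := ⟨_, rfl⟩
    have hs0 : 0 < s := by linarith
    refine lt_of_lt_of_eq (b := 80640000 / 28561 * s ^ 4 + 97920000 / 28561 * x * s ^ 3 + 33000000 / 28561 * x ^ 2 * s ^ 2
      + 2526000 / 28561 * x ^ 3 * s + 602145 / 57122 * x ^ 4) (by positivity) ?_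
    subst hs; ring
  obtain ⟨s, hs⟩ : ∃ s, s = 1 - x := ⟨_, rfl⟩
  obtain ⟨t, ht⟩ : ∃ t, t = x - 13 / 20 := ⟨_, rfl⟩
  have ht0 : 0 ≤ t := by linarith
  have hs0 : 0 < s := by linarith
  refine lt_of_lt_of_eq (b := 602145 / 4802 * s ^ 4 + 492600 / 2401 * t * s ^ 3 + 7566000 / 2401 * t ^ 2 * s ^ 2 + 8880000
    / 2401 * t ^ 3 * s + 2640000 / 2401 * t ^ 4) (by positivity) ?_
  subst hs ht; ring

theorem abelE_pos_7 {x : ℝ} (h0 : 0 < x) (h1 : x < 1) : 0 < abelE 7 x := by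
  rw [(abelE_explicit x).2.2.2.2.2.2.1]
  rcases lt_or_ge x (3 / 5) with hb | ha0
  · obtain ⟨s, hs⟩ : ∃ s, s = 3 / 5 - x := ⟨_, rfl⟩
    have hs0 : 0 < s := by linarith
    refine lt_of_lt_of_eq (b := 350000 / 27 * s ^ 5 + 512500 / 27 * x * s ^ 4 + 200000 / 27 * x ^ 2 * s ^ 3 + 1250 / 27 *
      x ^ 3 * s ^ 2 + 175 / 27 * x ^ 4 * s + 14723 / 108 * x ^ 5) (by positivity) ?_
    subst hs; ring
  obtain ⟨s, hs⟩ : ∃ s, s = 1 - x := ⟨_, rfl⟩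
  obtain ⟨t, ht⟩ : ∃ t, t = x - 3 / 5 := ⟨_, rfl⟩
  have ht0 : 0 ≤ t := by linarith
  have hs0 : 0 < s := by linarith
  refine lt_of_lt_of_eq (b := 132507 / 128 * s ^ 5 + 1100025 / 128 * t * s ^ 4 + 1836375 / 64 * t ^ 2 * s ^ 3 + 2015625 /
    64 * t ^ 3 * s ^ 2 + 1734375 / 128 * t ^ 4 * s + 253125 / 128 * t ^ 5) (by positivity) ?_
  subst hs ht; ring

theorem abelE_pos_8 {x : ℝ} (h0 : 0 < x) (h1 : x < 1) : 0 < abelE 8 x := by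
  rw [(abelE_explicit x).2.2.2.2.2.2.2.1]
  rcases lt_or_ge x (1 / 2) with hb | ha0
  · obtain ⟨s, hs⟩ : ∃ s, s = 1 / 2 - x := ⟨_, rfl⟩
    have hs0 : 0 < s := by linarith
    refine lt_of_lt_of_eq (b := 118272 * s ^ 6 + 253440 * x * s ^ 5 + 179520 * x ^ 2 * s ^ 4 + 39520 * x ^ 3 * s ^ 3 + 210
      * x ^ 4 * s ^ 2 + 3564 * x ^ 5 * s + 1525 * x ^ 6) (by positivity) ?_
    subst hs; ring
  obtain ⟨s, hs⟩ : ∃ s, s = 1 - x := ⟨_, rfl⟩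
  obtain ⟨t, ht⟩ : ∃ t, t = x - 1 / 2 := ⟨_, rfl⟩
  have ht0 : 0 ≤ t := by linarith
  have hs0 : 0 < s := by linarith
  refine lt_of_lt_of_eq (b := 1525 * s ^ 6 + 14736 * t * s ^ 5 + 56070 * t ^ 2 * s ^ 4 + 63600 * t ^ 3 * s ^ 3 + 28320 * t
    ^ 4 * s ^ 2 + 4800 * t ^ 5 * s + 224 * t ^ 6) (by positivity) ?_
  subst hs ht; ring

theorem abelE_pos_9 {x : ℝ} (h0 : 0 < x) (h1 : x < 1) : 0 < abelE 9 x := by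
  rw [(abelE_explicit x).2.2.2.2.2.2.2.2.1]
  rcases lt_or_ge x (2 / 5) with hb | ha0
  · obtain ⟨s, hs⟩ : ∃ s, s = 2 / 5 - x := ⟨_, rfl⟩
    have hs0 : 0 < s := by linarith
    refine lt_of_lt_of_eq (b := 7734375 / 4 * s ^ 7 + 47953125 / 8 * x * s ^ 6 + 28359375 / 4 * x ^ 2 * s ^ 5 + 62109375 /
      16 * x ^ 3 * s ^ 4 + 1940625 / 2 * x ^ 4 * s ^ 3 + 723525 / 4 * x ^ 5 * s ^ 2 + 187545 / 2
      * x ^ 6 * s + 374805 / 16 * x ^ 7) (by positivity) ?_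
    subst hs; ring
  rcases lt_or_ge x (9 / 10) with hb | ha1
  · obtain ⟨s, hs⟩ : ∃ s, s = 9 / 10 - x := ⟨_, rfl⟩
    obtain ⟨t, ht⟩ : ∃ t, t = x - 2 / 5 := ⟨_, rfl⟩
    have ht0 : 0 ≤ t := by linarith
    have hs0 : 0 < s := by linarith
    refine lt_of_lt_of_eq (b := 76760064 / 15625 * s ^ 7 + 824878848 / 15625 * t * s ^ 6 + 3901422144 / 15625 * t ^ 2 * s
      ^ 5 + 1128768048 / 3125 * t ^ 3 * s ^ 4 + 680557848 / 3125 * t ^ 4 * s ^ 3 + 877782594 /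
      15625 * t ^ 5 * s ^ 2 + 166285071 / 31250 * t ^ 6 * s + 35976537 / 125000 * t ^ 7) (by positivity) ?_
    subst hs ht; ring
  obtain ⟨s, hs⟩ : ∃ s, s = 1 - x := ⟨_, rfl⟩
  obtain ⟨t, ht⟩ : ∃ t, t = x - 9 / 10 := ⟨_, rfl⟩
  have ht0 : 0 ≤ t := by linarith
  have hs0 : 0 < s := by linarith
  refine lt_of_lt_of_eq (b := 179882685 / 8 * s ^ 7 + 422937135 / 4 * t * s ^ 6 + 513773625 / 2 * t ^ 2 * s ^ 5 +
    481261875 * t ^ 3 * s ^ 4 + 678318750 * t ^ 4 * s ^ 3 + 602812500 * t ^ 5 * s ^ 2 +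
    288375000 * t ^ 6 * s + 56250000 * t ^ 7) (by positivity) ?_
  subst hs ht; ring

theorem abelE_pos_10 {x : ℝ} (h0 : 0 < x) (h1 : x < 1) : 0 < abelE 10 x := by
  rw [(abelE_explicit x).2.2.2.2.2.2.2.2.2.1]
  rcases lt_or_ge x (2 / 5) with hb | ha0
  · obtain ⟨s, hs⟩ : ∃ s, s = 2 / 5 - x := ⟨_, rfl⟩
    have hs0 : 0 < s := by linarith
    refine lt_of_lt_of_eq (b := 502734375 / 64 * s ^ 8 + 100546875 / 4 * x * s ^ 7 + 234609375 / 8 * x ^ 2 * s ^ 6 +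
      106640625 / 8 * x ^ 3 * s ^ 5 + 19359375 / 32 * x ^ 4 * s ^ 4 + 574875 / 2 * x ^ 5 * s ^ 3
      + 7099575 / 4 * x ^ 6 * s ^ 2 + 7494675 / 8 * x ^ 7 * s + 9401025 / 64 * x ^ 8) (by positivity) ?_
    subst hs; ring
  rcases lt_or_ge x (4 / 5) with hb | ha1
  · obtain ⟨s, hs⟩ : ∃ s, s = 4 / 5 - x := ⟨_, rfl⟩
    obtain ⟨t, ht⟩ : ∃ t, t = x - 2 / 5 := ⟨_, rfl⟩
    have ht0 : 0 ≤ t := by linarith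
    have hs0 : 0 < s := by linarith
    refine lt_of_lt_of_eq (b := 9401025 / 64 * s ^ 8 + 11307375 / 8 * t * s ^ 7 + 20444025 / 4 * t ^ 2 * s ^ 6 + 8124375 *
      t ^ 3 * s ^ 5 + 205713375 / 32 * t ^ 4 * s ^ 4 + 20773725 / 8 * t ^ 5 * s ^ 3 + 4165875 /
      8 * t ^ 6 * s ^ 2 + 262425 / 4 * t ^ 7 * s + 642375 / 64 * t ^ 8) (by positivity) ?_
    subst hs ht; ring
  obtain ⟨s, hs⟩ : ∃ s, s = 1 - x := ⟨_, rfl⟩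
  obtain ⟨t, ht⟩ : ∃ t, t = x - 4 / 5 := ⟨_, rfl⟩
  have ht0 : 0 ≤ t := by linarith
  have hs0 : 0 < s := by linarith
  refine lt_of_lt_of_eq (b := 2569500 * s ^ 8 + 22436400 * t * s ^ 7 + 107030700 * t ^ 2 * s ^ 6 + 305697000 * t ^ 3 * s ^
    5 + 523031250 * t ^ 4 * s ^ 4 + 536812500 * t ^ 5 * s ^ 3 + 323203125 * t ^ 6 * s ^ 2 +
    210234375 / 2 * t ^ 7 * s + 455859375 / 32 * t ^ 8) (by positivity) ?_
  subst hs ht; ring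

theorem abelE_pos_11 {x : ℝ} (h0 : 0 < x) (h1 : x < 1) : 0 < abelE 11 x := by
  rw [(abelE_explicit x).2.2.2.2.2.2.2.2.2.2]
  rcases lt_or_ge x (3 / 10) with hb | ha0
  · obtain ⟨s, hs⟩ : ∃ s, s = 3 / 10 - x := ⟨_, rfl⟩
    have hs0 : 0 < s := by linarith
    refine lt_of_lt_of_eq (b := 8008000000000 / 19683 * s ^ 9 + 4147000000000 / 2187 * x * s ^ 8 + 8008000000000 / 2187 *
      x ^ 2 * s ^ 7 + 24551800000000 / 6561 * x ^ 3 * s ^ 6 + 4699142000000 / 2187 * x ^ 4 * s ^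
      5 + 1569542870000 / 2187 * x ^ 5 * s ^ 4 + 1360145500000 / 6561 * x ^ 6 * s ^ 3 +
      222365749375 / 2187 * x ^ 7 * s ^ 2 + 683110792625 / 17496 * x ^ 8 * s + 7350737714215 /
      1259712 * x ^ 9) (by positivity) ?_
    subst hs; ring
  rcases lt_or_ge x (7 / 10) with hb | ha1
  · obtain ⟨s, hs⟩ : ∃ s, s = 7 / 10 - x := ⟨_, rfl⟩
    obtain ⟨t, ht⟩ : ∃ t, t = x - 3 / 10 := ⟨_, rfl⟩
    have ht0 : 0 ≤ t := by linarith
    have hs0 : 0 < s := by linarith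
    refine lt_of_lt_of_eq (b := 7350737714215 / 16777216 * s ^ 9 + 88786855906515 / 16777216 * t * s ^ 8 + 111078144740535
      / 4194304 * t ^ 2 * s ^ 7 + 236769773417135 / 4194304 * t ^ 3 * s ^ 6 + 513036536523945 /
      8388608 * t ^ 4 * s ^ 5 + 303544729805205 / 8388608 * t ^ 5 * s ^ 4 + 49551283818715 /
      4194304 * t ^ 6 * s ^ 3 + 9379854926715 / 4194304 * t ^ 7 * s ^ 2 + 6117949654335 /
      16777216 * t ^ 8 * s + 918696454235 / 16777216 * t ^ 9) (by positivity) ?_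
    subst hs ht; ring
  obtain ⟨s, hs⟩ : ∃ s, s = 1 - x := ⟨_, rfl⟩
  obtain ⟨t, ht⟩ : ∃ t, t = x - 7 / 10 := ⟨_, rfl⟩
  have ht0 : 0 ≤ t := by linarith
  have hs0 : 0 < s := by linarith
  refine lt_of_lt_of_eq (b := 918696454235 / 1259712 * s ^ 9 + 548944828525 / 69984 * t * s ^ 8 + 403836710375 / 8748 * t
    ^ 2 * s ^ 7 + 2031661279375 / 13122 * t ^ 3 * s ^ 6 + 1319251863125 / 4374 * t ^ 4 * s ^ 5 +
    767929421875 / 2187 * t ^ 5 * s ^ 4 + 1619824062500 / 6561 * t ^ 6 * s ^ 3 + 223803125000 /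
    2187 * t ^ 7 * s ^ 2 + 50117187500 / 2187 * t ^ 8 * s + 41890625000 / 19683 * t ^ 9) (by positivity) ?_
  subst hs ht; ring

/-- `abelE 5`, which belongs to `C_4^2`, is negative near `x = 0.9`; this and the next two lemmas
compensate it by a neighbour. Their names count the degree of the Gegenbauer polynomial, one less
than the index of `abelE`. -/
theorem abelE_four_add_three_pos {x : ℝ} (h0 : 0 < x) (h1 : x < 1) : 0 < abelE 5 x + abelE 4 x := by
  rw [(abelE_explicit x).2.2.2.2.1, (abelE_explicit x).2.2.2.1]
  obtain ⟨s, hs⟩ : ∃ s, s = 1 - x := ⟨_, rfl⟩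
  have hs0 : 0 < s := by linarith
  refine lt_of_lt_of_eq (b := 308 * s ^ 3 + 132 * x * s ^ 2 + 1 * x ^ 3) (by positivity) ?_
  subst hs; ring

theorem abelE_five_add_four_pos {x : ℝ} (h0 : 0 < x) (h1 : x < 1) : 0 < abelE 6 x + abelE 5 x := by
  rw [(abelE_explicit x).2.2.2.2.2.1, (abelE_explicit x).2.2.2.2.1]
  rcases lt_or_ge x (4 / 5) with hb | ha0
  · obtain ⟨s, hs⟩ : ∃ s, s = 4 / 5 - x := ⟨_, rfl⟩
    have hs0 : 0 < s := by linarith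
    refine lt_of_lt_of_eq (b := 56875 / 32 * s ^ 4 + 1625 * x * s ^ 3 + 4875 / 16 * x ^ 2 * s ^ 2 + 495 / 32 * x ^ 4) (by positivity) ?_
    subst hs; ring
  obtain ⟨s, hs⟩ : ∃ s, s = 1 - x := ⟨_, rfl⟩
  obtain ⟨t, ht⟩ : ∃ t, t = x - 4 / 5 := ⟨_, rfl⟩
  have ht0 : 0 ≤ t := by linarith
  have hs0 : 0 < s := by linarith
  refine lt_of_lt_of_eq (b := 3960 * s ^ 4 + 19800 * t * s ^ 3 + 42000 * t ^ 2 * s ^ 2 + 36625 * t ^ 3 * s + 21875 / 2 * t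
    ^ 4) (by positivity) ?_
  subst hs ht; ring

theorem abelE_four_add_two_pos {x : ℝ} (h0 : 0 < x) (h1 : x < 1) : 0 < abelE 5 x + abelE 3 x / 3 := by
  rw [(abelE_explicit x).2.2.2.2.1, (abelE_explicit x).2.2.1]
  rcases lt_or_ge x (9 / 10) with hb | ha0
  · obtain ⟨s, hs⟩ : ∃ s, s = 9 / 10 - x := ⟨_, rfl⟩
    have hs0 : 0 < s := by linarith
    refine lt_of_lt_of_eq (b := 232000 / 729 * s ^ 3 + 35800 / 243 * x * s ^ 2 + 1600 / 243 * x ^ 2 * s + 1825 / 729 * x ^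
      3) (by positivity) ?_
    subst hs; ring
  obtain ⟨s, hs⟩ : ∃ s, s = 1 - x := ⟨_, rfl⟩
  obtain ⟨t, ht⟩ : ∃ t, t = x - 9 / 10 := ⟨_, rfl⟩
  have ht0 : 0 ≤ t := by linarith
  have hs0 : 0 < s := by linarith
  refine lt_of_lt_of_eq (b := 1825 * s ^ 3 + 5550 * t * s ^ 2 + 6900 * t ^ 2 * s + 3000 * t ^ 3) (by positivity) ?_
  subst hs ht; ring

theorem abelE_pos {n : ℕ} (hn : 1 ≤ n) (h4 : n ≠ 4) {x : ℝ} (h0 : 0 < x) (h1 : x < 1) :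
    0 < abelE (n + 1) x := by
  rcases le_or_gt 11 n with h | h
  · exact abelE_pos_of_large (by lia) h0 h1
  · interval_cases n
    · exact abelE_pos_2 x
    · exact abelE_pos_3 h0 h1
    · exact abelE_pos_4 h0 h1
    · exact absurd rfl h4
    · exact abelE_pos_6 h0 h1
    · exact abelE_pos_7 h0 h1
    · exact abelE_pos_8 h0 h1
    · exact abelE_pos_9 h0 h1
    · exact abelE_pos_10 h0 h1
    · exact abelE_pos_11 h0 h1

theorem abelE_one (x : ℝ) : abelE 1 x = 0 := (abelE_explicit x).1

/-! ### Strict monotonicity of the mean of the zonal polynomial for every `ν` that occurs. -/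

/-- The negative derivative of the mean of `C_n^ν(1 - w)`, up to a factor. -/
noncomputable def gegE (ν : ℝ) (n : ℕ) (x : ℝ) : ℝ :=
  ∑ k ∈ Finset.range (n / 2 + 1), (2 + n - 2 * k) * gegCoeff 2 ν n k * abelE (n - 2 * k + 1) x

/-- In the expansion of `C_{2i+4}^ν` the weights of `C_4^2` and `C_2^2` are `6` and `4` times these
coefficients, so the second weight is at least a third of the first, as `abelE_four_add_two_pos`
requires. -/
theorem gegCoeff_ratio {ν : ℝ} (hν : 5 / 2 ≤ ν) (i : ℕ) :
    gegCoeff 2 ν (2 * i + 4) i ≤ 2 * gegCoeff 2 ν (2 * i + 4) (i + 1) := by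
  have e1 : 2 * i + 4 - i = i + 4 := by lia
  have e2 : 2 * i + 4 - (i + 1) = i + 3 := by lia
  unfold gegCoeff
  rw [e1, e2, Finset.prod_range_succ _ i, Finset.prod_range_succ _ (i + 3),
    Finset.prod_range_succ _ (i + 4), Nat.factorial_succ]
  have hD : 0 < ∏ x ∈ Finset.range (i + 3 + 1), ((2 : ℝ) + x) :=
    Finset.prod_pos fun j _ => by positivity
  have hA : 0 ≤ ∏ x ∈ Finset.range i, (ν - 2 + (x : ℝ)) := Finset.prod_nonneg fun j _ => by
    have : (0 : ℝ) ≤ j := by positivity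
    linarith
  have hB : 0 ≤ ∏ x ∈ Finset.range (i + 3), (ν + (x : ℝ)) := Finset.prod_nonneg fun j _ => by
    have : (0 : ℝ) ≤ j := by positivity
    linarith
  rw [show i + 4 = i + 3 + 1 by ring]
  generalize (∏ x ∈ Finset.range (i + 3 + 1), ((2 : ℝ) + x)) = D at *
  generalize (∏ x ∈ Finset.range i, (ν - 2 + (x : ℝ))) = A at *
  generalize (∏ x ∈ Finset.range (i + 3), (ν + (x : ℝ))) = B at *
  have hi : (0 : ℝ) ≤ i := by positivity
  have hf : (0 : ℝ) < i.factorial := by positivity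
  push_cast
  have key : (ν + (i + 3)) * (i + 1) ≤ 2 * ((ν - 2 + i) * (2 + (i + 3 + 1))) := by nlinarith
  rw [mul_div_assoc', div_le_div_iff₀ (by positivity) (by positivity)]
  have := mul_le_mul_of_nonneg_left key (by positivity : 0 ≤ A * B * i.factorial * D)
  linarith

theorem gegE_pos_of_ge {ν : ℝ} (hν : 5 / 2 ≤ ν) {n : ℕ} (hn : 1 ≤ n) {x : ℝ} (h0 : 0 < x)
    (h1 : x < 1) : 0 < gegE ν n x := by
  have hterm : ∀ k, 2 * k + 1 ≤ n → n - 2 * k ≠ 4 →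
      0 < (2 + n - 2 * k) * gegCoeff 2 ν n k * abelE (n - 2 * k + 1) x := by
    intro k hk h4
    have hk' : (2 : ℝ) * k + 1 ≤ n := by exact_mod_cast hk
    exact mul_pos (mul_pos (by linarith) (gegCoeff_pos two_pos (by linarith) n k))
      (abelE_pos (by lia) h4 h0 h1)
  by_cases hbad : ∃ i, n = 2 * i + 4
  -- The last three terms belong to `C_4^2`, `C_2^2` and `C_0^2`; the constant contributes nothing,
  -- and the other two are taken together.
  · obtain ⟨i, rfl⟩ := hbad
    rw [gegE, show (2 * i + 4) / 2 + 1 = i + 1 + 1 + 1 by lia, Finset.sum_range_succ,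
      Finset.sum_range_succ, Finset.sum_range_succ]
    have hs : 0 ≤ ∑ k ∈ Finset.range i, (2 + ((2 * i + 4 : ℕ) : ℝ) - 2 * k) *
        gegCoeff 2 ν (2 * i + 4) k * abelE (2 * i + 4 - 2 * k + 1) x := by
      refine Finset.sum_nonneg fun k hk => ?_
      rw [Finset.mem_range] at hk
      exact (hterm k (by lia) (by lia)).le
    have e1 : 2 * i + 4 - 2 * i + 1 = 5 := by lia
    have e2 : 2 * i + 4 - 2 * (i + 1) + 1 = 3 := by lia
    have e3 : 2 * i + 4 - 2 * (i + 1 + 1) + 1 = 1 := by lia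
    rw [e1, e2, e3, abelE_one, mul_zero, add_zero]
    have hr := gegCoeff_ratio hν i
    have hp := gegCoeff_pos two_pos (by linarith : 2 < ν) (2 * i + 4) i
    have a1 := abelE_four_add_two_pos h0 h1
    have a2 := abelE_pos_3 h0 h1
    push_cast
    have h5 : (2 + (2 * (i : ℝ) + 4) - 2 * i) = 6 := by ring
    have h6 : (2 + (2 * (i : ℝ) + 4) - 2 * (i + 1)) = 4 := by ring
    push_cast at hs
    rw [h5, h6, add_assoc]
    refine add_pos_of_nonneg_of_pos hs ?_
    have b1 := mul_pos hp a1
    have b2 := mul_le_mul_of_nonneg_right hr a2.le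
    nlinarith
  · rw [gegE, Finset.sum_range_succ']
    refine add_pos_of_nonneg_of_pos (Finset.sum_nonneg fun k hk => ?_) ?_
    · rw [Finset.mem_range] at hk
      rcases Nat.lt_or_ge n (2 * (k + 1) + 1) with h | h
      · rw [show n - 2 * (k + 1) + 1 = 1 by lia, abelE_one, mul_zero]
      · exact (hterm (k + 1) h fun h4 => hbad ⟨k + 1, by lia⟩).le
    · exact hterm 0 (by lia) fun h4 => hbad ⟨0, by lia⟩

theorem gegE_zero (ν x : ℝ) : gegE ν 0 x = 0 := by simp [gegE, abelE_one]

theorem gegE_two (n : ℕ) (x : ℝ) : gegE 2 n x = abelE (n + 1) x := by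
  rw [gegE, Finset.sum_range_succ', Finset.sum_eq_zero, zero_add]
  · have hD : 0 < ∏ x ∈ Finset.range n, ((2 : ℝ) + x) :=
      Finset.prod_pos fun j _ => by positivity
    have h2 : (2 : ℝ) + n ≠ 0 := by positivity
    simp [gegCoeff, Finset.prod_range_succ]
    field_simp
  · intro k _
    have : gegCoeff 2 2 n (k + 1) = 0 := by
      rw [gegCoeff, Finset.prod_range_succ']; simp
    rw [this]; ring

/-- The alternative is that `ν = d/2 + 1` with `d = 2` or `d ≥ 3`. At `ν = 2` there is a single term
per degree, so the exceptional one must be compensated inside the zonal sum, at `n = 3` and `n = 4`.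
-/
theorem gegE_add_pos {ν : ℝ} (hν : ν = 2 ∨ 5 / 2 ≤ ν) (n : ℕ) {x : ℝ} (h0 : 0 < x)
    (h1 : x < 1) : 0 < gegE ν (n + 1) x + gegE ν n x := by
  rcases hν with rfl | hν
  · rw [gegE_two, gegE_two]
    rcases Nat.eq_zero_or_pos n with rfl | hn
    · rw [abelE_one, add_zero]; exact abelE_pos_2 x
    · by_cases h3 : n = 3
      · subst h3; exact abelE_four_add_three_pos h0 h1
      by_cases h4 : n = 4
      · subst h4; exact abelE_five_add_four_pos h0 h1
      · exact add_pos (abelE_pos (by lia) (by lia) h0 h1) (abelE_pos hn h4 h0 h1)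
  · have := gegE_pos_of_ge hν (n := n + 1) (by lia) h0 h1
    rcases Nat.eq_zero_or_pos n with rfl | hn
    · rw [gegE_zero, add_zero]; exact this
    · exact add_pos this (gegE_pos_of_ge hν hn h0 h1)

theorem continuous_geg (κ : ℝ) (m : ℤ) : Continuous (geg κ m) :=
  continuous_iff_continuousAt.2 fun u => (hasDerivAt_geg κ m u).continuousAt

open Polynomial in
theorem integral_geg_two (n : ℕ) (x : ℝ) :
    ∫ φ in (0 : ℝ)..Real.pi, geg 2 n (1 - x * ((1 - Real.cos φ) / 2))
      = Real.pi / 2 * (abelD (n + 1)).eval x := by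
  have h := integral_eval_eq_abelMean ((derivative (Chebyshev.U ℝ (n + 1 : ℕ))).comp (1 - X)) x
  rw [← abelD] at h
  have e : ((n + 1 : ℕ) : ℤ) - 1 = n := by push_cast; ring
  simp only [eval_comp, eval_sub, eval_one, eval_X] at h
  simp_rw [eval_derivative_U _ (by lia : (-1 : ℤ) ≤ ((n + 1 : ℕ) : ℤ)), e] at h
  rw [intervalIntegral.integral_const_mul] at h
  linarith

theorem integral_geg (ν : ℝ) (n : ℕ) (x : ℝ) :
    ∫ φ in (0 : ℝ)..Real.pi, geg ν n (1 - x * ((1 - Real.cos φ) / 2))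
      = ∑ k ∈ Finset.range (n / 2 + 1), (2 + n - 2 * k) * gegCoeff 2 ν n k *
        (Real.pi / 2 * (abelD (n - 2 * k + 1)).eval x) := by
  rw [intervalIntegral.integral_congr fun φ _ =>
    geg_connection two_pos ν (1 - x * ((1 - Real.cos φ) / 2)) n]
  rw [intervalIntegral.integral_finsetSum]
  · refine Finset.sum_congr rfl fun k _ => ?_
    rw [intervalIntegral.integral_const_mul, integral_geg_two]
  · intro k _
    refine Continuous.intervalIntegrable ?_ _ _
    have := continuous_geg 2 ((n - 2 * k : ℕ) : ℤ)
    fun_prop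

theorem hasDerivAt_integral_geg (ν : ℝ) (n : ℕ) (x : ℝ) :
    HasDerivAt (fun x => ∫ φ in (0 : ℝ)..Real.pi, geg ν n (1 - x * ((1 - Real.cos φ) / 2)))
      (-(Real.pi / 2 * gegE ν n x)) x := by
  simp_rw [integral_geg]
  refine (HasDerivAt.fun_sum fun k _ => (((abelD (n - 2 * k + 1)).hasDerivAt x).const_mul
    (Real.pi / 2)).const_mul ((2 + (n : ℝ) - 2 * k) * gegCoeff 2 ν n k)).congr_deriv ?_
  rw [gegE, Finset.mul_sum, ← Finset.sum_neg_distrib]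
  refine Finset.sum_congr rfl fun k _ => ?_
  rw [abelE]; ring

theorem strictAntiOn_integral_geg {ν : ℝ} (hν : ν = 2 ∨ 5 / 2 ≤ ν) (n : ℕ) :
    StrictAntiOn (fun x => ∫ φ in (0 : ℝ)..Real.pi, (geg ν (n + 1 : ℕ) (1 - x * ((1 - Real.cos φ) / 2))
      + geg ν n (1 - x * ((1 - Real.cos φ) / 2)))) (Set.Icc 0 1) := by
  have hi : ∀ (m : ℕ) (x : ℝ), IntervalIntegrable
      (fun φ => geg ν m (1 - x * ((1 - Real.cos φ) / 2))) volume 0 Real.pi := by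
    intro m x
    refine Continuous.intervalIntegrable ?_ _ _
    have := continuous_geg ν m
    fun_prop
  have hd : ∀ x, HasDerivAt (fun x => ∫ φ in (0 : ℝ)..Real.pi,
      (geg ν (n + 1 : ℕ) (1 - x * ((1 - Real.cos φ) / 2))
      + geg ν n (1 - x * ((1 - Real.cos φ) / 2)))) (-(Real.pi / 2 * (gegE ν (n + 1) x + gegE ν n x))) x := by
    intro x
    have e : (fun x => ∫ φ in (0 : ℝ)..Real.pi,
      (geg ν (n + 1 : ℕ) (1 - x * ((1 - Real.cos φ) / 2))
      + geg ν n (1 - x * ((1 - Real.cos φ) / 2)))) = fun x =>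
      (∫ φ in (0 : ℝ)..Real.pi, geg ν (n + 1 : ℕ) (1 - x * ((1 - Real.cos φ) / 2)))
      + ∫ φ in (0 : ℝ)..Real.pi, geg ν n (1 - x * ((1 - Real.cos φ) / 2)) :=
      funext fun x => intervalIntegral.integral_add (hi _ x) (hi _ x)
    rw [e]
    refine ((hasDerivAt_integral_geg ν (n + 1) x).add (hasDerivAt_integral_geg ν n x)).congr_deriv ?_
    ring
  refine strictAntiOn_of_deriv_neg (convex_Icc 0 1)
    (fun x _ => (hd x).continuousAt.continuousWithinAt) fun x hx => ?_
  rw [interior_Icc] at hx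
  rw [(hd x).deriv, neg_lt_zero]
  exact mul_pos (by positivity) (gegE_add_pos hν n hx.1 hx.2)

/-! ### Orthogonality of `C_n^{d/2}` and the one-variable reproducing property. -/

section Orthogonality

open Polynomial

theorem continuous_geg_cos (κ : ℝ) (m : ℤ) : Continuous fun φ => geg κ m (Real.cos φ) :=
  (continuous_geg κ m).comp Real.continuous_cos

/-- Green's identity for the Gegenbauer operator: by `geg_ode` the integrand is the derivative of a
Wronskian multiplied by `sin^{d+1}`, which vanishes at both ends. -/
theorem integral_geg_sturm (d n : ℕ) (q : ℝ[X]) :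
    ∫ φ in (0 : ℝ)..Real.pi, geg (d / 2) n (Real.cos φ) *
      ((1 - Real.cos φ ^ 2) * (derivative (derivative q)).eval (Real.cos φ)
        - (d + 1) * Real.cos φ * (derivative q).eval (Real.cos φ)
        + n * (n + d) * q.eval (Real.cos φ)) * Real.sin φ ^ d = 0 := by
  set κ : ℝ := d / 2 with hκ
  have hg : ∀ (κ : ℝ) (m : ℤ) (φ : ℝ), HasDerivAt (fun φ => geg κ m (Real.cos φ))
      (2 * κ * geg (κ + 1) (m - 1) (Real.cos φ) * -Real.sin φ) φ := fun κ m φ =>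
    (hasDerivAt_geg κ m _).comp φ (Real.hasDerivAt_cos φ)
  have hq : ∀ (q : ℝ[X]) (φ : ℝ), HasDerivAt (fun φ => q.eval (Real.cos φ))
      ((derivative q).eval (Real.cos φ) * -Real.sin φ) φ := fun q φ =>
    (q.hasDerivAt _).comp φ (Real.hasDerivAt_cos φ)
  have hF : ∀ φ, HasDerivAt (fun φ => -(Real.sin φ ^ (d + 1) * (geg κ n (Real.cos φ) *
      (derivative q).eval (Real.cos φ) - 2 * κ * geg (κ + 1) (n - 1) (Real.cos φ) *
        q.eval (Real.cos φ))))
      (geg κ n (Real.cos φ) *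
      ((1 - Real.cos φ ^ 2) * (derivative (derivative q)).eval (Real.cos φ)
        - (d + 1) * Real.cos φ * (derivative q).eval (Real.cos φ)
        + n * (n + d) * q.eval (Real.cos φ)) * Real.sin φ ^ d) φ := by
    intro φ
    refine (((Real.hasDerivAt_sin φ).pow (d + 1)).mul (((hg κ n φ).mul (hq (derivative q) φ)).sub
      (((hg (κ + 1) (n - 1) φ).const_mul (2 * κ)).mul (hq q φ)))).neg.congr_deriv ?_
    have ho := geg_ode κ n (Real.cos φ)
    have e1 : κ + 1 + 1 = κ + 2 := by ring
    have e2 : (n : ℤ) - 1 - 1 = n - 2 := by ring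
    have hs := Real.sin_sq_add_cos_sq φ
    have e3 : 2 * κ = d := by rw [hκ]; ring
    simp only [Pi.sub_apply, Pi.mul_apply, e1, e2, Pi.pow_apply, Nat.add_sub_cancel]
    rw [e3] at ho ⊢
    have e4 : 2 * (κ + 1) = d + 2 := by linarith
    have e5 : 4 * κ * (κ + 1) = d * (d + 2) := by rw [← e4, ← e3]; ring
    rw [e5] at ho
    rw [e4]
    push_cast at ho ⊢
    rw [pow_succ]
    generalize Real.sin φ ^ d = sd
    generalize Real.sin φ = s at *
    generalize Real.cos φ = c at *
    have hs2 : s ^ 2 = 1 - c ^ 2 := by linarith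
    linear_combination (-(sd * eval c q)) * ho + (sd * (geg κ n c * eval c (derivative (derivative q))
      - d * (d + 2) * geg (κ + 2) (n - 2) c * eval c q)) * hs2
  rw [intervalIntegral.integral_eq_sub_of_hasDerivAt (fun φ _ => hF φ)]
  · simp
  · refine Continuous.intervalIntegrable ?_ _ _
    have := continuous_geg_cos κ n
    fun_prop

/-- Taking `q = X^j` in Green's identity links the moments `j` and `j - 2`, with the factor `n(n+d)
- j(j+d) ≠ 0` at the moment `j`. -/
theorem integral_geg_cos_pow (d n : ℕ) (j : ℕ) (hj : j < n) :
    ∫ φ in (0 : ℝ)..Real.pi, geg (d / 2) n (Real.cos φ) * Real.cos φ ^ j * Real.sin φ ^ d = 0 := by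
  induction j using Nat.strong_induction_on with
  | _ j ih =>
    have h := integral_geg_sturm d n (X ^ j)
    have hc := continuous_geg_cos (d / 2) n
    have hI : ∀ i, IntervalIntegrable (fun φ => geg (d / 2) n (Real.cos φ) * Real.cos φ ^ i *
        Real.sin φ ^ d) volume 0 Real.pi := fun i => Continuous.intervalIntegrable (by fun_prop) _ _
    have h2 : ∫ φ in (0 : ℝ)..Real.pi, ((j * (j - 1 : ℕ) : ℝ) * (geg (d / 2) n (Real.cos φ) *
        Real.cos φ ^ (j - 1 - 1) * Real.sin φ ^ d) + ((n : ℝ) * (n + d) - j * (j + d)) *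
        (geg (d / 2) n (Real.cos φ) * Real.cos φ ^ j * Real.sin φ ^ d)) = 0 := by
      refine Eq.trans (intervalIntegral.integral_congr fun φ _ => ?_) h
      simp only [derivative_X_pow, derivative_mul, eval_mul, eval_pow, eval_X,
        zero_mul, zero_add, eval_C, derivative_C]
      rcases j with _ | _ | j
      · simp; ring
      · simp; ring
      · simp only [Nat.add_sub_cancel]; push_cast; ring
    rw [intervalIntegral.integral_add ((hI (j - 1 - 1)).const_mul (j * (j - 1 : ℕ) : ℝ))
        ((hI j).const_mul ((n : ℝ) * (n + d) - j * (j + d))),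
      intervalIntegral.integral_const_mul, intervalIntegral.integral_const_mul] at h2
    have h3 : (j * (j - 1 : ℕ) : ℝ) * ∫ φ in (0 : ℝ)..Real.pi, geg (d / 2) n (Real.cos φ) *
        Real.cos φ ^ (j - 1 - 1) * Real.sin φ ^ d = 0 := by
      rcases j with _ | _ | j
      · simp
      · simp
      · simp only [Nat.add_sub_cancel]
        rw [ih j (by lia) (by lia), mul_zero]
    rw [h3, zero_add] at h2
    have hjn : (j : ℝ) < n := by exact_mod_cast hj
    refine (mul_eq_zero.1 h2).resolve_left (ne_of_gt ?_)
    have : (0 : ℝ) ≤ j := by positivity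
    have : (0 : ℝ) ≤ d := by positivity
    nlinarith

theorem integral_geg_mul_eval (d n : ℕ) (r : ℝ[X]) (hr : r.natDegree < n) :
    ∫ φ in (0 : ℝ)..Real.pi, geg (d / 2) n (Real.cos φ) * r.eval (Real.cos φ) * Real.sin φ ^ d = 0 := by
  have hc := continuous_geg_cos (d / 2) n
  have e : ∀ φ, geg (d / 2) n (Real.cos φ) * r.eval (Real.cos φ) * Real.sin φ ^ d
      = ∑ j ∈ Finset.range (r.natDegree + 1), r.coeff j *
        (geg (d / 2) n (Real.cos φ) * Real.cos φ ^ j * Real.sin φ ^ d) := by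
    intro φ
    rw [eval_eq_sum_range, Finset.mul_sum, Finset.sum_mul]
    exact Finset.sum_congr rfl fun j _ => by ring
  simp_rw [e]
  rw [intervalIntegral.integral_finsetSum
    fun j _ => Continuous.intervalIntegrable (by fun_prop) _ _]
  refine Finset.sum_eq_zero fun j hj => ?_
  rw [Finset.mem_range] at hj
  rw [intervalIntegral.integral_const_mul, integral_geg_cos_pow d n j (by lia), mul_zero]

/-- The zonal polynomial `C_n^ν + C_{n-1}^ν`. -/
noncomputable def zonal (ν : ℝ) (n : ℕ) (u : ℝ) : ℝ := geg ν n u + geg ν (n - 1) u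

theorem continuous_zonal (ν : ℝ) (n : ℕ) : Continuous (zonal ν n) :=
  (continuous_geg ν n).add (continuous_geg ν (n - 1))

/-- By `geg_raise`, consecutive zonal polynomials differ by a multiple of `C_{n+1}^{d/2}`, which is
orthogonal to constants. -/
theorem integral_zonal_one (d : ℕ) (hd : 1 ≤ d) (n : ℕ) :
    ∫ φ in (0 : ℝ)..Real.pi, zonal (d / 2 + 1) n (Real.cos φ) * Real.sin φ ^ d
      = ∫ φ in (0 : ℝ)..Real.pi, Real.sin φ ^ d := by
  have hd' : (0 : ℝ) < d / 2 := by positivity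
  induction n with
  | zero =>
    refine intervalIntegral.integral_congr fun φ _ => ?_
    simp [zonal, geg_of_neg]
  | succ n ih =>
    rw [← ih]
    have h := integral_geg_mul_eval d (n + 1) 1 (by simp)
    have hz := continuous_zonal (d / 2 + 1) n
    have hc := continuous_geg_cos (d / 2) (n + 1)
    have e : ∀ φ, zonal (d / 2 + 1) (n + 1) (Real.cos φ) * Real.sin φ ^ d =
        zonal (d / 2 + 1) n (Real.cos φ) * Real.sin φ ^ d + (n + 1 + d / 2) / (d / 2) *
        (geg (d / 2) (n + 1 : ℕ) (Real.cos φ) * (1 : ℝ[X]).eval (Real.cos φ) * Real.sin φ ^ d) := by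
      intro φ
      have hr := geg_raise (d / 2) (n + 1 : ℕ) (Real.cos φ)
      have e1 : (((n + 1 : ℕ) : ℤ) - 2) = n - 1 := by push_cast; ring
      have e2 : (((n + 1 : ℕ) : ℤ) - 1) = n := by push_cast; ring
      rw [e1] at hr
      have h3 : (n + 1 + d / 2) / (d / 2) * geg (d / 2) (n + 1 : ℕ) (Real.cos φ)
          = geg (d / 2 + 1) (n + 1 : ℕ) (Real.cos φ) - geg (d / 2 + 1) (n - 1) (Real.cos φ) := by
        rw [div_mul_eq_mul_div, div_eq_iff hd'.ne']
        push_cast at hr ⊢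
        linarith
      rw [eval_one, mul_one, ← mul_assoc, h3, zonal, zonal, e2]
      ring
    rw [intervalIntegral.integral_congr fun φ _ => e φ, intervalIntegral.integral_add,
      intervalIntegral.integral_const_mul, h, mul_zero, add_zero]
    · exact Continuous.intervalIntegrable (by fun_prop) _ _
    · simp only [eval_one]
      push_cast
      exact Continuous.intervalIntegrable (by fun_prop) _ _

/-- Write `q = q(1) + (X - 1) r`. By Christoffel–Darboux, `(u - 1) Z_n(u)` is a combination of
`C_n^{d/2}` and `C_{n+1}^{d/2}`, both orthogonal to `r`. -/
theorem integral_zonal_mul_eval (d : ℕ) (hd : 1 ≤ d) (n : ℕ) (q : ℝ[X]) (hq : q.natDegree ≤ n) :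
    ∫ φ in (0 : ℝ)..Real.pi, zonal (d / 2 + 1) n (Real.cos φ) * q.eval (Real.cos φ) * Real.sin φ ^ d
      = (∫ φ in (0 : ℝ)..Real.pi, Real.sin φ ^ d) * q.eval 1 := by
  have hd' : (0 : ℝ) < d := by positivity
  obtain ⟨r, hr⟩ : (X - C 1) ∣ q - C (q.eval 1) := X_sub_C_dvd_sub_C_eval
  have hz := (continuous_zonal (d / 2 + 1) n).comp Real.continuous_cos
  have hc := fun m => continuous_geg_cos (d / 2) m
  by_cases hr0 : r = 0
  · have hqc : q = C (q.eval 1) := by rw [hr0, mul_zero] at hr; exact sub_eq_zero.1 hr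
    have e : ∀ φ, zonal (d / 2 + 1) n (Real.cos φ) * q.eval (Real.cos φ) * Real.sin φ ^ d
        = zonal (d / 2 + 1) n (Real.cos φ) * Real.sin φ ^ d * q.eval 1 := by
      intro φ
      have : q.eval (Real.cos φ) = q.eval 1 := by rw [hqc]; simp
      rw [this]; ring
    simp_rw [e]
    rw [intervalIntegral.integral_mul_const, integral_zonal_one d hd]
  have hdeg : r.natDegree < n := by
    have h1 : (q - C (q.eval 1)).natDegree = 1 + r.natDegree := by
      rw [hr, natDegree_mul (X_sub_C_ne_zero 1) hr0, natDegree_X_sub_C]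
    rw [natDegree_sub_C] at h1
    lia
  have h1 := integral_geg_mul_eval d n r hdeg
  have h2 := integral_geg_mul_eval d (n + 1) r (by lia)
  have e : ∀ φ, zonal (d / 2 + 1) n (Real.cos φ) * q.eval (Real.cos φ) * Real.sin φ ^ d
      = zonal (d / 2 + 1) n (Real.cos φ) * Real.sin φ ^ d * q.eval 1
        + (-((n + d) / d) * (geg (d / 2) n (Real.cos φ) * r.eval (Real.cos φ) * Real.sin φ ^ d)
        + (n + 1) / d * (geg (d / 2) (n + 1 : ℕ) (Real.cos φ) * r.eval (Real.cos φ) * Real.sin φ ^ d)) := by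
    intro φ
    have hqe := congrArg (eval (Real.cos φ)) hr
    simp only [eval_sub, eval_mul, eval_X, eval_C] at hqe
    have g1 := geg_raise_right (d / 2) n (Real.cos φ)
    have g2 := geg_raise_left (d / 2) (n + 1 : ℕ) (Real.cos φ)
    have e1 : (((n + 1 : ℕ) : ℤ) - 2) = n - 1 := by push_cast; ring
    have e2 : (((n + 1 : ℕ) : ℤ) - 1) = n := by push_cast; ring
    rw [e1, e2] at g2
    push_cast at g1 g2 ⊢
    rw [show eval (Real.cos φ) q = eval 1 q + (Real.cos φ - 1) * eval (Real.cos φ) r by linarith, zonal]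
    have e3 : 2 * ((d : ℝ) / 2) = d := by ring
    rw [e3] at g1 g2
    generalize geg (d / 2 + 1) n (Real.cos φ) = A at *
    generalize geg (d / 2 + 1) (n - 1) (Real.cos φ) = B at *
    generalize geg (d / 2) n (Real.cos φ) = G at *
    generalize geg (d / 2) (n + 1) (Real.cos φ) = G' at *
    field_simp
    linear_combination (eval (Real.cos φ) r * Real.sin φ ^ d) * (g1 - g2)
  rw [intervalIntegral.integral_congr fun φ _ => e φ, intervalIntegral.integral_add,
    intervalIntegral.integral_add, intervalIntegral.integral_const_mul,
    intervalIntegral.integral_const_mul, h1, h2, intervalIntegral.integral_mul_const,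
    integral_zonal_one d hd, mul_zero, mul_zero, add_zero, add_zero]
  · have := hc n
    exact Continuous.intervalIntegrable (by fun_prop) _ _
  · have := hc (n + 1 : ℕ)
    exact Continuous.intervalIntegrable (by fun_prop) _ _
  · simp only [Function.comp_def] at hz
    exact Continuous.intervalIntegrable (by fun_prop) _ _
  · have h3 := hc n
    have h4 := hc (n + 1 : ℕ)
    exact Continuous.intervalIntegrable (by fun_prop) _ _

end Orthogonality

/-! ### The rotation-invariant weight on the ball of `ℝ × ℝ^d` and its two iterated integrals. -/

section ArcWeight

/-- Square roots of negative numbers and the inverse of `0` are `0`, so these weights vanish off the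
ball and can be integrated over the whole space. -/
theorem inv_sqrt_one_sub_sq_eq_zero {t : ℝ} (ht : t ∉ Set.Ioc (-1 : ℝ) 1) :
    (√(1 - t ^ 2))⁻¹ = 0 := by
  rw [inv_eq_zero, Real.sqrt_eq_zero']
  by_contra! h
  exact ht ⟨by nlinarith, by nlinarith⟩

theorem integrable_mul_inv_sqrt_one_sub_sq {f : ℝ → ℝ} (hf : Continuous f) :
    Integrable fun t => f t * (√(1 - t ^ 2))⁻¹ := by
  have h := Polynomial.Chebyshev.intervalIntegrable_sqrt_one_sub_sq_inv.continuousOn_mul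
    hf.continuousOn
  rw [intervalIntegrable_iff, Set.uIoc_of_le (by norm_num)] at h
  simp only [Real.sqrt_inv] at h
  refine (integrableOn_iff_integrable_of_support_subset fun t ht => ?_).1 h
  by_contra hn
  exact ht (by simp only [inv_sqrt_one_sub_sq_eq_zero hn, mul_zero])

theorem integral_mul_inv_sqrt_one_sub_sq (f : ℝ → ℝ) :
    ∫ t, f t * (√(1 - t ^ 2))⁻¹ = ∫ φ in (0 : ℝ)..Real.pi, f (Real.cos φ) := by
  rw [← Polynomial.Chebyshev.integral_measureT_eq_integral_cos,
    Polynomial.Chebyshev.integral_measureT, intervalIntegral.integral_of_le (by norm_num)]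
  simp only [Real.sqrt_inv]
  refine (setIntegral_eq_integral_of_forall_compl_eq_zero fun t ht => ?_).symm
  rw [inv_sqrt_one_sub_sq_eq_zero ht, mul_zero]

theorem inv_sqrt_sub_sq_mul {a : ℝ} (ha : 0 < a) (s : ℝ) :
    (√(a - (√a * s) ^ 2))⁻¹ = (√a)⁻¹ * (√(1 - s ^ 2))⁻¹ := by
  rw [mul_pow, Real.sq_sqrt ha.le, show a - a * s ^ 2 = a * (1 - s ^ 2) by ring,
    Real.sqrt_mul ha.le, mul_inv]

theorem integrable_mul_inv_sqrt_sub_sq {f : ℝ → ℝ} (hf : Continuous f) (a : ℝ) :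
    Integrable fun t => f t * (√(a - t ^ 2))⁻¹ := by
  rcases le_or_gt a 0 with ha | ha
  · refine (integrable_zero ℝ ℝ volume).congr (Filter.Eventually.of_forall fun t => ?_)
    simp only [Real.sqrt_eq_zero'.2 (by nlinarith [sq_nonneg t] : a - t ^ 2 ≤ 0), inv_zero, mul_zero,
      Pi.zero_apply]
  · have hs : √a ≠ 0 := (Real.sqrt_pos.2 ha).ne'
    rw [← integrable_comp_mul_left_iff _ hs]
    simp only [inv_sqrt_sub_sq_mul ha]
    refine ((integrable_mul_inv_sqrt_one_sub_sq
      (f := fun s => f (√a * s)) (by fun_prop)).const_mul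
        (√a)⁻¹).congr (Filter.Eventually.of_forall fun t => ?_)
    ring

theorem integral_mul_inv_sqrt_sub_sq (f : ℝ → ℝ) {a : ℝ} (ha : 0 < a) :
    ∫ t, f t * (√(a - t ^ 2))⁻¹ = ∫ φ in (0 : ℝ)..Real.pi, f (√a * Real.cos φ) := by
  have hs : 0 < √a := Real.sqrt_pos.2 ha
  rw [← integral_mul_inv_sqrt_one_sub_sq fun s => f (√a * s)]
  have h := Measure.integral_comp_mul_left (fun t => f t * (√(a - t ^ 2))⁻¹) √a
  simp only [inv_sqrt_sub_sq_mul ha, abs_of_pos (inv_pos.2 hs), smul_eq_mul] at h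
  rw [eq_inv_mul_iff_mul_eq₀ hs.ne', ← integral_const_mul] at h
  rw [← h]
  refine integral_congr_ae (Filter.Eventually.of_forall fun t => ?_)
  field_simp

theorem integral_mul_inv_sqrt_sub_sq_of_nonpos (f : ℝ → ℝ) {a : ℝ} (ha : a ≤ 0) :
    ∫ t, f t * (√(a - t ^ 2))⁻¹ = 0 := by
  refine integral_eq_zero_of_ae (Filter.Eventually.of_forall fun t => ?_)
  simp only [Real.sqrt_eq_zero'.2 (by nlinarith [sq_nonneg t] : a - t ^ 2 ≤ 0), inv_zero, mul_zero,
    Pi.zero_apply]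

variable {d : ℕ}

/-- The weight `(1 - t² - |y|²)^{-1/2}` on the unit ball of `ℝ × ℝ^d`, extended by zero. -/
noncomputable def ballWeight (z : ℝ × RSpace d) : ℝ := (√(1 - z.1 ^ 2 - ‖z.2‖ ^ 2))⁻¹

theorem ballWeight_nonneg (z : ℝ × RSpace d) : 0 ≤ ballWeight z := by
  unfold ballWeight; positivity

theorem measurable_ballWeight : Measurable (ballWeight (d := d)) := by
  unfold ballWeight; fun_prop

theorem ballWeight_eq_zero {z : ℝ × RSpace d} (hz : 1 ≤ z.1 ^ 2 + ‖z.2‖ ^ 2) :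
    ballWeight z = 0 := by
  rw [ballWeight, inv_eq_zero, Real.sqrt_eq_zero']; linarith

theorem ballWeight_comm (t : ℝ) (y : RSpace d) :
    ballWeight (t, y) = (√(1 - ‖y‖ ^ 2 - t ^ 2))⁻¹ := by
  rw [ballWeight]; congr 2; ring

theorem integrable_ballWeight : Integrable (ballWeight (d := d)) := by
  rw [Measure.volume_eq_prod, integrable_prod_iff' measurable_ballWeight.aestronglyMeasurable]
  simp only [ballWeight_comm, norm_inv, Real.norm_of_nonneg (Real.sqrt_nonneg _)]
  constructor
  · refine Filter.Eventually.of_forall fun y => ?_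
    simpa using integrable_mul_inv_sqrt_sub_sq (f := fun _ => 1) continuous_const (1 - ‖y‖ ^ 2)
  · have h : (fun y : RSpace d => ∫ t, (√(1 - ‖y‖ ^ 2 - t ^ 2))⁻¹)
        = (Metric.ball 0 1).indicator fun _ => Real.pi := by
      funext y
      by_cases hy : y ∈ Metric.ball (0 : RSpace d) 1
      · rw [Set.indicator_of_mem hy]
        rw [mem_ball_zero_iff] at hy
        have := integral_mul_inv_sqrt_sub_sq (fun _ => 1) (a := 1 - ‖y‖ ^ 2)
          (by nlinarith [norm_nonneg y])
        simpa using this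
      · rw [Set.indicator_of_notMem hy]
        rw [mem_ball_zero_iff] at hy
        have := integral_mul_inv_sqrt_sub_sq_of_nonpos (fun _ => 1) (a := 1 - ‖y‖ ^ 2)
          (by nlinarith [norm_nonneg y])
        simpa using this
    rw [h, integrable_indicator_iff measurableSet_ball]
    exact integrableOn_const measure_ball_lt_top.ne

theorem integrable_mul_ballWeight {F : ℝ × RSpace d → ℝ} (hF : Continuous F) :
    Integrable fun z => F z * ballWeight z := by
  obtain ⟨C, hC⟩ := ((isCompact_Icc (a := (-1 : ℝ)) (b := 1)).prod
    (isCompact_closedBall (0 : RSpace d) 1)).exists_bound_of_continuousOn hF.continuousOn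
  refine (integrable_ballWeight.const_mul C).mono'
    (hF.aestronglyMeasurable.mul measurable_ballWeight.aestronglyMeasurable)
    (Filter.Eventually.of_forall fun z => ?_)
  by_cases hz : 1 ≤ z.1 ^ 2 + ‖z.2‖ ^ 2
  · simp [ballWeight_eq_zero hz]
  · rw [norm_mul, Real.norm_of_nonneg (ballWeight_nonneg z)]
    refine mul_le_mul_of_nonneg_right (hC z ⟨?_, ?_⟩) (ballWeight_nonneg z)
    · rw [Set.mem_Icc, ← abs_le]
      exact abs_le_one_iff_mul_self_le_one.2 (by nlinarith [sq_nonneg ‖z.2‖])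
    · rw [mem_closedBall_zero_iff]
      nlinarith [sq_nonneg z.1, norm_nonneg z.2]

theorem integrable_mul_inv_sqrt_one_sub_norm_sq {f : RSpace d → ℝ} (hf : Continuous f) :
    Integrable fun w => f w * (√(1 - ‖w‖ ^ 2))⁻¹ := by
  have h := integrable_ballWeight (d := d)
  rw [Measure.volume_eq_prod] at h
  -- By Fubini almost every slice of `ballWeight` is integrable; one slice with `|v| < 1`, rescaled,
  -- gives the weight on `ℝ^d`.
  obtain ⟨v, hv, hi⟩ : ∃ v ∈ Set.Ioo (-1 : ℝ) 1, Integrable fun w : RSpace d => ballWeight (v, w) := by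
    by_contra! hn
    have := measure_mono_null (s := Set.Ioo (-1 : ℝ) 1) (fun v hv => hn v hv)
      (ae_iff.1 h.prod_right_ae)
    simp [Real.volume_Ioo] at this
    norm_num at this
  have ha : 0 < 1 - v ^ 2 := by nlinarith [hv.1, hv.2]
  have hs : 0 < √(1 - v ^ 2) := Real.sqrt_pos.2 ha
  rw [← integrable_comp_smul_iff volume _ hs.ne'] at hi
  have h1 : Integrable fun w : RSpace d => (√(1 - ‖w‖ ^ 2))⁻¹ := by
    refine (hi.const_mul √(1 - v ^ 2)).congr (Filter.Eventually.of_forall fun w => ?_)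
    simp only [ballWeight, norm_smul, Real.norm_of_nonneg hs.le]
    rw [inv_sqrt_sub_sq_mul ha]
    field_simp
  obtain ⟨C, hC⟩ := (isCompact_closedBall (0 : RSpace d) 1).exists_bound_of_continuousOn
    hf.continuousOn
  refine (h1.const_mul C).mono' (hf.aestronglyMeasurable.mul h1.aestronglyMeasurable)
    (Filter.Eventually.of_forall fun w => ?_)
  rw [norm_mul, Real.norm_of_nonneg (inv_nonneg.2 (Real.sqrt_nonneg (1 - ‖w‖ ^ 2)))]
  by_cases hw : ‖w‖ ≤ 1
  · exact mul_le_mul_of_nonneg_right (hC w (mem_closedBall_zero_iff.2 hw)) (by positivity)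
  · rw [Real.sqrt_eq_zero'.2 (by nlinarith : 1 - ‖w‖ ^ 2 ≤ 0)]
    simp

/-- Integrating the extra variable out. -/
theorem integral_mul_ballWeight_fst {F : ℝ × RSpace d → ℝ} (hF : Continuous F) :
    ∫ z, F z * ballWeight z = ∫ y in Metric.closedBall (0 : RSpace d) 1,
      ∫ φ in (0 : ℝ)..Real.pi, F (√(1 - ‖y‖ ^ 2) * Real.cos φ, y) := by
  have hi := integrable_mul_ballWeight hF
  rw [Measure.volume_eq_prod] at hi ⊢
  rw [integral_prod_symm _ hi, ← Metric.ball_union_sphere, setIntegral_congr_set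
    (union_ae_eq_left_of_ae_eq_empty
      (ae_eq_empty.2 (Measure.addHaar_sphere_of_ne_zero volume (0 : RSpace d) one_ne_zero))),
    ← integral_indicator measurableSet_ball]
  refine integral_congr_ae (Filter.Eventually.of_forall fun y => ?_)
  simp only [ballWeight_comm]
  by_cases hy : y ∈ Metric.ball (0 : RSpace d) 1
  · rw [Set.indicator_of_mem hy]
    rw [mem_ball_zero_iff] at hy
    exact integral_mul_inv_sqrt_sub_sq (fun t => F (t, y)) (by nlinarith [norm_nonneg y])
  · rw [Set.indicator_of_notMem hy]
    rw [mem_ball_zero_iff] at hy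
    exact integral_mul_inv_sqrt_sub_sq_of_nonpos (fun t => F (t, y)) (by nlinarith [norm_nonneg y])

/-- Integrating the `ℝ^d` variable by slices. -/
theorem integral_mul_ballWeight_snd {F : ℝ × RSpace d → ℝ} (hF : Continuous F) :
    ∫ z, F z * ballWeight z = ∫ φ in (0 : ℝ)..Real.pi,
      (∫ w : RSpace d, F (Real.cos φ, Real.sin φ • w) * (√(1 - ‖w‖ ^ 2))⁻¹) * Real.sin φ ^ d := by
  have hi := integrable_mul_ballWeight hF
  rw [Measure.volume_eq_prod] at hi ⊢
  rw [integral_prod _ hi]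
  have h := integral_mul_inv_sqrt_one_sub_sq fun v => (∫ w : RSpace d,
    F (v, √(1 - v ^ 2) • w) * (√(1 - ‖w‖ ^ 2))⁻¹) * √(1 - v ^ 2) ^ d
  have e : ∀ φ ∈ Set.uIcc 0 Real.pi, √(1 - Real.cos φ ^ 2) = Real.sin φ := by
    intro φ hφ
    rw [Set.uIcc_of_le Real.pi_pos.le] at hφ
    exact (Real.sin_eq_sqrt_one_sub_cos_sq hφ.1 hφ.2).symm
  rw [intervalIntegral.integral_congr (g := fun φ => (∫ w : RSpace d,
      F (Real.cos φ, Real.sin φ • w) * (√(1 - ‖w‖ ^ 2))⁻¹) * Real.sin φ ^ d)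
    (fun φ hφ => by simp only [e φ hφ])] at h
  rw [← h]
  refine integral_congr_ae (Filter.Eventually.of_forall fun v => ?_)
  simp only
  rcases le_or_gt (1 - v ^ 2) 0 with ha | ha
  · rw [Real.sqrt_eq_zero'.2 ha, inv_zero, mul_zero]
    refine integral_eq_zero_of_ae (Filter.Eventually.of_forall fun w => ?_)
    simp only [Pi.zero_apply]
    rw [ballWeight_eq_zero (by simp only; nlinarith [sq_nonneg ‖w‖]), mul_zero]
  · have hs : 0 < √(1 - v ^ 2) := Real.sqrt_pos.2 ha
    -- The slice at height `v` is scaled by `√(1 - v²)`: volume gives the power `d`, the weight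
    -- gives the power `-1` that becomes the arc measure.
    have h2 := Measure.integral_comp_smul volume
      (fun w : RSpace d => F (v, w) * ballWeight (v, w)) √(1 - v ^ 2)
    have h3 : ∀ w : RSpace d, ballWeight (v, √(1 - v ^ 2) • w)
        = (√(1 - v ^ 2))⁻¹ * (√(1 - ‖w‖ ^ 2))⁻¹ := by
      intro w
      rw [ballWeight, norm_smul, Real.norm_of_nonneg hs.le, inv_sqrt_sub_sq_mul ha]
    simp only [h3, finrank_euclideanSpace, Fintype.card_fin, smul_eq_mul] at h2
    rw [abs_of_pos (by positivity), eq_inv_mul_iff_mul_eq₀ (by positivity)] at h2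
    rw [← h2, mul_comm, mul_right_comm]
    congr 1
    rw [← integral_mul_const]
    exact integral_congr_ae (Filter.Eventually.of_forall fun w => by ring)

end ArcWeight

/-! ### Stability of the polynomial spaces under products and substitutions. -/

section PolySpace

open scoped RealInnerProductSpace

variable {d : ℕ}

theorem mem_polySpace {n : ℕ} {f : RSpace d → ℝ} :
    f ∈ polySpace n d ↔ ∃ P : MvPolynomial (Fin d) ℝ, P.totalDegree ≤ n ∧ polyFun d P = f := by
  simp only [polySpace, Submodule.mem_map, MvPolynomial.mem_restrictTotalDegree]

theorem continuous_of_mem_polySpace {n : ℕ} {f : RSpace d → ℝ} (hf : f ∈ polySpace n d) :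
    Continuous f := by
  obtain ⟨P, -, rfl⟩ := mem_polySpace.1 hf
  exact continuous_polyFun P

theorem polySpace_mono : Monotone fun n => polySpace n d := by
  intro m n h f hf
  obtain ⟨P, hP, rfl⟩ := mem_polySpace.1 hf
  exact mem_polySpace.2 ⟨P, hP.trans h, rfl⟩

theorem const_mem_polySpace (n : ℕ) (c : ℝ) : (fun _ => c) ∈ polySpace n d :=
  mem_polySpace.2 ⟨MvPolynomial.C c, by simp, by funext y; simp [polyFun]⟩

theorem coord_mem_polySpace (i : Fin d) : (fun y : RSpace d => y i) ∈ polySpace 1 d :=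
  mem_polySpace.2 ⟨MvPolynomial.X i, by simp, by funext y; simp [polyFun]⟩

theorem mul_mem_polySpace {m n : ℕ} {f g : RSpace d → ℝ} (hf : f ∈ polySpace m d)
    (hg : g ∈ polySpace n d) : (fun y => f y * g y) ∈ polySpace (m + n) d := by
  obtain ⟨P, hP, rfl⟩ := mem_polySpace.1 hf
  obtain ⟨Q, hQ, rfl⟩ := mem_polySpace.1 hg
  exact mem_polySpace.2 ⟨P * Q, (MvPolynomial.totalDegree_mul P Q).trans (add_le_add hP hQ),
    by funext y; simp [polyFun]⟩

theorem pow_mem_polySpace {m : ℕ} {f : RSpace d → ℝ} (hf : f ∈ polySpace m d) (k : ℕ) :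
    (fun y => f y ^ k) ∈ polySpace (k * m) d := by
  induction k with
  | zero => simpa using const_mem_polySpace 0 1
  | succ k ih =>
    simp only [pow_succ, add_mul, one_mul]
    exact mul_mem_polySpace ih hf

theorem sum_mem_polySpace {ι : Type*} (s : Finset ι) {n : ℕ} {f : ι → RSpace d → ℝ}
    (hf : ∀ i ∈ s, f i ∈ polySpace n d) : (fun y => ∑ i ∈ s, f i y) ∈ polySpace n d := by
  have := Submodule.sum_mem (polySpace n d) hf
  convert this using 1
  funext y; simp

theorem inner_mem_polySpace (x : RSpace d) : (fun y : RSpace d => ⟪x, y⟫) ∈ polySpace 1 d := by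
  have e : (fun y : RSpace d => ⟪x, y⟫) = fun y => ∑ i, x i * y i := by
    funext y
    rw [PiLp.inner_apply]
    exact Finset.sum_congr rfl fun i _ => by simp [mul_comm]
  rw [e]
  exact sum_mem_polySpace _ fun i _ => Submodule.smul_mem _ (x i) (coord_mem_polySpace i)

theorem one_sub_norm_sq_mem_polySpace : (fun y : RSpace d => 1 - ‖y‖ ^ 2) ∈ polySpace 2 d := by
  have e : (fun y : RSpace d => ‖y‖ ^ 2) = fun y => ∑ i, y i * y i := by
    funext y
    rw [EuclideanSpace.real_norm_sq_eq]
    exact Finset.sum_congr rfl fun i _ => by ring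
  have h2 : (fun y : RSpace d => ‖y‖ ^ 2) ∈ polySpace 2 d := by
    rw [e]
    refine sum_mem_polySpace _ fun i _ => ?_
    have h := mul_mem_polySpace (coord_mem_polySpace i) (coord_mem_polySpace i)
    rwa [one_add_one_eq_two] at h
  have h3 := Submodule.sub_mem _ (const_mem_polySpace 2 1) h2
  exact h3

theorem prod_pow_eq_prod_toMultiset {ι : Type*} (s : ι →₀ ℕ) (x : ι → ℝ) :
    ∏ i ∈ s.support, x i ^ s i = (s.toMultiset.map x).prod := by
  induction s using Finsupp.induction_linear with
  | zero => simp
  | add s t hs ht =>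
    rw [map_add, Multiset.map_add, Multiset.prod_add, ← hs, ← ht]
    exact Finsupp.prod_add_index' (h := fun i k => x i ^ k) (fun _ => pow_zero _) fun _ _ _ => pow_add _ _ _
  | single i k =>
    rw [Finsupp.toMultiset_single, Multiset.map_nsmul, Multiset.prod_nsmul, Multiset.map_singleton,
      Multiset.prod_singleton]
    exact Finsupp.prod_single_index (h := fun i k => x i ^ k) (pow_zero _)

/-- A polynomial of degree at most `n` in functions of degree one lies in degree `n`, for any
filtration `V` that multiplication by these functions shifts by one. -/
theorem comp_mem_of_mem_polySpace {A : Type*} {V : ℕ → Submodule ℝ (A → ℝ)} (hV : Monotone V)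
    (h1 : (fun _ => 1) ∈ V 0) (g : A → RSpace d)
    (hg : ∀ m i f, f ∈ V m → (fun a => g a i * f a) ∈ V (m + 1))
    {n : ℕ} {p : RSpace d → ℝ} (hp : p ∈ polySpace n d) : (fun a => p (g a)) ∈ V n := by
  obtain ⟨P, hP, rfl⟩ := mem_polySpace.1 hp
  have hM : ∀ M : Multiset (Fin d), (fun a => (M.map fun i => g a i).prod) ∈ V (Multiset.card M) := by
    intro M
    induction M using Multiset.induction_on with
    | empty => simpa using h1
    | cons i M ih => simpa using hg _ i _ ih
  have e : (fun a => polyFun d P (g a))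
      = ∑ s ∈ P.support, P.coeff s • fun a => (s.toMultiset.map fun i => g a i).prod := by
    funext a
    simp only [Finset.sum_apply, Pi.smul_apply, smul_eq_mul, ← prod_pow_eq_prod_toMultiset]
    exact MvPolynomial.eval_eq _ _
  rw [e]
  refine Submodule.sum_mem _ fun s hs => Submodule.smul_mem _ _ (hV ?_ (hM _))
  rw [Finsupp.card_toMultiset]
  exact (MvPolynomial.le_totalDegree hs).trans hP

/-- Polynomials are preserved by affine substitutions `y ↦ x + ρ y`. -/
theorem comp_affine_mem_polySpace {n : ℕ} {p : RSpace d → ℝ} (hp : p ∈ polySpace n d)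
    (x : RSpace d) (ρ : ℝ) : (fun y => p (x + ρ • y)) ∈ polySpace n d := by
  refine comp_mem_of_mem_polySpace polySpace_mono (const_mem_polySpace 0 1) _ (fun m i f hf => ?_) hp
  have h : (fun y : RSpace d => (x + ρ • y) i) ∈ polySpace 1 d := by
    have := Submodule.add_mem _ (const_mem_polySpace 1 (x i))
      (Submodule.smul_mem _ ρ (coord_mem_polySpace i))
    exact this
  rw [add_comm m]
  exact mul_mem_polySpace h hf

end PolySpace

/-! ### The reproducing formula on the ball. -/

section Reproducing

open Polynomial
open scoped RealInnerProductSpace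

variable {d : ℕ}

/-- Functions of `(v, h, w)` spanned by `vʲ hᵏ B(w)` with `j + k ≤ m` and `B` continuous of the
parity of `k`. -/
noncomputable def paritySpan (d m : ℕ) : Submodule ℝ (ℝ × ℝ × RSpace d → ℝ) :=
  Submodule.span ℝ {f | ∃ (j k : ℕ) (B : RSpace d → ℝ), j + k ≤ m ∧ Continuous B ∧
    (∀ w, B (-w) = (-1) ^ k * B w) ∧ f = fun a => a.1 ^ j * a.2.1 ^ k * B a.2.2}

theorem paritySpan_mono : Monotone (paritySpan d) := by
  intro m n h
  refine Submodule.span_mono ?_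
  rintro f ⟨j, k, B, hjk, hB⟩
  exact ⟨j, k, B, hjk.trans h, hB⟩

theorem one_mem_paritySpan : (fun _ => 1) ∈ paritySpan d 0 :=
  Submodule.subset_span ⟨0, 0, fun _ => 1, le_rfl, continuous_const, by simp, by simp⟩

theorem mul_mem_paritySpan {m : ℕ} {f : ℝ × ℝ × RSpace d → ℝ} (hf : f ∈ paritySpan d m) (c : ℝ)
    (l : RSpace d →L[ℝ] ℝ) :
    (fun a => (a.1 * c + a.2.1 * l a.2.2) * f a) ∈ paritySpan d (m + 1) := by
  induction hf using Submodule.span_induction with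
  | mem f hf =>
    obtain ⟨j, k, B, hjk, hB, hp, rfl⟩ := hf
    have h1 : (fun a : ℝ × ℝ × RSpace d => a.1 ^ (j + 1) * a.2.1 ^ k * B a.2.2)
        ∈ paritySpan d (m + 1) := Submodule.subset_span ⟨j + 1, k, B, by lia, hB, hp, rfl⟩
    have h2 : (fun a : ℝ × ℝ × RSpace d => a.1 ^ j * a.2.1 ^ (k + 1) * (l a.2.2 * B a.2.2))
        ∈ paritySpan d (m + 1) := Submodule.subset_span ⟨j, k + 1, fun w => l w * B w, by lia,
          l.continuous.mul hB, fun w => by simp only [map_neg, hp]; ring, rfl⟩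
    convert Submodule.add_mem _ (Submodule.smul_mem _ c h1) h2 using 1
    funext a
    simp only [Pi.add_apply, Pi.smul_apply, smul_eq_mul]; ring
  | zero =>
    convert Submodule.zero_mem (paritySpan d (m + 1)) using 1
    funext a
    simp
  | add f g _ _ hf hg =>
    convert Submodule.add_mem _ hf hg using 1
    funext a
    simp only [Pi.add_apply, mul_add]
  | smul r f _ hf =>
    convert Submodule.smul_mem _ r hf using 1
    funext a
    simp only [Pi.smul_apply, smul_eq_mul]; ring

theorem integral_eq_zero_of_odd {f : RSpace d → ℝ} (hf : ∀ w, f (-w) = -f w) : ∫ w, f w = 0 := by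
  have h := integral_neg_eq_self f volume
  simp only [hf, integral_neg] at h
  linarith

/-- For odd `k` the integral of `B` against the even weight vanishes; for even `k` the power `h^k`
is a power of `1 - v²`. So averaging over `w` leaves a polynomial in `v` alone. -/
theorem exists_polynomial_of_mem_paritySpan {m : ℕ} {f : ℝ × ℝ × RSpace d → ℝ}
    (hf : f ∈ paritySpan d m) : ∃ q : ℝ[X], q.natDegree ≤ m ∧ ∀ v h : ℝ, v ^ 2 + h ^ 2 = 1 →
      Integrable (fun w => f (v, h, w) * (√(1 - ‖w‖ ^ 2))⁻¹) ∧
      ∫ w, f (v, h, w) * (√(1 - ‖w‖ ^ 2))⁻¹ = q.eval v := by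
  induction hf using Submodule.span_induction with
  | mem f hf =>
    obtain ⟨j, k, B, hjk, hB, hp, rfl⟩ := hf
    have hi := integrable_mul_inv_sqrt_one_sub_norm_sq hB
    have hI : ∀ v h : ℝ, Integrable fun w => v ^ j * h ^ k * B w * (√(1 - ‖w‖ ^ 2))⁻¹ := fun v h => by
      simpa only [mul_assoc] using hi.const_mul (v ^ j * h ^ k)
    have hE : ∀ v h : ℝ, ∫ w, v ^ j * h ^ k * B w * (√(1 - ‖w‖ ^ 2))⁻¹
        = v ^ j * h ^ k * ∫ w, B w * (√(1 - ‖w‖ ^ 2))⁻¹ := fun v h => by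
      rw [← integral_const_mul]; simp only [mul_assoc]
    rcases Nat.even_or_odd' k with ⟨l, rfl | rfl⟩
    · refine ⟨C (∫ w, B w * (√(1 - ‖w‖ ^ 2))⁻¹) * (X ^ j * (1 - X ^ 2) ^ l), ?_, fun v h hvh =>
        ⟨hI v h, ?_⟩⟩
      · refine (natDegree_C_mul_le _ _).trans (natDegree_mul_le.trans (le_trans ?_ hjk))
        refine add_le_add (natDegree_X_pow_le j) (natDegree_pow_le.trans ?_)
        rw [mul_comm 2]
        exact Nat.mul_le_mul_left l ((natDegree_sub_le _ _).trans (by simp))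
      · rw [hE, pow_mul, show h ^ 2 = 1 - v ^ 2 by linarith]
        simp [mul_comm]
    · refine ⟨0, by simp, fun v h hvh => ⟨hI v h, ?_⟩⟩
      rw [hE, integral_eq_zero_of_odd, mul_zero, eval_zero]
      intro w
      rw [hp, norm_neg, pow_succ, pow_mul]
      simp
  | zero => exact ⟨0, by simp, fun v h _ => by simp⟩
  | add f g _ _ hf hg =>
    obtain ⟨q, hq, hf⟩ := hf
    obtain ⟨r, hr, hg⟩ := hg
    refine ⟨q + r, (natDegree_add_le _ _).trans (max_le hq hr), fun v h hvh => ?_⟩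
    simp only [Pi.add_apply, add_mul]
    refine ⟨(hf v h hvh).1.add (hg v h hvh).1, ?_⟩
    rw [integral_add (hf v h hvh).1 (hg v h hvh).1, (hf v h hvh).2, (hg v h hvh).2, eval_add]
  | smul c f _ hf =>
    obtain ⟨q, hq, hf⟩ := hf
    refine ⟨C c * q, (natDegree_C_mul_le _ _).trans hq, fun v h hvh => ?_⟩
    simp only [Pi.smul_apply, smul_eq_mul, mul_assoc]
    refine ⟨(hf v h hvh).1.const_mul c, ?_⟩
    rw [integral_const_mul, (hf v h hvh).2, eval_mul, eval_C]

theorem ballWeight_eq_norm (z : ℝ × RSpace d) :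
    ballWeight z = (√(1 - ‖WithLp.toLp 2 z‖ ^ 2))⁻¹ := by
  rw [WithLp.prod_norm_sq_eq_of_L2, ballWeight]
  simp only [Real.norm_eq_abs, sq_abs]
  rw [sub_sub]
  rfl

theorem integral_mul_ballWeight_comp
    (U : WithLp 2 (ℝ × RSpace d) ≃ₗᵢ[ℝ] WithLp 2 (ℝ × RSpace d)) {F : ℝ × RSpace d → ℝ}
    (hF : Continuous F) :
    ∫ z, F (U (WithLp.toLp 2 z)).ofLp * ballWeight z = ∫ z, F z * ballWeight z := by
  have hT : MeasurePreserving (fun z : ℝ × RSpace d => (U (WithLp.toLp 2 z)).ofLp) :=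
    (WithLp.volume_preserving_ofLp ℝ (RSpace d)).comp
      (U.measurePreserving.comp (WithLp.volume_preserving_toLp ℝ (RSpace d)))
  have hm : AEStronglyMeasurable (fun z : ℝ × RSpace d => F z * ballWeight z) volume :=
    hF.aestronglyMeasurable.mul measurable_ballWeight.aestronglyMeasurable
  nth_rw 2 [← hT.map_eq]
  rw [integral_map hT.measurable.aemeasurable (by rwa [hT.map_eq])]
  simp only [ballWeight_eq_norm, WithLp.toLp_ofLp, LinearIsometryEquiv.norm_map]

/-- Rotating the direction `(√(1-|x|²), x)` to the first axis. -/
theorem exists_rotation {x : RSpace d} (hx : ‖x‖ ≤ 1) : ∃ l : RSpace d →L[ℝ] RSpace d,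
    ∀ (Z : ℝ → ℝ) (p : RSpace d → ℝ), Continuous Z → Continuous p →
      ∫ z : ℝ × RSpace d, Z (√(1 - ‖x‖ ^ 2) * z.1 + ⟪x, z.2⟫) * p z.2 * ballWeight z =
        ∫ z : ℝ × RSpace d, Z z.1 * p (z.1 • x + l z.2) * ballWeight z := by
  set e₀ : WithLp 2 (ℝ × RSpace d) := WithLp.toLp 2 (1, 0) with he₀
  set ξ : WithLp 2 (ℝ × RSpace d) := WithLp.toLp 2 (√(1 - ‖x‖ ^ 2), x) with hξ
  have hn : ‖e₀‖ = ‖ξ‖ := by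
    rw [← sq_eq_sq₀ (norm_nonneg _) (norm_nonneg _), WithLp.prod_norm_sq_eq_of_L2,
      WithLp.prod_norm_sq_eq_of_L2]
    have hs : √(1 - ‖x‖ ^ 2) ^ 2 = 1 - ‖x‖ ^ 2 := Real.sq_sqrt (by nlinarith [norm_nonneg x])
    simp [he₀, hξ, hs]
  -- A single reflection exchanges the two unit vectors `e₀` and `ξ`; it preserves both the measure
  -- and the weight.
  set U := Submodule.reflection (ℝ ∙ (e₀ - ξ))ᗮ
  have hU : U e₀ = ξ := Submodule.reflection_sub hn
  let T : ℝ × RSpace d →L[ℝ] RSpace d := (ContinuousLinearMap.snd ℝ ℝ (RSpace d)).comp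
    (((WithLp.prodContinuousLinearEquiv 2 ℝ ℝ (RSpace d)).toContinuousLinearMap.comp
      U.toContinuousLinearEquiv.toContinuousLinearMap).comp
      (WithLp.prodContinuousLinearEquiv 2 ℝ ℝ (RSpace d)).symm.toContinuousLinearMap)
  have hT : ∀ z, T z = (U (WithLp.toLp 2 z)).ofLp.2 := fun z => rfl
  refine ⟨T.comp (ContinuousLinearMap.inr ℝ ℝ (RSpace d)), fun Z p hZ hp => ?_⟩
  rw [← integral_mul_ballWeight_comp U (F := fun z => Z (√(1 - ‖x‖ ^ 2) * z.1 + ⟪x, z.2⟫) * p z.2)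
    (by fun_prop)]
  refine integral_congr_ae (Filter.Eventually.of_forall fun z => ?_)
  have h1 : √(1 - ‖x‖ ^ 2) * (U (WithLp.toLp 2 z)).ofLp.1 + ⟪x, (U (WithLp.toLp 2 z)).ofLp.2⟫
      = z.1 := by
    have h : ⟪ξ, U (WithLp.toLp 2 z)⟫ = ⟪e₀, WithLp.toLp 2 z⟫ := by
      rw [← hU, LinearIsometryEquiv.inner_map_map]
    rw [WithLp.prod_inner_apply, WithLp.prod_inner_apply] at h
    simpa [hξ, he₀, mul_comm] using h
  have h2 : (U (WithLp.toLp 2 z)).ofLp.2 = z.1 • x + T (0, z.2) := by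
    have hz : z = z.1 • ((1 : ℝ), (0 : RSpace d)) + (0, z.2) := by ext <;> simp
    have h3 : T (1, 0) = x := by rw [hT, ← he₀, hU]
    rw [← hT]
    conv_lhs => rw [hz, map_add, map_smul, h3]
  simp only [h1]
  rw [h2]
  rfl

/-- The normalizing constant of the zonal reproducing formula. -/
noncomputable def zonalConst (d : ℕ) : ℝ :=
  (∫ φ in (0 : ℝ)..Real.pi, Real.sin φ ^ d) * ∫ w : RSpace d, (√(1 - ‖w‖ ^ 2))⁻¹

/-- The left side comes from integrating out the extra variable. After rotation, slicing at `cos φ`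
gives a one-variable integral against the zonal polynomial, which evaluates the averaged polynomial
at `1`. -/
theorem integral_zonal_reproducing (hd : 1 ≤ d) {x : RSpace d} (hx : ‖x‖ ≤ 1) {n : ℕ}
    {p : RSpace d → ℝ} (hp : p ∈ polySpace n d) :
    ∫ y in unitBall d, (∫ φ in (0 : ℝ)..Real.pi, zonal (d / 2 + 1) n
      (⟪x, y⟫ + √(1 - ‖x‖ ^ 2) * (√(1 - ‖y‖ ^ 2) * Real.cos φ))) * p y = zonalConst d * p x := by
  have hZ := continuous_zonal (d / 2 + 1) n
  have hpc := continuous_of_mem_polySpace hp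
  obtain ⟨l, hl⟩ := exists_rotation hx
  have h := hl _ p hZ hpc
  rw [integral_mul_ballWeight_fst (by fun_prop), integral_mul_ballWeight_snd (by fun_prop)] at h
  have hV : (fun a : ℝ × ℝ × RSpace d => p (a.1 • x + a.2.1 • l a.2.2)) ∈ paritySpan d n := by
    refine comp_mem_of_mem_polySpace paritySpan_mono one_mem_paritySpan _ (fun m i f hf => ?_) hp
    exact mul_mem_paritySpan hf (x i) ((EuclideanSpace.proj i).comp l)
  obtain ⟨q, hqd, hq⟩ := exists_polynomial_of_mem_paritySpan hV
  -- At `v = 1`, `h = 0` the slice degenerates to the point `x`, so `q.eval 1` is `p x` times the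
  -- total weight.
  have hq1 := (hq 1 0 (by norm_num)).2
  simp only [one_smul, zero_smul, add_zero] at hq1
  rw [integral_const_mul] at hq1
  have hr : ∀ φ, (∫ w : RSpace d, zonal (d / 2 + 1) n (Real.cos φ) *
      p (Real.cos φ • x + l (Real.sin φ • w)) * (√(1 - ‖w‖ ^ 2))⁻¹) * Real.sin φ ^ d
      = zonal (d / 2 + 1) n (Real.cos φ) * q.eval (Real.cos φ) * Real.sin φ ^ d := by
    intro φ
    rw [← (hq (Real.cos φ) (Real.sin φ) (Real.cos_sq_add_sin_sq φ)).2, ← integral_const_mul]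
    simp only [map_smul, mul_assoc]
  simp only [hr] at h
  rw [integral_zonal_mul_eval d hd n q hqd, ← hq1] at h
  rw [zonalConst]
  refine Eq.trans (integral_congr_ae (Filter.Eventually.of_forall fun y => ?_)) (h.trans (by ring))
  simp only [intervalIntegral.integral_mul_const]
  simp only [add_comm ⟪x, y⟫]

end Reproducing

/-! ### The Christoffel function as a one-dimensional integral. -/

section Kernel

open Polynomial
open scoped RealInnerProductSpace

variable {d : ℕ}

theorem natDegree_gegenbauer_le (κ : ℝ) (n : ℕ) : (gegenbauer κ n).natDegree ≤ n := by
  induction n using Nat.strong_induction_on with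
  | _ n ih =>
    match n with
    | 0 => simp [gegenbauer]
    | 1 =>
      rw [gegenbauer]
      exact (natDegree_C_mul_le _ _).trans natDegree_X_le
    | n + 2 =>
      rw [gegenbauer]
      refine (natDegree_C_mul_le _ _).trans ((natDegree_sub_le _ _).trans (max_le ?_ ?_))
      · refine natDegree_mul_le.trans ?_
        have h1 := ih (n + 1) (by lia)
        have h2 : (C (2 * ((n : ℝ) + 1 + κ)) * X).natDegree ≤ 1 :=
          (natDegree_C_mul_le _ _).trans natDegree_X_le
        lia
      · exact ((natDegree_C_mul_le _ _).trans (ih n (by lia))).trans (by lia)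

theorem exists_polynomial_zonal (ν : ℝ) (n : ℕ) :
    ∃ Q : ℝ[X], Q.natDegree ≤ n ∧ ∀ u, zonal ν n u = Q.eval u := by
  rcases n with _ | n
  · exact ⟨1, by simp, fun u => by simp [zonal, geg_of_neg]⟩
  · refine ⟨gegenbauer ν (n + 1) + gegenbauer ν n, (natDegree_add_le _ _).trans
      (max_le (natDegree_gegenbauer_le _ _) ((natDegree_gegenbauer_le _ _).trans (by lia))),
      fun u => ?_⟩
    rw [eval_add, ← geg_natCast, ← geg_natCast, zonal]
    congr 2
    push_cast; ring

theorem integral_cos_pow_odd (l : ℕ) : ∫ φ in (0 : ℝ)..Real.pi, Real.cos φ ^ (2 * l + 1) = 0 := by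
  have h := intervalIntegral.integral_comp_sub_left (fun φ => Real.cos φ ^ (2 * l + 1)) Real.pi
    (a := 0) (b := Real.pi)
  simp only [Real.cos_pi_sub, sub_self, sub_zero, Odd.neg_pow (⟨l, rfl⟩ : Odd (2 * l + 1)),
    intervalIntegral.integral_neg] at h
  linarith

/-- Odd powers of `cos φ` integrate to zero, so only even powers of `√(1 - ‖y‖²)` survive and the
kernel is a polynomial in `y`. -/
theorem exists_mem_polySpace_integral_pow (x : RSpace d) (j : ℕ) : ∃ K ∈ polySpace j d,
    ∀ y, ‖y‖ ≤ 1 → K y = ∫ φ in (0 : ℝ)..Real.pi,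
      (⟪x, y⟫ + √(1 - ‖x‖ ^ 2) * (√(1 - ‖y‖ ^ 2) * Real.cos φ)) ^ j := by
  have hk : ∀ k ∈ Finset.range (j + 1), ∃ K ∈ polySpace j d, ∀ y, ‖y‖ ≤ 1 →
      K y = ∫ φ in (0 : ℝ)..Real.pi, ⟪x, y⟫ ^ k *
        (√(1 - ‖x‖ ^ 2) * (√(1 - ‖y‖ ^ 2) * Real.cos φ)) ^ (j - k) * (j.choose k) := by
    intro k hk
    rw [Finset.mem_range] at hk
    have e : ∀ y, ∫ φ in (0 : ℝ)..Real.pi, ⟪x, y⟫ ^ k *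
        (√(1 - ‖x‖ ^ 2) * (√(1 - ‖y‖ ^ 2) * Real.cos φ)) ^ (j - k) * (j.choose k)
        = (√(1 - ‖x‖ ^ 2) ^ (j - k) * (j.choose k) * ∫ φ in (0 : ℝ)..Real.pi, Real.cos φ ^ (j - k))
          * (⟪x, y⟫ ^ k * √(1 - ‖y‖ ^ 2) ^ (j - k)) := by
      intro y
      rw [mul_right_comm, mul_assoc (_ * _), ← mul_assoc (_ * _),
        ← intervalIntegral.integral_const_mul]
      congr 1
      funext φ
      ring
    rcases Nat.even_or_odd' (j - k) with ⟨l, hl | hl⟩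
    · refine ⟨fun y => (√(1 - ‖x‖ ^ 2) ^ (j - k) * (j.choose k) *
        ∫ φ in (0 : ℝ)..Real.pi, Real.cos φ ^ (j - k)) * (⟪x, y⟫ ^ k * (1 - ‖y‖ ^ 2) ^ l),
        Submodule.smul_mem _ _ ?_, fun y hy => ?_⟩
      · have h := mul_mem_polySpace (pow_mem_polySpace (inner_mem_polySpace x) k)
          (pow_mem_polySpace (one_sub_norm_sq_mem_polySpace (d := d)) l)
        rwa [show k * 1 + l * 2 = j by lia] at h
      · rw [e, hl, pow_mul √(1 - ‖y‖ ^ 2), Real.sq_sqrt (by nlinarith [norm_nonneg y])]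
    · refine ⟨fun _ => 0, const_mem_polySpace j 0, fun y hy => ?_⟩
      rw [e, hl, integral_cos_pow_odd]
      simp
  choose! K hK hKy using hk
  refine ⟨fun y => ∑ k ∈ Finset.range (j + 1), K k y, sum_mem_polySpace _ hK, fun y hy => ?_⟩
  simp only [add_pow]
  rw [intervalIntegral.integral_finsetSum fun k _ => Continuous.intervalIntegrable (by fun_prop) _ _]
  exact Finset.sum_congr rfl fun k hk => hKy k hk y hy

theorem exists_mem_polySpace_integral_eval (x : RSpace d) {n : ℕ} (Q : ℝ[X]) (hQ : Q.natDegree ≤ n) :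
    ∃ K ∈ polySpace n d, ∀ y, ‖y‖ ≤ 1 → K y = ∫ φ in (0 : ℝ)..Real.pi,
      Q.eval (⟪x, y⟫ + √(1 - ‖x‖ ^ 2) * (√(1 - ‖y‖ ^ 2) * Real.cos φ)) := by
  choose K hK hKy using exists_mem_polySpace_integral_pow x
  refine ⟨fun y => ∑ j ∈ Finset.range (Q.natDegree + 1), Q.coeff j * K j y,
    sum_mem_polySpace _ fun j hj => Submodule.smul_mem _ _ (polySpace_mono ?_ (hK j)), fun y hy => ?_⟩
  · rw [Finset.mem_range] at hj; lia
  simp only [eval_eq_sum_range]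
  rw [intervalIntegral.integral_finsetSum fun k _ => Continuous.intervalIntegrable (by fun_prop) _ _]
  refine Finset.sum_congr rfl fun j _ => ?_
  rw [hKy j y hy, intervalIntegral.integral_const_mul]

theorem zonalConst_pos (d : ℕ) : 0 < zonalConst d := by
  refine mul_pos (integral_sin_pow_pos d) ?_
  have hi := integrable_mul_inv_sqrt_one_sub_norm_sq (f := fun _ : RSpace d => (1 : ℝ)) continuous_const
  simp only [one_mul] at hi
  rw [integral_pos_iff_support_of_nonneg (fun w => by simp only [Pi.zero_apply]; positivity) hi]
  refine (Metric.measure_ball_pos volume (0 : RSpace d) one_pos).trans_le (measure_mono fun w hw => ?_)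
  rw [mem_ball_zero_iff] at hw
  rw [Function.mem_support]
  exact (inv_pos.2 (Real.sqrt_pos.2 (by nlinarith [norm_nonneg w]))).ne'

/-- The Christoffel function of the ball as an integral of a zonal polynomial. -/
theorem zonalConst_mul_christoffelC (hd : 1 ≤ d) (n : ℕ) {x : RSpace d} (hx : ‖x‖ ≤ 1) :
    zonalConst d * christoffelC (polySpace n d) (unitBall d) volume x
      = ∫ φ in (0 : ℝ)..Real.pi, zonal (d / 2 + 1) n (‖x‖ ^ 2 + (1 - ‖x‖ ^ 2) * Real.cos φ) := by
  obtain ⟨Q, hQ, hZ⟩ := exists_polynomial_zonal (d / 2 + 1) n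
  obtain ⟨K, hK, hKy⟩ := exists_mem_polySpace_integral_eval x Q hQ
  obtain ⟨N, ψ, hψ⟩ := exists_isOrthonormalBasisOn_polySpace n d
  have hψm : ∀ k, ψ k ∈ polySpace n d := fun k => by
    rw [← hψ.span_eq]; exact Submodule.subset_span ⟨k, rfl⟩
  obtain ⟨a, ha⟩ := (Submodule.mem_span_range_iff_exists_fun ℝ).1 (hψ.span_eq.symm ▸ hK)
  have hKa : ∀ y, K y = ∑ j, a j * ψ j y := fun y => by simpa using (congrFun ha y).symm
  -- The reproducing formula identifies the coefficients of the kernel in the orthonormal basis;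
  -- evaluation at `y = x` then gives the sum of squares.
  have hak : ∀ k, a k = zonalConst d * ψ k x := by
    intro k
    have h := integral_zonal_reproducing hd hx (hψm k)
    simp only [hZ] at h
    rw [← h, setIntegral_congr_fun (g := fun y => ∑ j, a j * (ψ j y * ψ k y))
      measurableSet_closedBall, integral_finsetSum]
    · simp only [integral_const_mul, hψ.orthonormal]
      simp
    · exact fun j _ => ((hψ.memLp j).integrable_mul (hψ.memLp k)).const_mul (a j)
    · intro y hy
      simp only
      rw [← hKy y (mem_closedBall_zero_iff.1 hy), hKa, Finset.sum_mul]
      exact Finset.sum_congr rfl fun j _ => by ring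
  have hs := hKy x hx
  rw [hKa] at hs
  rw [christoffelC_eq hψ, Finset.mul_sum]
  calc ∑ k, zonalConst d * ψ k x ^ 2 = ∑ k, a k * ψ k x :=
        Finset.sum_congr rfl fun k _ => by rw [hak]; ring
    _ = _ := hs
    _ = _ := by
      have h1 : √(1 - ‖x‖ ^ 2) * √(1 - ‖x‖ ^ 2) = 1 - ‖x‖ ^ 2 :=
        Real.mul_self_sqrt (by nlinarith [norm_nonneg x])
      simp only [hZ, real_inner_self_eq_norm_sq, ← mul_assoc, h1]

end Kernel

/-! ### Radial profile and its monotonicity. -/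

section Monotone

variable {d : ℕ}

/-- The radial profile of the Christoffel function of the ball. -/
noncomputable def christoffelProfile (d n : ℕ) (r : ℝ) : ℝ :=
  (zonalConst d)⁻¹ * ∫ φ in (0 : ℝ)..Real.pi, zonal (d / 2 + 1) n (r ^ 2 + (1 - r ^ 2) * Real.cos φ)

theorem christoffelC_eq_profile (hd : 1 ≤ d) (n : ℕ) {x : RSpace d} (hx : ‖x‖ ≤ 1) :
    christoffelC (polySpace n d) (unitBall d) volume x = christoffelProfile d n ‖x‖ := by
  rw [christoffelProfile, ← zonalConst_mul_christoffelC hd n hx,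
    inv_mul_cancel_left₀ (zonalConst_pos d).ne']

theorem strictMonoOn_christoffelProfile (hd : 2 ≤ d) {n : ℕ} (hn : 1 ≤ n) :
    StrictMonoOn (christoffelProfile d n) {r : ℝ | 0 ≤ r ∧ 1 / 2 ≤ r ^ 2 ∧ r ^ 2 ≤ 1} := by
  obtain ⟨m, rfl⟩ : ∃ m, n = m + 1 := ⟨n - 1, by lia⟩
  have hν : ((d : ℝ) / 2 + 1 = 2 ∨ (5 / 2 : ℝ) ≤ d / 2 + 1) := by
    rcases hd.eq_or_lt with rfl | hd
    · left; norm_num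
    · right
      have : (3 : ℝ) ≤ d := by exact_mod_cast hd
      linarith
  have h := strictAntiOn_integral_geg hν m
  intro r hr s hs hrs
  have hsq : r ^ 2 < s ^ 2 := pow_lt_pow_left₀ hrs hr.1 two_ne_zero
  -- The substitution `t = 2(1 - r²)` reverses order, so a decreasing mean gives an increasing
  -- profile.
  have key := h (a := 2 * (1 - s ^ 2)) ⟨by linarith [hs.2.2], by linarith [hs.2.1]⟩
    (b := 2 * (1 - r ^ 2)) ⟨by linarith [hr.2.2], by linarith [hr.2.1]⟩ (by linarith)
  have e : ∀ t : ℝ, ∫ φ in (0 : ℝ)..Real.pi, zonal (d / 2 + 1) (m + 1) (t ^ 2 + (1 - t ^ 2) * Real.cos φ)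
      = ∫ φ in (0 : ℝ)..Real.pi,
        (geg (d / 2 + 1) (m + 1 : ℕ) (1 - 2 * (1 - t ^ 2) * ((1 - Real.cos φ) / 2)) +
          geg (d / 2 + 1) m (1 - 2 * (1 - t ^ 2) * ((1 - Real.cos φ) / 2))) := by
    intro t
    congr 1
    funext φ
    have h1 : t ^ 2 + (1 - t ^ 2) * Real.cos φ = 1 - 2 * (1 - t ^ 2) * ((1 - Real.cos φ) / 2) := by ring
    have h2 : ((m + 1 : ℕ) : ℤ) - 1 = m := by push_cast; ring
    rw [zonal, h1, h2]
  rw [christoffelProfile, christoffelProfile, e, e]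
  exact mul_lt_mul_of_pos_left key (inv_pos.2 (zonalConst_pos d))

end Monotone

/-! ### Size of the zonal polynomials and of their integrals. -/

section ZonalBounds

open Polynomial

theorem abs_geg_one_le (j : ℕ) {u : ℝ} (hu : |u| ≤ 1) : |geg 1 j u| ≤ j + 1 := by
  rw [geg_one_left_eq_U j (by lia), ← Real.cos_arccos (abs_le.1 hu).1 (abs_le.1 hu).2]
  generalize Real.arccos u = θ
  induction j with
  | zero => simp
  | succ j ih =>
    have h := congrArg (eval (Real.cos θ)) (Chebyshev.T_eq_U_sub_X_mul_U ℝ (j + 1 : ℕ))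
    rw [Chebyshev.T_real_cos, eval_sub, eval_mul, eval_X,
      show ((j + 1 : ℕ) : ℤ) - 1 = j by push_cast; ring] at h
    rw [show eval (Real.cos θ) (Chebyshev.U ℝ (j + 1 : ℕ))
      = Real.cos ((j + 1 : ℕ) * θ) + Real.cos θ * eval (Real.cos θ) (Chebyshev.U ℝ j) by
        push_cast at h ⊢; linarith]
    refine (abs_add_le _ _).trans ?_
    rw [abs_mul]
    have h1 := Real.abs_cos_le_one ((j + 1 : ℕ) * θ)
    have h2 := mul_le_mul (Real.abs_cos_le_one θ) ih (abs_nonneg _) zero_le_one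
    push_cast at h1 ⊢
    linarith

theorem geg_one_one (j : ℕ) : geg 1 j 1 = j + 1 := by
  rw [geg_one_left_eq_U j (by lia), Chebyshev.U_eval_one]
  simp

/-- The coefficients in terms of `C_j^1 = U_j` are nonnegative, and `|U_j| ≤ j + 1 = U_j(1)`. -/
theorem abs_geg_le {ν : ℝ} (hν : 1 ≤ ν) (n : ℕ) {u : ℝ} (hu : |u| ≤ 1) :
    |geg ν n u| ≤ geg ν n 1 := by
  rw [geg_connection one_pos ν u, geg_connection one_pos ν 1]
  refine (Finset.abs_sum_le_sum_abs _ _).trans (Finset.sum_le_sum fun k hk => ?_)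
  have hk' : 2 * k ≤ n := by rw [Finset.mem_range] at hk; lia
  have hk2 : (2 * k : ℝ) ≤ n := by exact_mod_cast hk'
  have h0 : 0 ≤ (1 + n - 2 * k) * gegCoeff 1 ν n k :=
    mul_nonneg (by linarith) (gegCoeff_nonneg one_pos hν n k)
  rw [abs_mul, abs_of_nonneg h0, geg_one_one]
  exact mul_le_mul_of_nonneg_left (abs_geg_one_le _ hu) h0

theorem integral_cos_natCast_mul {n : ℕ} (hn : n ≠ 0) :
    ∫ φ in (0 : ℝ)..Real.pi, Real.cos (n * φ) = 0 := by
  rw [intervalIntegral.integral_comp_mul_left (fun φ => Real.cos φ) (by exact_mod_cast hn)]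
  simp [Real.sin_nat_mul_pi]

theorem integral_geg_one_cos (j : ℕ) :
    ∫ φ in (0 : ℝ)..Real.pi, geg 1 j (Real.cos φ) = if Even j then Real.pi else 0 := by
  induction j using Nat.twoStepInduction with
  | zero => simp
  | one =>
    have e : ∀ φ, geg 1 (1 : ℕ) (Real.cos φ) = 2 * Real.cos φ := fun φ => by
      rw [geg_one_left_eq_U _ (by lia)]; simp
    simp only [e, intervalIntegral.integral_const_mul]
    simp
  | more j ih _ =>
    have e : ∀ φ, geg 1 (j + 2 : ℕ) (Real.cos φ)
        = geg 1 j (Real.cos φ) + 2 * Real.cos ((j + 2 : ℕ) * φ) := by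
      intro φ
      have h1 := congrArg (eval (Real.cos φ)) (Chebyshev.T_eq_U_sub_X_mul_U ℝ (j + 2 : ℕ))
      have h2 := congrArg (eval (Real.cos φ)) (Chebyshev.U_add_two ℝ j)
      rw [Chebyshev.T_real_cos, eval_sub, eval_mul, eval_X,
        show ((j + 2 : ℕ) : ℤ) - 1 = j + 1 by push_cast; ring] at h1
      simp only [eval_sub, eval_mul, eval_X, eval_ofNat] at h2
      rw [geg_one_left_eq_U _ (by lia), geg_one_left_eq_U _ (by lia)]
      push_cast at h1 h2 ⊢
      linarith
    simp only [e]
    have hc := continuous_geg_cos 1 j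
    rw [intervalIntegral.integral_add (Continuous.intervalIntegrable (by fun_prop) _ _)
      (Continuous.intervalIntegrable (by fun_prop) _ _), ih, intervalIntegral.integral_const_mul,
      integral_cos_natCast_mul (by lia)]
    simp [Nat.even_add]

theorem integral_geg_cos_eq (ν : ℝ) (n : ℕ) :
    ∫ φ in (0 : ℝ)..Real.pi, geg ν n (Real.cos φ) = ∑ k ∈ Finset.range (n / 2 + 1),
      (1 + n - 2 * k) * gegCoeff 1 ν n k * if Even n then Real.pi else 0 := by
  have hc := fun k => continuous_geg_cos 1 k
  rw [intervalIntegral.integral_congr fun φ _ => geg_connection one_pos ν (Real.cos φ) n,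
    intervalIntegral.integral_finsetSum fun k _ => Continuous.intervalIntegrable (by fun_prop) _ _]
  refine Finset.sum_congr rfl fun k hk => ?_
  have hk' : 2 * k ≤ n := by rw [Finset.mem_range] at hk; lia
  rw [intervalIntegral.integral_const_mul, integral_geg_one_cos]
  simp [Nat.even_sub hk']

theorem integral_geg_cos_nonneg {ν : ℝ} (hν : 1 ≤ ν) (n : ℕ) :
    0 ≤ ∫ φ in (0 : ℝ)..Real.pi, geg ν n (Real.cos φ) := by
  rw [integral_geg_cos_eq]
  refine Finset.sum_nonneg fun k hk => ?_
  have hk' : 2 * k ≤ n := by rw [Finset.mem_range] at hk; lia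
  have hk2 : (2 * k : ℝ) ≤ n := by exact_mod_cast hk'
  refine mul_nonneg (mul_nonneg (by linarith) (gegCoeff_nonneg one_pos hν n k)) ?_
  split_ifs
  · exact Real.pi_pos.le
  · exact le_rfl

/-- Termwise in the same expansion: for even `j ≤ n` the integral of `U_j(cos φ)` is `π`, while
`U_j(1) = j + 1 ≤ n + 1`. This loses exactly one power of `n`. -/
theorem le_integral_geg_cos {ν : ℝ} (hν : 1 ≤ ν) {n : ℕ} (hn : Even n) :
    Real.pi * geg ν n 1 ≤ (n + 1) * ∫ φ in (0 : ℝ)..Real.pi, geg ν n (Real.cos φ) := by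
  rw [integral_geg_cos_eq, if_pos hn, geg_connection one_pos ν 1, Finset.mul_sum, Finset.mul_sum]
  refine Finset.sum_le_sum fun k hk => ?_
  have hk' : 2 * k ≤ n := by rw [Finset.mem_range] at hk; lia
  have hk2 : (2 * k : ℝ) ≤ n := by exact_mod_cast hk'
  have h0 : 0 ≤ (1 + n - 2 * k) * gegCoeff 1 ν n k :=
    mul_nonneg (by linarith) (gegCoeff_nonneg one_pos hν n k)
  rw [geg_one_one, mul_comm Real.pi, mul_comm ((n : ℝ) + 1), mul_assoc, mul_assoc _ Real.pi,
    mul_comm Real.pi]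
  refine mul_le_mul_of_nonneg_left (mul_le_mul_of_nonneg_right ?_ Real.pi_pos.le) h0
  rw [Nat.cast_sub hk']
  push_cast
  linarith [(by positivity : (0 : ℝ) ≤ k)]

theorem geg_eval_one_succ (κ : ℝ) (m : ℕ) :
    (m + 1) * geg κ (m + 1 : ℕ) 1 = (m + 2 * κ) * geg κ m 1 := by
  induction m with
  | zero => simp
  | succ m ih =>
    have h := geg_rec κ m 1
    push_cast at h ih ⊢
    rw [add_assoc (m : ℤ), one_add_one_eq_two]
    linarith

theorem geg_eval_one_eq_choose (d m : ℕ) :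
    geg (d / 2 + 1) m 1 = (m + d + 1).choose (d + 1) := by
  induction m with
  | zero => simp
  | succ m ih =>
    have h := geg_eval_one_succ (d / 2 + 1) m
    rw [ih] at h
    have h2 := Nat.choose_mul_succ_eq (m + d + 1) (d + 1)
    rw [show m + d + 1 + 1 - (d + 1) = m + 1 by lia] at h2
    have h3 : ((m + d + 1).choose (d + 1) : ℝ) * (m + d + 2)
        = (m + 1 + d + 1).choose (d + 1) * (m + 1) := by
      rw [show m + 1 + d + 1 = m + d + 1 + 1 by ring]
      exact_mod_cast h2
    have h4 : ((m : ℝ) + 1) ≠ 0 := by positivity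
    refine mul_left_cancel₀ h4 (h.trans ?_)
    linarith

theorem le_geg_eval_one (d m : ℕ) :
    (m + 1 : ℝ) ^ (d + 1) / (d + 1).factorial ≤ geg (d / 2 + 1) m 1 := by
  rw [geg_eval_one_eq_choose]
  have h := Nat.pow_le_choose (α := ℝ) (d + 1) (m + d + 1)
  rw [show m + d + 1 + 1 - (d + 1) = m + 1 by lia] at h
  exact_mod_cast h

theorem geg_eval_one_le (d m : ℕ) : geg (d / 2 + 1) m 1 ≤ (m + d + 1 : ℝ) ^ (d + 1) := by
  rw [geg_eval_one_eq_choose]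
  exact_mod_cast Nat.choose_le_pow (m + d + 1) (d + 1)

theorem zonal_eq_add (ν : ℝ) {n : ℕ} (hn : 1 ≤ n) (u : ℝ) :
    zonal ν n u = geg ν n u + geg ν (n - 1 : ℕ) u := by
  rw [zonal, Nat.cast_sub hn, Nat.cast_one]

theorem abs_zonal_le (d : ℕ) {n : ℕ} (hn : 1 ≤ n) {u : ℝ} (hu : |u| ≤ 1) :
    |zonal (d / 2 + 1) n u| ≤ 2 * (d + 2 : ℝ) ^ (d + 1) * n ^ (d + 1) := by
  have hν : (1 : ℝ) ≤ d / 2 + 1 := by linarith [(by positivity : (0 : ℝ) ≤ d / 2)]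
  have hb : ∀ m ≤ n, |geg (d / 2 + 1) m u| ≤ ((d + 2) * n : ℝ) ^ (d + 1) := by
    intro m hm
    refine (abs_geg_le hν m hu).trans ((geg_eval_one_le d m).trans ?_)
    have h1 : (m : ℝ) ≤ n := by exact_mod_cast hm
    have h2 : (1 : ℝ) ≤ n := by exact_mod_cast hn
    refine pow_le_pow_left₀ (by positivity) ?_ _
    nlinarith [(by positivity : (0 : ℝ) ≤ d)]
  rw [zonal_eq_add _ hn]
  refine (abs_add_le _ _).trans ?_
  have h1 := hb n le_rfl
  have h2 := hb (n - 1) (by lia)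
  rw [mul_pow] at h1 h2
  linarith

theorem le_zonal_one (d : ℕ) {n : ℕ} (hn : 1 ≤ n) :
    (n : ℝ) ^ (d + 1) / (d + 1).factorial ≤ zonal (d / 2 + 1) n 1 := by
  have h1 := le_geg_eval_one d n
  have h2 := le_geg_eval_one d (n - 1)
  have h3 : (0 : ℝ) ≤ ((n - 1 : ℕ) + 1 : ℝ) ^ (d + 1) / (d + 1).factorial := by positivity
  have h4 : (n : ℝ) ^ (d + 1) / (d + 1).factorial ≤ (n + 1 : ℝ) ^ (d + 1) / (d + 1).factorial := by
    gcongr; linarith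
  rw [zonal_eq_add _ hn]
  linarith

theorem le_integral_zonal_cos (d : ℕ) {n : ℕ} (hn : 1 ≤ n) :
    Real.pi / (d + 1).factorial * (n : ℝ) ^ d
      ≤ ∫ φ in (0 : ℝ)..Real.pi, zonal (d / 2 + 1) n (Real.cos φ) := by
  have hν : (1 : ℝ) ≤ d / 2 + 1 := by linarith [(by positivity : (0 : ℝ) ≤ d / 2)]
  have hm : ∀ m : ℕ, Even m → n ≤ m + 1 → Real.pi / (d + 1).factorial * (n : ℝ) ^ d
      ≤ ∫ φ in (0 : ℝ)..Real.pi, geg (d / 2 + 1) m (Real.cos φ) := by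
    intro m he hnm
    have h1 := le_integral_geg_cos hν he
    have h2 := mul_le_mul_of_nonneg_left (le_geg_eval_one d m) Real.pi_pos.le
    have h3 : (0 : ℝ) < m + 1 := by positivity
    have h4 : (n : ℝ) ^ d ≤ (m + 1 : ℝ) ^ d := pow_le_pow_left₀ (by positivity) (by exact_mod_cast hnm) d
    refine (mul_le_mul_of_nonneg_left h4 (by positivity)).trans (le_of_mul_le_mul_left ?_ h3)
    refine le_trans (le_of_eq ?_) (h2.trans h1)
    rw [pow_succ]; ring
  simp only [zonal_eq_add _ hn]
  rw [intervalIntegral.integral_add ((continuous_geg_cos _ _).intervalIntegrable _ _)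
    ((continuous_geg_cos _ _).intervalIntegrable _ _)]
  -- One of `n`, `n - 1` is even and carries the bound; the other contributes a nonnegative
  -- integral.
  rcases Nat.even_or_odd n with he | ho
  · linarith [hm n he (by lia), integral_geg_cos_nonneg hν (n - 1)]
  · linarith [hm (n - 1) (Nat.Odd.sub_odd ho odd_one) (by lia), integral_geg_cos_nonneg hν n]

end ZonalBounds

/-! ### Extremal characterization and comparison of points. -/

section Comparison

variable {d : ℕ}

theorem christoffelC_nonneg (n : ℕ) (x : RSpace d) :
    0 ≤ christoffelC (polySpace n d) (unitBall d) volume x := by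
  obtain ⟨N, ψ, hψ⟩ := exists_isOrthonormalBasisOn_polySpace n d
  rw [christoffelC_eq hψ]
  exact Finset.sum_nonneg fun k _ => sq_nonneg _

theorem sq_le_christoffelC_mul {n : ℕ} {f : RSpace d → ℝ} (hf : f ∈ polySpace n d) (x : RSpace d) :
    f x ^ 2 ≤ christoffelC (polySpace n d) (unitBall d) volume x * ∫ y in unitBall d, f y ^ 2 := by
  obtain ⟨N, ψ, hψ⟩ := exists_isOrthonormalBasisOn_polySpace n d
  obtain ⟨a, ha⟩ := (Submodule.mem_span_range_iff_exists_fun ℝ).1 (hψ.span_eq.symm ▸ hf)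
  have hfa : ∀ y, f y = ∑ j, a j * ψ j y := fun y => by simpa using (congrFun ha y).symm
  simp only [hfa, hψ.integral_sq, christoffelC_eq hψ]
  rw [mul_comm]
  exact Finset.sum_mul_sq_le_sq_mul_sq _ _ _

theorem exists_extremal (n : ℕ) (x : RSpace d) : ∃ f ∈ polySpace n d,
    f x = christoffelC (polySpace n d) (unitBall d) volume x ∧
    ∫ y in unitBall d, f y ^ 2 = christoffelC (polySpace n d) (unitBall d) volume x := by
  obtain ⟨N, ψ, hψ⟩ := exists_isOrthonormalBasisOn_polySpace n d
  refine ⟨fun y => ∑ k, ψ k x * ψ k y, sum_mem_polySpace _ fun k _ => Submodule.smul_mem _ _ ?_, ?_, ?_⟩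
  · rw [← hψ.span_eq]; exact Submodule.subset_span ⟨k, rfl⟩
  · rw [christoffelC_eq hψ]
    exact Finset.sum_congr rfl fun k _ => (sq _).symm
  · rw [hψ.integral_sq, christoffelC_eq hψ]

theorem integral_comp_affine_le {g : RSpace d → ℝ} (hg : Continuous g) (hg0 : ∀ y, 0 ≤ g y)
    {x : RSpace d} {ρ : ℝ} (hρ : 0 < ρ) (hxρ : ‖x‖ + ρ ≤ 1) :
    ∫ y in unitBall d, g (x + ρ • y) ≤ (ρ ^ d)⁻¹ * ∫ y in unitBall d, g y := by
  have hi : Integrable ((unitBall d).indicator g) :=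
    (hg.continuousOn.integrableOn_compact (isCompact_closedBall _ _)).integrable_indicator
      measurableSet_closedBall
  have h := Measure.integral_comp_smul volume (fun y => (unitBall d).indicator g (x + y)) ρ
  rw [integral_add_left_eq_self, finrank_euclideanSpace, Fintype.card_fin,
    integral_indicator measurableSet_closedBall, abs_of_pos (by positivity), smul_eq_mul] at h
  rw [← h]
  have hi2 : Integrable fun y => (unitBall d).indicator g (x + ρ • y) :=
    (integrable_comp_smul_iff volume (fun y => (unitBall d).indicator g (x + y)) hρ.ne').2
      (hi.comp_add_left x)
  rw [setIntegral_congr_fun (g := fun y => (unitBall d).indicator g (x + ρ • y))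
    measurableSet_closedBall]
  · exact setIntegral_le_integral hi2
      (Filter.Eventually.of_forall fun y => Set.indicator_nonneg (fun y _ => hg0 y) _)
  · intro y hy
    refine (Set.indicator_of_mem (s := unitBall d) ?_ g).symm
    rw [mem_closedBall_zero_iff] at hy ⊢
    refine (norm_add_le _ _).trans (le_trans ?_ hxρ)
    rw [norm_smul, Real.norm_of_nonneg hρ.le]
    nlinarith

/-- The extremal polynomial at `x + ρw`, pulled back by `y ↦ x + ρy`, competes at `w`; its norm over
the smaller ball is at most that over the unit ball. -/
theorem christoffelC_affine_le (n : ℕ) {x : RSpace d} {ρ : ℝ} (hρ : 0 < ρ) (hxρ : ‖x‖ + ρ ≤ 1)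
    (w : RSpace d) : christoffelC (polySpace n d) (unitBall d) volume (x + ρ • w)
      ≤ (ρ ^ d)⁻¹ * christoffelC (polySpace n d) (unitBall d) volume w := by
  obtain ⟨f, hf, hfx, hfi⟩ := exists_extremal n (x + ρ • w)
  have hw := christoffelC_nonneg n w
  have h0 := christoffelC_nonneg n (x + ρ • w)
  have h1 := sq_le_christoffelC_mul (comp_affine_mem_polySpace hf x ρ) w
  have h2 := integral_comp_affine_le ((continuous_of_mem_polySpace hf).pow 2)
    (fun y => sq_nonneg (f y)) hρ hxρ
  simp only [Pi.pow_apply] at h2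
  rw [hfi] at h2
  simp only [hfx] at h1
  rcases h0.eq_or_lt with h0 | h0
  · rw [← h0]; positivity
  · refine le_of_mul_le_mul_right ?_ h0
    rw [← sq]
    refine h1.trans ((mul_le_mul_of_nonneg_left h2 hw).trans (le_of_eq (by ring)))

theorem polySpace_le_span_monomials (n d : ℕ) : polySpace n d ≤ Submodule.span ℝ
    (Set.range fun (s : Fin d → Fin (n + 1)) (y : RSpace d) => ∏ i, y i ^ (s i : ℕ)) := by
  intro f hf
  obtain ⟨P, hP, rfl⟩ := mem_polySpace.1 hf
  have e : polyFun d P = ∑ s ∈ P.support, P.coeff s • fun y => ∏ i, y i ^ s i := by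
    funext y
    simp only [Finset.sum_apply, Pi.smul_apply, smul_eq_mul]
    exact MvPolynomial.eval_eq' _ _
  rw [e]
  refine Submodule.sum_mem _ fun s hs => Submodule.smul_mem _ _ (Submodule.subset_span
    ⟨fun i => ⟨s i, ?_⟩, rfl⟩)
  have h1 := MvPolynomial.monomial_le_degreeOf i hs
  have h2 := MvPolynomial.degreeOf_le_totalDegree P i
  lia

theorem IsOrthonormalBasisOn.card_le {n N : ℕ} {ψ : Fin N → RSpace d → ℝ}
    (hψ : IsOrthonormalBasisOn (polySpace n d) (unitBall d) volume ψ) : N ≤ (n + 1) ^ d := by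
  classical
  have hli : LinearIndependent ℝ ψ := by
    refine Fintype.linearIndependent_iff.2 fun a ha k => ?_
    have h := hψ.integral_sq a
    have h0 : ∀ y, ∑ j, a j * ψ j y = 0 := fun y => by simpa using congrFun ha y
    simp only [h0] at h
    rw [zero_pow two_ne_zero, integral_zero] at h
    exact pow_eq_zero_iff two_ne_zero |>.1
      ((Finset.sum_eq_zero_iff_of_nonneg fun j _ => sq_nonneg (a j)).1 h.symm k (Finset.mem_univ k))
  have h := linearIndependent_le_span' ψ hli (Set.range fun (s : Fin d → Fin (n + 1)) (y : RSpace d) =>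
    ∏ i, y i ^ (s i : ℕ)) ((Submodule.subset_span (R := ℝ)).trans
      (hψ.span_eq.le.trans (polySpace_le_span_monomials n d)))
  rw [Cardinal.mk_fin] at h
  have h2 := Fintype.card_range_le fun (s : Fin d → Fin (n + 1)) (y : RSpace d) => ∏ i, y i ^ (s i : ℕ)
  simp only [Fintype.card_fun, Fintype.card_fin] at h2
  exact (Nat.cast_le.1 h).trans h2

theorem christoffelC_zero_le_two_pow_mul (n : ℕ) {w : RSpace d} (hw : ‖w‖ ≤ 1) :
    christoffelC (polySpace n d) (unitBall d) volume 0
      ≤ 2 ^ d * christoffelC (polySpace n d) (unitBall d) volume w := by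
  -- The centre is the image of `w` under `y ↦ -w/2 + y/2`, which maps the unit ball into itself.
  have h := christoffelC_affine_le n (x := -((1 / 2 : ℝ) • w)) (ρ := 1 / 2) (by norm_num)
    (by rw [norm_neg, norm_smul]; norm_num; linarith) w
  rw [neg_add_cancel] at h
  simpa using h

/-- Up to `2^d` the centre has the least value, so that value is controlled by the average over the
ball; the integral is the dimension. -/
theorem christoffelC_zero_le (d n : ℕ) : christoffelC (polySpace n d) (unitBall d) volume 0
    ≤ 2 ^ d * (n + 1 : ℝ) ^ d / volume.real (unitBall d) := by
  obtain ⟨N, ψ, hψ⟩ := exists_isOrthonormalBasisOn_polySpace n d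
  have hN : (N : ℝ) ≤ (n + 1 : ℝ) ^ d := by exact_mod_cast hψ.card_le
  have hv : 0 < volume.real (unitBall d) :=
    ENNReal.toReal_pos (Metric.measure_closedBall_pos volume _ one_pos).ne'
      measure_closedBall_lt_top.ne
  have hii : ∀ k, IntegrableOn (fun w => ψ k w ^ 2) (unitBall d) := fun k => (hψ.memLp k).integrable_sq
  have hint : ∫ w in unitBall d, christoffelC (polySpace n d) (unitBall d) volume w = N := by
    simp only [christoffelC_eq hψ]
    rw [integral_finsetSum _ fun k _ => hii k]
    simp only [sq, hψ.orthonormal]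
    simp
  have hci : IntegrableOn (fun w => christoffelC (polySpace n d) (unitBall d) volume w) (unitBall d) := by
    simp only [christoffelC_eq hψ]
    exact integrable_finsetSum _ fun k _ => hii k
  rw [le_div_iff₀ hv]
  calc _ = ∫ w in unitBall d, christoffelC (polySpace n d) (unitBall d) volume (0 : RSpace d) := by
        rw [setIntegral_const, smul_eq_mul, mul_comm]
    _ ≤ ∫ w in unitBall d, 2 ^ d * christoffelC (polySpace n d) (unitBall d) volume w := by
        refine setIntegral_mono_on (integrableOn_const measure_closedBall_lt_top.ne)
          (hci.const_mul _) measurableSet_closedBall fun w hw =>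
            christoffelC_zero_le_two_pow_mul n (mem_closedBall_zero_iff.1 hw)
    _ = 2 ^ d * N := by rw [integral_const_mul, hint]
    _ ≤ _ := by gcongr

end Comparison

/-! ### Growth in `n` and the main theorem. -/

section Growth

variable {d : ℕ}

theorem christoffelC_le (hd : 1 ≤ d) {n : ℕ} (hn : 1 ≤ n) {x : RSpace d} (hx : ‖x‖ ≤ 1) :
    christoffelC (polySpace n d) (unitBall d) volume x
      ≤ Real.pi * (2 * (d + 2 : ℝ) ^ (d + 1)) / zonalConst d * n ^ (d + 1) := by
  rw [div_mul_eq_mul_div, le_div_iff₀ (zonalConst_pos d), mul_comm,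
    zonalConst_mul_christoffelC hd n hx]
  have h := intervalIntegral.norm_integral_le_of_norm_le_const (a := 0) (b := Real.pi)
    (f := fun φ => zonal (d / 2 + 1) n (‖x‖ ^ 2 + (1 - ‖x‖ ^ 2) * Real.cos φ))
    (C := 2 * (d + 2 : ℝ) ^ (d + 1) * n ^ (d + 1)) fun φ _ => by
      refine abs_zonal_le d hn (abs_le.2 ?_)
      have hr : ‖x‖ ^ 2 ≤ 1 := by nlinarith [norm_nonneg x]
      constructor <;> nlinarith [Real.neg_one_le_cos φ, Real.cos_le_one φ, sq_nonneg ‖x‖]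
  rw [sub_zero, abs_of_pos Real.pi_pos] at h
  refine (le_abs_self _).trans (h.trans (le_of_eq (by ring)))

theorem le_christoffelC_of_norm_eq_one (hd : 1 ≤ d) {n : ℕ} (hn : 1 ≤ n) {x : RSpace d}
    (hx : ‖x‖ = 1) : Real.pi / (d + 1).factorial / zonalConst d * n ^ (d + 1)
      ≤ christoffelC (polySpace n d) (unitBall d) volume x := by
  rw [div_mul_eq_mul_div, div_le_iff₀ (zonalConst_pos d), mul_comm (christoffelC _ _ _ _),
    zonalConst_mul_christoffelC hd n hx.le, hx]
  simp only [one_pow, sub_self, zero_mul, add_zero, intervalIntegral.integral_const, sub_zero,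
    smul_eq_mul]
  have h := mul_le_mul_of_nonneg_left (le_zonal_one d hn) Real.pi_pos.le
  exact le_trans (le_of_eq (by ring)) h

theorem le_christoffelC_zero (hd : 1 ≤ d) {n : ℕ} (hn : 1 ≤ n) :
    Real.pi / (d + 1).factorial / zonalConst d * n ^ d
      ≤ christoffelC (polySpace n d) (unitBall d) volume 0 := by
  rw [div_mul_eq_mul_div, div_le_iff₀ (zonalConst_pos d), mul_comm (christoffelC _ _ _ _),
    zonalConst_mul_christoffelC hd n (by simp)]
  have h := le_integral_zonal_cos d hn
  simpa using h

theorem christoffelC_le_of_norm_lt {a : ℝ} (ha : a < 1) {n : ℕ} (hn : 1 ≤ n) {x : RSpace d}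
    (hx : ‖x‖ < a) : christoffelC (polySpace n d) (unitBall d) volume x
      ≤ ((1 - a) ^ d)⁻¹ * (2 ^ d * 2 ^ d / volume.real (unitBall d)) * n ^ d := by
  have h := christoffelC_affine_le n (x := x) (ρ := 1 - a) (by linarith) (by linarith) 0
  rw [smul_zero, add_zero] at h
  rw [mul_assoc]
  refine h.trans (mul_le_mul_of_nonneg_left ((christoffelC_zero_le d n).trans ?_)
    (inv_nonneg.2 (pow_nonneg (by linarith) d)))
  rw [div_mul_eq_mul_div, mul_assoc, ← mul_pow 2 (n : ℝ)]
  have h2 : (1 : ℝ) ≤ n := by exact_mod_cast hn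
  gcongr
  linarith

theorem exists_const_of_bounds {A B : ℝ} (hA : 0 < A) : ∃ c : ℝ, 0 < c ∧ c⁻¹ ≤ A ∧ B ≤ c :=
  ⟨max A⁻¹ B, lt_max_of_lt_left (inv_pos.2 hA), inv_le_of_inv_le₀ hA (le_max_left _ _),
    le_max_right _ _⟩

end Growth

theorem mainTheorem9 (d : ℕ) (hd : 1 ≤ d) :
    -- `C(𝒫_n, B_2^d) ≈ n^{d+1}`
    (∃ c : ℝ, 0 < c ∧ ∀ n : ℕ, 1 ≤ n →
      c⁻¹ * (n : ℝ) ^ (d + 1) ≤ christoffelSup (polySpace n d) (unitBall d) ∧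
      christoffelSup (polySpace n d) (unitBall d) ≤ c * (n : ℝ) ^ (d + 1)) ∧
    -- `C(𝒫_n, B_2^d, x)` is an increasing function of `‖x‖` for `1/2 ≤ ‖x‖² ≤ 1`
    (∀ n : ℕ, 1 ≤ n → ∃ g : ℝ → ℝ,
      (∀ x : RSpace d, 1 / 2 ≤ ‖x‖ ^ 2 → ‖x‖ ^ 2 ≤ 1 →
        christoffelC (polySpace n d) (unitBall d) volume x = g ‖x‖) ∧
      (2 ≤ d → StrictMonoOn g {r : ℝ | 0 ≤ r ∧ 1 / 2 ≤ r ^ 2 ∧ r ^ 2 ≤ 1})) ∧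
    -- `C(𝒫_n, B_2^d, x) ≈ n^d` for `‖x‖ < a < 1`, with constants depending on `a`
    (∀ a : ℝ, a < 1 → ∃ c : ℝ, 0 < c ∧ ∀ n : ℕ, 1 ≤ n → ∀ x : RSpace d, ‖x‖ < a →
      c⁻¹ * (n : ℝ) ^ d ≤ christoffelC (polySpace n d) (unitBall d) volume x ∧
      christoffelC (polySpace n d) (unitBall d) volume x ≤ c * (n : ℝ) ^ d) := by

  have hk : 0 < Real.pi / (d + 1).factorial / zonalConst d := by
    have := zonalConst_pos d
    have := Real.pi_pos
    positivity
  refine ⟨?_, fun n hn => ⟨christoffelProfile d n, fun x _ hx => ?_, fun hd2 =>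
    strictMonoOn_christoffelProfile hd2 hn⟩, fun a ha => ?_⟩
  · obtain ⟨c, hc, hcl, hcu⟩ := exists_const_of_bounds
      (B := Real.pi * (2 * (d + 2 : ℝ) ^ (d + 1)) / zonalConst d) hk
    refine ⟨c, hc, fun n hn => ?_⟩
    have hu : ∀ x : unitBall d, christoffelC (polySpace n d) (unitBall d) volume (x : RSpace d)
        ≤ c * (n : ℝ) ^ (d + 1) := fun x =>
      (christoffelC_le hd hn (mem_closedBall_zero_iff.1 x.2)).trans
        (mul_le_mul_of_nonneg_right hcu (by positivity))
    have : Nonempty (unitBall d) := ⟨⟨0, by simp⟩⟩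
    refine ⟨?_, ciSup_le hu⟩
    -- A boundary point, where the lower bound of order `n^{d+1}` holds; it exists because `d ≥ 1`.
    have he : ‖(EuclideanSpace.single ⟨0, hd⟩ 1 : RSpace d)‖ = 1 := by simp
    refine le_ciSup_of_le ⟨_, Set.forall_mem_range.2 hu⟩
      ⟨EuclideanSpace.single ⟨0, hd⟩ 1, mem_closedBall_zero_iff.2 he.le⟩ ?_
    exact (mul_le_mul_of_nonneg_right hcl (by positivity)).trans
      (le_christoffelC_of_norm_eq_one hd hn he)
  · exact christoffelC_eq_profile hd n (by nlinarith [norm_nonneg x])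
  · obtain ⟨c, hc, hcl, hcu⟩ := exists_const_of_bounds
      (B := ((1 - a) ^ d)⁻¹ * (2 ^ d * 2 ^ d / volume.real (unitBall d)))
      -- The division by `2^d` is the price of passing from the centre to an arbitrary point.
      (div_pos hk (pow_pos two_pos d))
    refine ⟨c, hc, fun n hn x hx => ⟨?_, ?_⟩⟩
    · refine (mul_le_mul_of_nonneg_right hcl (by positivity)).trans ?_
      rw [div_mul_eq_mul_div, div_le_iff₀ (by positivity), mul_comm (christoffelC _ _ _ _)]
      exact (le_christoffelC_zero hd hn).trans
        (christoffelC_zero_le_two_pow_mul n (hx.le.trans ha.le))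
    · exact (christoffelC_le_of_norm_lt ha hn hx).trans
        (mul_le_mul_of_nonneg_right hcu (by positivity))
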